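/- **Computational model.** The input consists of $n\ge 2$ points $P_0,\dots,P_{n-1}\in\mathbb{R}^2$. An algorithm is a finite program, independent of $n$, for a random access machine that initially holds only the number $n$. The machine has finitely many variables and finitely many arrays holding natural numbers. Assigning a constant or a copy, adding, subtracting (truncated at $0$), reading or writing an array cell, comparing two variables, branching and looping are exact and cost one time step each. The points are accessible only through *noisy primitives*, each of which costs one time step and answers, for point indices $i,j,k,l$ held in variables, one of the questions $$x(P_i)\le x(P_j)?\qquad y(P_i)\le y(P_j)?\qquad \|P_i-P_j\|\le\|P_k-P_l\|?\qquad |x(P_i)-x(P_j)|\le\|P_k-P_l\|?$$ Each evaluation of a primitive, including repeated evaluations of the same question, returns the wrong answer with probability at most $p$, independently of all earlier questions and answers, and the correct answer otherwise. The error probability may differ between questions and between evaluations. (A question about an index that is not below $n$ has the correct answer "no".) **Theorem.** Let $0\le p<\tfrac12$ and $c\ge 1$ be constants. There are a program and a constant $C>0$, depending only on $p$ and $c$, such that for every $n\ge 2$, every choice of $n$ points in the plane (no general position is required), and all noisy primitives with error probabilities at most $p$, the following holds with probability at least $1-n^{-c}$: the program halts within $C\,n\log n$ time steps, and its output is a closest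 pair, that is, a pair of indices $i\ne j$ with $$\|P_i-P_j\|\le\|P_k-P_l\|\qquad\text{for all } k\ne l .$$ -/

import Mathlib

namespace NoisyGeometry

/-- The Euclidean plane. -/
abbrev Plane : Type := EuclideanSpace ℝ (Fin 2)

/-- The Boolean geometric primitives, with arguments of type `α` that designate input points:
comparison of two `x`-coordinates, comparison of two `y`-coordinates, comparison of two distances
determined by two pairs of points, and comparison of the horizontal gap between two points with
the distance between two points. -/
inductive Primitive (α : Type) : Type
  | xLe (i j : α) : Primitive α
  | yLe (i j : α) : Primitive α
  | distLe (i j k l : α) : Primitive α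
  | gapLe (i j k l : α) : Primitive α

namespace Primitive

/-- Apply a function to all arguments of a primitive. -/
def map {α β : Type} (f : α → β) : Primitive α → Primitive β
  | xLe i j => xLe (f i) (f j)
  | yLe i j => yLe (f i) (f j)
  | distLe i j k l => distLe (f i) (f j) (f k) (f l)
  | gapLe i j k l => gapLe (f i) (f j) (f k) (f l)

/-- The meaning of a primitive on the input points. -/
def Holds {n : ℕ} (P : Fin n → Plane) : Primitive (Fin n) → Prop
  | xLe i j => P i 0 ≤ P j 0
  | yLe i j => P i 1 ≤ P j 1
  | distLe i j k l => dist (P i) (P j) ≤ dist (P k) (P l)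
  | gapLe i j k l => |P i 0 - P j 0| ≤ dist (P k) (P l)

open Classical in
/-- The correct answer to a primitive whose arguments are numbers, read as indices of input
points; it is `false` if some argument is not the index of an input point. -/
noncomputable def answer {n : ℕ} (P : Fin n → Plane) (q : Primitive ℕ) : Bool :=
  decide (∃ q' : Primitive (Fin n), q'.map Fin.val = q ∧ q'.Holds P)

end Primitive

/-- Exact (noise-free) tests on the contents of two variables, given by their names. -/
inductive Test : Type
  | lt (x y : ℕ) : Test
  | le (x y : ℕ) : Test
  | eq (x y : ℕ) : Test
  | ne (x y : ℕ) : Test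

/-- The value of a test when the variables hold the numbers `v`. -/
def Test.eval (v : ℕ → ℕ) : Test → Bool
  | lt x y => decide (v x < v y)
  | le x y => decide (v x ≤ v y)
  | eq x y => decide (v x = v y)
  | ne x y => decide (v x ≠ v y)

/-- Programs of a random access machine, in structured form. Variables and arrays have fixed
names (natural numbers) in the program text, so a program uses finitely many of them. -/
inductive Program : Type
  /-- `x := a` for a constant `a` -/
  | const (x a : ℕ) : Program
  /-- `x := y` -/
  | copy (x y : ℕ) : Program
  /-- `x := y + z` -/
  | add (x y z : ℕ) : Program
  /-- `x := y - z`, truncated at zero -/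
  | sub (x y z : ℕ) : Program
  /-- `x := A[y]` for the array `A` -/
  | load (x A y : ℕ) : Program
  /-- `A[y] := x` for the array `A` -/
  | store (A y x : ℕ) : Program
  /-- `x := 1` or `x := 0` according to the noisy answer to the primitive `q`, whose arguments
  are the point indices that are held in the named variables -/
  | query (x : ℕ) (q : Primitive ℕ) : Program
  /-- sequential composition -/
  | seq (c d : Program) : Program
  /-- `if b then c else d` -/
  | ite (b : Test) (c d : Program) : Program
  /-- `while b do c` -/
  | loop (b : Test) (c : Program) : Program

/-- A configuration of the machine: the program pieces that are still to be executed (a stack,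
first piece first), the contents of the variables, the contents of the arrays, and the number of
primitives evaluated so far (which the program cannot read). -/
structure Config : Type where
  todo : List Program
  var : ℕ → ℕ
  arr : ℕ → ℕ → ℕ
  calls : ℕ

namespace Config

/-- The initial configuration on `n` points: variable `0` holds `n`, all else holds `0`. -/
def init (prog : Program) (n : ℕ) : Config where
  todo := [prog]
  var := Function.update (fun _ => 0) 0 n
  arr := fun _ _ => 0
  calls := 0

/-- Replace the rest of the program. -/
def goto (s : Config) (k : List Program) : Config := { s with todo := k }

/-- Write `a` into variable `x` and continue with `k`. -/
def assign (s : Config) (x a : ℕ) (k : List Program) : Config :=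
  { s with todo := k, var := Function.update s.var x a }

/-- Write `a` into cell `i` of array `A` and continue with `k`. -/
def write (s : Config) (A i a : ℕ) (k : List Program) : Config :=
  { s with todo := k, arr := Function.update s.arr A (Function.update (s.arr A) i a) }

/-- The result of a primitive `q` (a source text with named variables) with target variable `x`;
the answer is wrong exactly if `e = true`. -/
noncomputable def receive {n : ℕ} (P : Fin n → Plane) (s : Config) (x : ℕ) (q : Primitive ℕ)
    (k : List Program) (e : Bool) : Config where
  todo := k
  var := Function.update s.var x (xor e ((q.map s.var).answer P)).toNat
  arr := s.arr
  calls := s.calls + 1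

/-- No program piece is left. -/
def Halted (s : Config) : Prop := s.todo = []

end Config

/-- A noise model: `ν k q` is the law of the error bit (`true` means a wrong answer) of the
primitive evaluation number `k`, if this is an evaluation of the primitive `q`. -/
abbrev Noise : Type := ℕ → Primitive ℕ → PMF Bool

/-- Every answer is wrong with probability at most `p`. -/
def Noise.ErrorAtMost (ν : Noise) (p : ℝ) : Prop :=
  ∀ (k : ℕ) (q : Primitive ℕ), ν k q true ≤ ENNReal.ofReal p

/-- One step of the machine, of unit cost. Every primitive draws a fresh error bit. A halted
configuration does not change any more. -/
noncomputable def step {n : ℕ} (P : Fin n → Plane) (ν : Noise) (s : Config) : PMF Config :=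
  match s.todo with
  | [] => PMF.pure s
  | .const x a :: k => PMF.pure (s.assign x a k)
  | .copy x y :: k => PMF.pure (s.assign x (s.var y) k)
  | .add x y z :: k => PMF.pure (s.assign x (s.var y + s.var z) k)
  | .sub x y z :: k => PMF.pure (s.assign x (s.var y - s.var z) k)
  | .load x A y :: k => PMF.pure (s.assign x (s.arr A (s.var y)) k)
  | .store A y x :: k => PMF.pure (s.write A (s.var y) (s.var x) k)
  | .query x q :: k => (ν s.calls (q.map s.var)).map (s.receive P x q k)
  | .seq c d :: k => PMF.pure (s.goto (c :: d :: k))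
  | .ite b c d :: k => PMF.pure (s.goto ((if b.eval s.var then c else d) :: k))
  | .loop b c :: k => PMF.pure (s.goto (if b.eval s.var then c :: .loop b c :: k else k))

/-- The law of the configuration after `t` steps on the input points `P`. -/
noncomputable def run {n : ℕ} (prog : Program) (P : Fin n → Plane) (ν : Noise) :
    ℕ → PMF Config
  | 0 => PMF.pure (Config.init prog n)
  | t + 1 => (run prog P ν t).bind (step P ν)

/-- `i` and `j` are the indices of a closest pair among the points `P`. -/
def IsClosestPair {n : ℕ} (P : Fin n → Plane) (i j : Fin n) : Prop :=
  i ≠ j ∧ ∀ k l : Fin n, k ≠ l → dist (P i) (P j) ≤ dist (P k) (P l)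

/-- The machine has halted and the variables `0` and `1` hold the indices of a closest pair. -/
def HasFoundClosestPair {n : ℕ} (P : Fin n → Plane) (s : Config) : Prop :=
  s.Halted ∧ ∃ i j : Fin n, s.var 0 = i ∧ s.var 1 = j ∧ IsClosestPair P i j

end NoisyGeometry

/-! Repeating every comparison of an ordinary algorithm about log n times would cost n (log n)^2.
The proof avoids this by noting that only linearly many questions need individually reliable
answers. The remaining Θ(n log n) comparisons serve to sort, and there noise is absorbed by a search
that can backtrack.

Randomness is isolated first. For a fixed sequence of error bits the machine is deterministic
(`detStep`). Calls are grouped into blocks of r, one block per majority vote, and a block is bad if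
at least half of its bits are errors. The sequence is `Reliable r m` if every window of 16 m
consecutive blocks has fewer than m bad ones. Although questions are chosen adaptively, an
exponential-moment argument (`expect_prod_bitWeight_le`) bounds the mean weight of any fixed set of
calls as if they were independent. A union bound over windows and over m-element sets of bad blocks
(`expect_badWindow_le`, `failure_le`) then bounds the failure probability by (t + 1) (2^16 μ^r)^m,
where μ < 1 is the mean weight `meanWeight`. With r a large constant and m = K ℓ, where 2^ℓ is the
least power of two that is at least n, this is at most n^{-c} for a suitable constant K.

It remains to prove, with a weakest-precondition calculus that also counts steps, that the program
succeeds on every reliable sequence.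

Sorting: the points are inserted into a 2-3 tree. The search for a place walks along the tree; at
every node it checks by two votes whether the key lies between the bounds of the subtree, and it
goes up if not. At a leaf it collects confirmations instead of going down. A potential falls by one
with every correct step and rises by at most one with a wrong one; since a fixed fraction of the
votes is correct, O(log n) steps end at the right leaf (`wp_walk`). The insertion itself is
noise-free (`wp_zipBuild`, `wp_insert`).

Sweep: the points are processed by increasing x-coordinate, with δ the least distance so far. Points
more than δ to the left are discarded, and the others are active. Active points have mutual
distances at least δ, so a δ-by-δ square contains at most four of them. Hence only the four active
neighbours on either side in the vertical order have to be compared with the new point (`wp_check`).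
The neighbours come from a noise-free tree of maxima: each point is marked with the time of its
insertion, so a whole prefix is discarded by raising a threshold. Each sweep step raises the number
of processed or of discarded points, so there are at most 2 n steps with at most nine reliable
questions each, and every such question is settled by a majority of 16 m votes (`wp_sure`). -/

open scoped ENNReal

namespace NoisyGeometry

/-! ### Execution on fixed error bits, and weakest preconditions with a clock -/

/-- The step of the machine on a fixed sequence `e` of error bits. -/
noncomputable def detStep {n : ℕ} (P : Fin n → Plane) (e : ℕ → Bool) (s : Config) : Config :=
  match s.todo with
  | [] => s
  | .const x a :: k => s.assign x a k
  | .copy x y :: k => s.assign x (s.var y) k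
  | .add x y z :: k => s.assign x (s.var y + s.var z) k
  | .sub x y z :: k => s.assign x (s.var y - s.var z) k
  | .load x A y :: k => s.assign x (s.arr A (s.var y)) k
  | .store A y x :: k => s.write A (s.var y) (s.var x) k
  | .query x q :: k => s.receive P x q k (e s.calls)
  | .seq c d :: k => s.goto (c :: d :: k)
  | .ite b c d :: k => s.goto ((if b.eval s.var then c else d) :: k)
  | .loop b c :: k => s.goto (if b.eval s.var then c :: .loop b c :: k else k)

/-- The data part of a configuration, together with a clock. -/
structure Mem : Type where
  var : ℕ → ℕ
  arr : ℕ → ℕ → ℕ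
  calls : ℕ
  time : ℕ

namespace Mem

/-- The configuration with data `m` and remaining program `k`. -/
def cfg (m : Mem) (k : List Program) : Config := ⟨k, m.var, m.arr, m.calls⟩

/-- Let one time step pass. -/
def tick (m : Mem) : Mem := { m with time := m.time + 1 }

/-- Write a variable. -/
def set (m : Mem) (x a : ℕ) : Mem := ⟨Function.update m.var x a, m.arr, m.calls, m.time + 1⟩

/-- Write an array cell. -/
def put (m : Mem) (A i a : ℕ) : Mem :=
  ⟨m.var, Function.update m.arr A (Function.update (m.arr A) i a), m.calls, m.time + 1⟩

/-- Receive the answer to a primitive. -/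
noncomputable def get {n : ℕ} (P : Fin n → Plane) (e : ℕ → Bool) (m : Mem) (x : ℕ)
    (q : Primitive ℕ) : Mem :=
  ⟨Function.update m.var x (xor (e m.calls) ((q.map m.var).answer P)).toNat, m.arr,
    m.calls + 1, m.time + 1⟩

@[simp] theorem tick_var (m : Mem) : m.tick.var = m.var := rfl
@[simp] theorem tick_arr (m : Mem) : m.tick.arr = m.arr := rfl
@[simp] theorem tick_calls (m : Mem) : m.tick.calls = m.calls := rfl
@[simp] theorem tick_time (m : Mem) : m.tick.time = m.time + 1 := rfl
@[simp] theorem set_var (m : Mem) (x a y : ℕ) :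
    (m.set x a).var y = if y = x then a else m.var y := by
  simp [set, Function.update_apply]
@[simp] theorem set_arr (m : Mem) (x a : ℕ) : (m.set x a).arr = m.arr := rfl
@[simp] theorem set_calls (m : Mem) (x a : ℕ) : (m.set x a).calls = m.calls := rfl
@[simp] theorem set_time (m : Mem) (x a : ℕ) : (m.set x a).time = m.time + 1 := rfl
@[simp] theorem put_var (m : Mem) (A i a : ℕ) : (m.put A i a).var = m.var := rfl
@[simp] theorem put_arr (m : Mem) (A i a B j : ℕ) :
    (m.put A i a).arr B j = if B = A ∧ j = i then a else m.arr B j := by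
  simp only [put, Function.update_apply]
  by_cases h : B = A
  · subst h; simp [Function.update_apply]
  · simp [h]
@[simp] theorem put_calls (m : Mem) (A i a : ℕ) : (m.put A i a).calls = m.calls := rfl
@[simp] theorem put_time (m : Mem) (A i a : ℕ) : (m.put A i a).time = m.time + 1 := rfl

end Mem

section Semantics

variable {n : ℕ} (P : Fin n → Plane) (e : ℕ → Bool)

/-- Started on data `m`, the program `c` terminates with data that satisfy `Q`; the clock counts
the steps. -/
def Runs (c : Program) (m : Mem) (Q : Mem → Prop) : Prop :=
  ∃ t m', Q m' ∧ m'.time = m.time + t ∧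
    ∀ k, (detStep P e)^[t] (m.cfg (c :: k)) = m'.cfg k

variable {P e}

theorem Runs.mono {c : Program} {m : Mem} {Q Q' : Mem → Prop} (h : Runs P e c m Q)
    (hQ : ∀ m', Q m' → Q' m') : Runs P e c m Q' := by
  obtain ⟨t, m', h1, h2, h3⟩ := h
  exact ⟨t, m', hQ _ h1, h2, h3⟩

theorem Runs.seq {c d : Program} {m : Mem} {Q : Mem → Prop}
    (h : Runs P e c m.tick fun m' => Runs P e d m' Q) : Runs P e (.seq c d) m Q := by
  obtain ⟨t, m', ⟨t', m'', h1, h2, h3⟩, h4, h5⟩ := h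
  refine ⟨t' + (t + 1), m'', h1, ?_, fun k => ?_⟩
  · simp at h4; omega
  · rw [Function.iterate_add_apply, Function.iterate_add_apply]
    have : (detStep P e)^[1] (m.cfg (.seq c d :: k)) = m.tick.cfg (c :: d :: k) := rfl
    rw [this, h5, h3]

theorem Runs.ite {b : Test} {c d : Program} {m : Mem} {Q : Mem → Prop}
    (h : b.eval m.var = true → Runs P e c m.tick Q)
    (h' : b.eval m.var = false → Runs P e d m.tick Q) : Runs P e (.ite b c d) m Q := by
  cases hb : b.eval m.var with
  | true =>
    obtain ⟨t, m', h1, h2, h3⟩ := h hb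
    refine ⟨t + 1, m', h1, ?_, fun k => ?_⟩
    · simp at h2; omega
    · rw [Function.iterate_add_apply]
      have : (detStep P e)^[1] (m.cfg (.ite b c d :: k)) = m.tick.cfg (c :: k) := by
        simp [detStep, Mem.cfg, Config.goto, hb]
      rw [this, h3]
  | false =>
    obtain ⟨t, m', h1, h2, h3⟩ := h' hb
    refine ⟨t + 1, m', h1, ?_, fun k => ?_⟩
    · simp at h2; omega
    · rw [Function.iterate_add_apply]
      have : (detStep P e)^[1] (m.cfg (.ite b c d :: k)) = m.tick.cfg (d :: k) := by
        simp [detStep, Mem.cfg, Config.goto, hb]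
      rw [this, h3]

theorem Runs.loop_exit {b : Test} {c : Program} {m : Mem} {Q : Mem → Prop}
    (hb : b.eval m.var = false) (h : Q m.tick) : Runs P e (.loop b c) m Q :=
  ⟨1, m.tick, h, rfl, fun k => by simp [detStep, Mem.cfg, Config.goto, hb]⟩

theorem Runs.loop_step {b : Test} {c : Program} {m : Mem} {Q : Mem → Prop}
    (hb : b.eval m.var = true)
    (h : Runs P e c m.tick fun m' => Runs P e (.loop b c) m' Q) :
    Runs P e (.loop b c) m Q := by
  obtain ⟨t, m', ⟨t', m'', h1, h2, h3⟩, h4, h5⟩ := h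
  refine ⟨t' + (t + 1), m'', h1, ?_, fun k => ?_⟩
  · simp at h4; omega
  · rw [Function.iterate_add_apply, Function.iterate_add_apply]
    have : (detStep P e)^[1] (m.cfg (.loop b c :: k)) = m.tick.cfg (c :: .loop b c :: k) := by
      simp [detStep, Mem.cfg, Config.goto, hb]
    rw [this, h5, h3]

variable (P e)

/-- Weakest preconditions of programs; loops are left to their semantics. -/
def wp : Program → (Mem → Prop) → Mem → Prop
  | .const x a, Q, m => Q (m.set x a)
  | .copy x y, Q, m => Q (m.set x (m.var y))
  | .add x y z, Q, m => Q (m.set x (m.var y + m.var z))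
  | .sub x y z, Q, m => Q (m.set x (m.var y - m.var z))
  | .load x A y, Q, m => Q (m.set x (m.arr A (m.var y)))
  | .store A y x, Q, m => Q (m.put A (m.var y) (m.var x))
  | .query x q, Q, m => Q (m.get P e x q)
  | .seq c d, Q, m => wp c (wp d Q) m.tick
  | .ite b c d, Q, m =>
    (b.eval m.var = true → wp c Q m.tick) ∧ (b.eval m.var = false → wp d Q m.tick)
  | .loop b c, Q, m => Runs P e (.loop b c) m Q

variable {P e}

theorem Runs.of_wp {c : Program} : ∀ {m : Mem} {Q : Mem → Prop}, wp P e c Q m →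
    Runs P e c m Q := by
  induction c with
  | seq c d ihc ihd => intro m Q h; exact Runs.seq ((ihc h).mono fun _ h' => ihd h')
  | ite b c d ihc ihd =>
    intro m Q h; exact Runs.ite (fun hb => ihc (h.1 hb)) (fun hb => ihd (h.2 hb))
  | loop b c _ => intro m Q h; exact h
  | _ => intro m Q h; exact ⟨1, _, h, rfl, fun k => rfl⟩

/-- Loop rule: `I f` is the invariant when at most `f` iterations are left. -/
theorem wp.loop {b : Test} {c : Program} {Q : Mem → Prop} (I : ℕ → Mem → Prop)
    (hstep : ∀ f m, I f m → b.eval m.var = true →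
      ∃ f', f = f' + 1 ∧ wp P e c (I f') m.tick)
    (hexit : ∀ f m, I f m → b.eval m.var = false → Q m.tick) :
    ∀ (f : ℕ) (m : Mem), I f m → wp P e (.loop b c) Q m := by
  intro f
  induction f with
  | zero =>
    intro m hI
    cases hb : b.eval m.var with
    | true => obtain ⟨f', h, _⟩ := hstep _ _ hI hb; omega
    | false => exact Runs.loop_exit hb (hexit _ _ hI hb)
  | succ f ih =>
    intro m hI
    cases hb : b.eval m.var with
    | true =>
      obtain ⟨f', h, h'⟩ := hstep _ _ hI hb
      obtain rfl : f' = f := by omega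
      exact Runs.loop_step hb ((Runs.of_wp h').mono fun m' hm' => ih m' hm')
    | false => exact Runs.loop_exit hb (hexit _ _ hI hb)

end Semantics

/-- Execute a list of programs one after the other. -/
def seqs : List Program → Program
  | [] => .copy 0 0
  | [c] => c
  | c :: d :: l => .seq c (seqs (d :: l))

attribute [simp] wp seqs


/-! ### Expectations under discrete distributions -/

section Expectation

variable {α β : Type*}

/-- The expectation of a nonnegative function. -/
noncomputable def expect (p : PMF α) (F : α → ℝ≥0∞) : ℝ≥0∞ := ∑' a, p a * F a

theorem expect_pure (a : α) (F : α → ℝ≥0∞) : expect (PMF.pure a) F = F a := by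
  rw [expect, tsum_eq_single a]
  · simp
  · intro b hb; simp [PMF.pure_apply, hb]

theorem expect_bind (p : PMF α) (f : α → PMF β) (F : β → ℝ≥0∞) :
    expect (p.bind f) F = expect p fun a => expect (f a) F := by
  simp only [expect, PMF.bind_apply, ← ENNReal.tsum_mul_right, ← ENNReal.tsum_mul_left]
  rw [ENNReal.tsum_comm]
  simp only [mul_assoc]

theorem expect_map (p : PMF α) (f : α → β) (F : β → ℝ≥0∞) :
    expect (p.map f) F = expect p fun a => F (f a) := by
  rw [← PMF.bind_pure_comp, expect_bind]
  simp [expect_pure]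

theorem expect_mono (p : PMF α) {F G : α → ℝ≥0∞} (h : ∀ a ∈ p.support, F a ≤ G a) :
    expect p F ≤ expect p G := by
  refine ENNReal.tsum_le_tsum fun a => ?_
  by_cases ha : p a = 0
  · simp [ha]
  · exact mul_le_mul_right (h a ((p.mem_support_iff a).2 ha)) _

theorem expect_sum {ι : Type*} (p : PMF α) (s : Finset ι) (F : ι → α → ℝ≥0∞) :
    expect p (fun a => ∑ i ∈ s, F i a) = ∑ i ∈ s, expect p (F i) := by
  simp only [expect, Finset.mul_sum]
  rw [Summable.tsum_finsetSum fun _ _ => ENNReal.summable]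

theorem toOuterMeasure_eq_expect (p : PMF α) (s : Set α) :
    p.toOuterMeasure s = expect p (s.indicator 1) := by
  rw [PMF.toOuterMeasure_apply, expect]
  congr 1; ext a
  by_cases h : a ∈ s <;> simp [h]

theorem expect_bool (p : PMF Bool) (F : Bool → ℝ≥0∞) :
    expect p F = p true * F true + p false * F false := by
  simp [expect, tsum_fintype]

end Expectation

/-! ### Runs with recorded error bits -/

section History

variable {n : ℕ} (P : Fin n → Plane) (ν : Noise)

/-- One step of the machine that also records the error bit. -/
noncomputable def historyStep (z : Config × (ℕ → Bool)) : PMF (Config × (ℕ → Bool)) :=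
  match z.1.todo with
  | .query x q :: k => (ν z.1.calls (q.map z.1.var)).map fun b =>
      (z.1.receive P x q k b, Function.update z.2 z.1.calls b)
  | _ => PMF.pure (detStep P z.2 z.1, z.2)

/-- The machine with a record of all error bits. -/
noncomputable def historyRun (prog : Program) : ℕ → PMF (Config × (ℕ → Bool))
  | 0 => PMF.pure (Config.init prog n, fun _ => false)
  | t + 1 => (historyRun prog t).bind (historyStep P ν)

/-- Only a primitive consumes randomness. Every other step is deterministic, ignores the error bits
and leaves the call counter alone. -/
theorem historyStep_cases (s : Config) (h : ℕ → Bool) :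
    (∃ x q k, s.todo = .query x q :: k ∧ historyStep P ν (s, h) =
      (ν s.calls (q.map s.var)).map fun b =>
        (s.receive P x q k b, Function.update h s.calls b)) ∨
    (historyStep P ν (s, h) = PMF.pure (detStep P h s, h) ∧
      (∀ h', detStep P h' s = detStep P h s) ∧ (detStep P h s).calls = s.calls ∧
      step P ν s = PMF.pure (detStep P h s)) := by
  obtain ⟨todo, var, arr, calls⟩ := s
  rcases todo with _ | ⟨c, k⟩
  · right; exact ⟨rfl, fun _ => rfl, rfl, rfl⟩
  · cases c with
    | query x q => left; exact ⟨x, q, k, rfl, rfl⟩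
    | _ => right; exact ⟨rfl, fun _ => rfl, rfl, rfl⟩

theorem historyStep_map_fst (z : Config × (ℕ → Bool)) :
    (historyStep P ν z).map Prod.fst = step P ν z.1 := by
  obtain ⟨s, h⟩ := z
  rcases historyStep_cases P ν s h with ⟨x, q, k, h1, h2⟩ | ⟨h1, -, -, h2⟩
  · rw [h2, PMF.map_comp, step, h1]; rfl
  · rw [h1, PMF.pure_map, h2]

theorem historyRun_map_fst (prog : Program) (t : ℕ) :
    (historyRun P ν prog t).map Prod.fst = run prog P ν t := by
  induction t with
  | zero => simp [historyRun, run, PMF.pure_map]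
  | succ t ih =>
    rw [historyRun, run, ← ih, PMF.map_bind, PMF.bind_map]
    congr 1; ext1 z
    exact historyStep_map_fst P ν z

/-- A run with a given number of calls has read only the bits below that number, so it is reproduced
by any sequence that agrees with the record there. This freedom in `h'` is needed in the induction,
because the next call overwrites one later entry of the record. Unread entries keep the default
`false`, that is, they count as correct. -/
theorem historyRun_support (prog : Program) (t : ℕ) :
    ∀ z ∈ (historyRun P ν prog t).support,
      (∀ h', (∀ k < z.1.calls, h' k = z.2 k) →
        (detStep P h')^[t] (Config.init prog n) = z.1) ∧
      (∀ k, z.1.calls ≤ k → z.2 k = false) ∧ z.1.calls ≤ t := by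
  induction t with
  | zero =>
    intro z hz
    simp only [historyRun, PMF.support_pure, Set.mem_singleton_iff] at hz
    subst hz
    simp [Config.init]
  | succ t ih =>
    intro z hz
    rw [historyRun, PMF.mem_support_bind_iff] at hz
    obtain ⟨⟨s, h⟩, hs, hz⟩ := hz
    obtain ⟨ih1, ih2, ih3⟩ := ih _ hs
    simp only at ih1 ih2 ih3
    rcases historyStep_cases P ν s h with ⟨x, q, k, h1, h2⟩ | ⟨h1, h2, h3, -⟩
    · rw [h2, PMF.mem_support_map_iff] at hz
      obtain ⟨b, -, rfl⟩ := hz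
      refine ⟨fun h' hh' => ?_, fun j hj => ?_, ?_⟩
      · rw [Function.iterate_succ_apply']
        have hc : (s.receive P x q k b).calls = s.calls + 1 := rfl
        simp only [hc] at hh'
        rw [ih1 h' fun j hj => by
          rw [hh' j (by omega), Function.update_of_ne (by omega)]]
        have := hh' s.calls (by omega)
        rw [Function.update_self] at this
        simp [detStep, h1, this]
      · have hj' : s.calls + 1 ≤ j := hj
        simp only
        rw [Function.update_of_ne (by omega)]
        exact ih2 j (by omega)
      · have hc : (s.receive P x q k b).calls = s.calls + 1 := rfl
        simp only [hc]; omega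
    · rw [h1] at hz
      simp only [PMF.support_pure, Set.mem_singleton_iff] at hz
      subst hz
      simp only [h3]
      refine ⟨fun h' hh' => ?_, ih2, by omega⟩
      rw [Function.iterate_succ_apply', ih1 h' hh', h2]

end History

/-! ### Exponential moments of adaptively chosen error bits -/

section Moments

variable {n : ℕ} (P : Fin n → Plane) (ν : Noise)

/-- The weight of an error bit. -/
noncomputable def bitWeight (p : ℝ) (b : Bool) : ℝ≥0∞ :=
  ENNReal.ofReal (if b then 1 / (2 * p) else 2 * p)

/-- A bound for the mean weight of an error bit. -/
noncomputable def meanWeight (p : ℝ) : ℝ := 1 / 2 + 2 * p * (1 - p)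

/-- With error probability x the mean is x / (2 p) + (1 - x) 2 p. Since 2 p < 1 this increases with
x, and at x = p it equals `meanWeight p`. -/
theorem expect_bitWeight_le {p : ℝ} (hp : 0 < p) (hp' : p < 1 / 2) (μ : PMF Bool)
    (hμ : μ true ≤ ENNReal.ofReal p) :
    expect μ (bitWeight p) ≤ ENNReal.ofReal (meanWeight p) := by
  have hsum : μ true + μ false = 1 := by
    have := μ.tsum_coe; rwa [tsum_fintype, Fintype.sum_bool] at this
  have ht : μ true ≠ ⊤ := μ.apply_ne_top _
  have hf : μ false ≠ ⊤ := μ.apply_ne_top _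
  have hx : (μ true).toReal ≤ p := by
    have := ENNReal.toReal_mono ENNReal.ofReal_ne_top hμ
    rwa [ENNReal.toReal_ofReal hp.le] at this
  have hs : (μ true).toReal + (μ false).toReal = 1 := by
    rw [← ENNReal.toReal_add ht hf, hsum]; simp
  have h0 : 0 ≤ (μ true).toReal := ENNReal.toReal_nonneg
  rw [expect_bool, bitWeight, bitWeight, ← ENNReal.ofReal_toReal ht,
    ← ENNReal.ofReal_toReal hf, ← ENNReal.ofReal_mul ENNReal.toReal_nonneg,
    ← ENNReal.ofReal_mul ENNReal.toReal_nonneg, ← ENNReal.ofReal_add (by simp; positivity)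
      (by simp; positivity)]
  refine ENNReal.ofReal_le_ofReal ?_
  simp only [if_true, Bool.false_eq_true, if_false, meanWeight]
  have hfe : (μ false).toReal = 1 - (μ true).toReal := by linarith
  rw [hfe]
  have h1 : (2 * p : ℝ) ≤ 1 / (2 * p) := by
    rw [le_div_iff₀ (by linarith)]; nlinarith
  have h2 : p * (1 / (2 * p)) = 1 / 2 := by field_simp
  nlinarith [mul_le_mul_of_nonneg_right hx (sub_nonneg.2 h1)]

/-- This covers calls that never take place: they are recorded as correct, and their actual weight
must not exceed the mean weight with which they are budgeted. -/
theorem bitWeight_false_le {p : ℝ} (hp : 0 < p) (hp' : p < 1 / 2) :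
    bitWeight p false ≤ ENNReal.ofReal (meanWeight p) := by
  refine ENNReal.ofReal_le_ofReal ?_
  simp only [Bool.false_eq_true, if_false, meanWeight]
  nlinarith

/-- The weight of a history on a set of calls; future calls count with their mean weight. -/
noncomputable def pathWeight (p : ℝ) (Z : Finset ℕ) (z : Config × (ℕ → Bool)) : ℝ≥0∞ :=
  ∏ i ∈ Z, if i < z.1.calls then bitWeight p (z.2 i) else ENNReal.ofReal (meanWeight p)

/-- The path weight is a supermartingale. A call in `Z` replaces one budgeted factor by an actual
one, whose conditional mean is at most the budget whatever question has been chosen; all other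
factors are unchanged. This is where independence of fresh errors enters, without any assumption on
how the questions depend on earlier answers. -/
theorem expect_historyStep_pathWeight_le {p : ℝ} (hp : 0 < p) (hp' : p < 1 / 2)
    (hν : ν.ErrorAtMost p) (Z : Finset ℕ) (z : Config × (ℕ → Bool)) :
    expect (historyStep P ν z) (pathWeight p Z) ≤ pathWeight p Z z := by
  obtain ⟨s, h⟩ := z
  rcases historyStep_cases P ν s h with ⟨x, q, k, h1, h2⟩ | ⟨h1, -, h3, -⟩
  · rw [h2, expect_map]
    have key : ∀ b, pathWeight p Z (s.receive P x q k b, Function.update h s.calls b) =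
        (if s.calls ∈ Z then bitWeight p b else 1) *
        ∏ i ∈ Z.erase s.calls,
          if i < s.calls then bitWeight p (h i) else ENNReal.ofReal (meanWeight p) := by
      intro b
      have hc : (s.receive P x q k b).calls = s.calls + 1 := rfl
      have hr : ∏ i ∈ Z.erase s.calls, (if i < s.calls + 1 then
          bitWeight p (Function.update h s.calls b i) else ENNReal.ofReal (meanWeight p)) =
          ∏ i ∈ Z.erase s.calls,
          if i < s.calls then bitWeight p (h i) else ENNReal.ofReal (meanWeight p) := by
        refine Finset.prod_congr rfl fun i hi => ?_
        have hne := Finset.ne_of_mem_erase hi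
        rw [Function.update_of_ne hne]
        have : (i < s.calls + 1) ↔ i < s.calls := by omega
        simp [this]
      simp only [pathWeight, hc]
      by_cases hm : s.calls ∈ Z
      · rw [← Finset.mul_prod_erase _ _ hm, hr]; simp [hm]
      · rw [← hr, Finset.erase_eq_of_notMem hm]; simp [hm]
    simp only [key]
    have hz : pathWeight p Z (s, h) =
        (if s.calls ∈ Z then ENNReal.ofReal (meanWeight p) else 1) *
        ∏ i ∈ Z.erase s.calls,
          if i < s.calls then bitWeight p (h i) else ENNReal.ofReal (meanWeight p) := by
      by_cases hm : s.calls ∈ Z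
      · simp only [pathWeight]; rw [← Finset.mul_prod_erase _ _ hm]; simp [hm]
      · rw [Finset.erase_eq_of_notMem hm]; simp [pathWeight, hm]
    rw [hz]
    simp only [expect, ← mul_assoc]
    rw [ENNReal.tsum_mul_right]
    refine mul_le_mul_left ?_ _
    by_cases hm : s.calls ∈ Z
    · simp only [hm, if_true]
      exact expect_bitWeight_le hp hp' _ (hν _ _)
    · have := (ν s.calls (q.map s.var)).tsum_coe
      rw [tsum_fintype, Fintype.sum_bool] at this
      simp [hm, this.le]
  · rw [h1, expect_pure]
    simp [pathWeight, h3]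

theorem expect_historyRun_pathWeight_le {p : ℝ} (hp : 0 < p) (hp' : p < 1 / 2)
    (hν : ν.ErrorAtMost p) (prog : Program) (Z : Finset ℕ) (t : ℕ) :
    expect (historyRun P ν prog t) (pathWeight p Z) ≤
      ENNReal.ofReal (meanWeight p) ^ Z.card := by
  induction t with
  | zero => simp [historyRun, expect_pure, pathWeight, Config.init]
  | succ t ih =>
    rw [historyRun, expect_bind]
    exact (expect_mono _ fun z _ =>
      expect_historyStep_pathWeight_le P ν hp hp' hν Z z).trans ih

/-- The expected weight of the error bits on a set of calls. -/
theorem expect_prod_bitWeight_le {p : ℝ} (hp : 0 < p) (hp' : p < 1 / 2)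
    (hν : ν.ErrorAtMost p) (prog : Program) (Z : Finset ℕ) (t : ℕ) :
    expect (historyRun P ν prog t) (fun z => ∏ i ∈ Z, bitWeight p (z.2 i)) ≤
      ENNReal.ofReal (meanWeight p) ^ Z.card := by
  refine (expect_mono _ fun z hz => ?_).trans
    (expect_historyRun_pathWeight_le P ν hp hp' hν prog Z t)
  refine Finset.prod_le_prod' fun i _ => ?_
  split_ifs with hi
  · exact le_rfl
  · rw [(historyRun_support P ν prog t z hz).2.1 i (by omega)]
    exact bitWeight_false_le hp hp'

end Moments

/-! ### Bad blocks and the failure probability -/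

section Blocks

/-- The majority of the `r` calls in block number `k` may be wrong. -/
def BadBlock (r : ℕ) (h : ℕ → Bool) (k : ℕ) : Prop :=
  r ≤ 2 * ((Finset.range r).filter fun i => h (r * k + i) = true).card

instance (r : ℕ) (h : ℕ → Bool) : DecidablePred (BadBlock r h) :=
  fun _ => inferInstanceAs (Decidable (_ ≤ _))

/-- Among any `16 * m` successive blocks fewer than `m` are bad. -/
def Reliable (r m : ℕ) (h : ℕ → Bool) : Prop :=
  ∀ k, ((Finset.range (16 * m)).filter fun j => BadBlock r h (k + j)).card < m

/-- A correct bit weighs 2 p and an error the inverse of it. If the errors outnumber the correct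
bits by d ≥ 0, everything else cancels and (1 / (2 p))^d ≥ 1 is left. -/
theorem one_le_prod_of_badBlock {p : ℝ} (hp : 0 < p) (hp' : p < 1 / 2) {r k : ℕ}
    {h : ℕ → Bool} (hb : BadBlock r h k) :
    1 ≤ ∏ i ∈ Finset.range r, bitWeight p (h (r * k + i)) := by
  unfold BadBlock at hb
  set f := (Finset.range r).filter fun i => h (r * k + i) = true with hf
  have hcard : f.card + ((Finset.range r).filter fun i => ¬ h (r * k + i) = true).card = r := by
    rw [hf, Finset.card_filter_add_card_filter_not, Finset.card_range]
  rw [← Finset.prod_filter_mul_prod_filter_not _ (fun i => h (r * k + i) = true)]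
  have h1 : ∏ i ∈ (Finset.range r).filter (fun i => h (r * k + i) = true),
      bitWeight p (h (r * k + i)) = ENNReal.ofReal (1 / (2 * p)) ^ f.card := by
    rw [hf]; apply Finset.prod_eq_pow_card
    intro i hi
    simp [bitWeight, (Finset.mem_filter.1 hi).2]
  have h2 : ∏ i ∈ (Finset.range r).filter (fun i => ¬ h (r * k + i) = true),
      bitWeight p (h (r * k + i)) = ENNReal.ofReal (2 * p) ^
        ((Finset.range r).filter fun i => ¬ h (r * k + i) = true).card := by
    apply Finset.prod_eq_pow_card
    intro i hi
    simp [bitWeight, (Finset.mem_filter.1 hi).2]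
  rw [h1, h2]
  generalize ((Finset.range r).filter fun i => ¬ h (r * k + i) = true).card = g at *
  obtain ⟨d, hd⟩ : ∃ d, f.card = g + d := ⟨f.card - g, by omega⟩
  rw [hd, ← ENNReal.ofReal_pow (by positivity), ← ENNReal.ofReal_pow (by positivity),
    ← ENNReal.ofReal_mul (by positivity), ← ENNReal.ofReal_one]
  refine ENNReal.ofReal_le_ofReal ?_
  have : (1 / (2 * p)) ^ (g + d) * (2 * p) ^ g = (1 / (2 * p)) ^ d := by
    rw [pow_add, mul_right_comm, ← mul_pow]
    have : 1 / (2 * p) * (2 * p) = 1 := by field_simp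
    rw [this]; simp
  rw [this]
  refine one_le_pow₀ ?_
  rw [le_div_iff₀ (by linarith)]; linarith

variable {n : ℕ} (P : Fin n → Plane) (ν : Noise)

/-- If m blocks of the window are bad, the weight of the bits in some m-element set of blocks is at
least 1. So the probability is at most the sum of the mean weights over all such sets. There are at
most 2^(16 m) of them, each with mean weight at most `meanWeight p` to the power r m. -/
theorem expect_badWindow_le {p : ℝ} (hp : 0 < p) (hp' : p < 1 / 2)
    (hν : ν.ErrorAtMost p) (prog : Program) (t r m k : ℕ) :
    expect (historyRun P ν prog t) (Set.indicator {z | m ≤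
      ((Finset.range (16 * m)).filter fun j => BadBlock r z.2 (k + j)).card} 1) ≤
      (2 ^ 16 * ENNReal.ofReal (meanWeight p) ^ r) ^ m := by
  classical
  have hS : ∀ S ∈ (Finset.range (16 * m)).powersetCard m,
      expect (historyRun P ν prog t) (fun z => ∏ j ∈ S, ∏ i ∈ Finset.range r,
        bitWeight p (z.2 (r * (k + j) + i))) ≤ ENNReal.ofReal (meanWeight p) ^ (r * m) := by
    intro S hS
    -- Different blocks use different calls: the block number is the quotient of the call number by
    -- r.
    have hinj : Set.InjOn (fun x : ℕ × ℕ => r * (k + x.1) + x.2)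
        (S ×ˢ Finset.range r : Finset (ℕ × ℕ)) := by
      rintro ⟨j, i⟩ h1 ⟨j', i'⟩ h2 h
      simp only [Finset.coe_product, Set.mem_prod, Finset.mem_coe, Finset.mem_range] at h1 h2
      simp only at h
      have hr : 0 < r := by omega
      have e1 : (r * (k + j) + i) / r = k + j := by
        rw [Nat.mul_add_div hr, Nat.div_eq_of_lt h1.2, add_zero]
      have e2 : (r * (k + j') + i') / r = k + j' := by
        rw [Nat.mul_add_div hr, Nat.div_eq_of_lt h2.2, add_zero]
      rw [h, e2] at e1
      obtain rfl : j' = j := by omega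
      simp; omega
    have := expect_prod_bitWeight_le P ν hp hp' hν prog
      ((S ×ˢ Finset.range r).image fun x : ℕ × ℕ => r * (k + x.1) + x.2) t
    rw [Finset.card_image_of_injOn hinj, Finset.card_product, Finset.card_range,
      (Finset.mem_powersetCard.1 hS).2, mul_comm m r] at this
    refine le_trans (le_of_eq ?_) this
    congr 1; ext z
    rw [Finset.prod_image hinj, Finset.prod_product]
  calc _ ≤ expect (historyRun P ν prog t) (fun z => ∑ S ∈ (Finset.range (16 * m)).powersetCard m,
        ∏ j ∈ S, ∏ i ∈ Finset.range r, bitWeight p (z.2 (r * (k + j) + i))) := by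
        refine expect_mono _ fun z _ => ?_
        by_cases hz : m ≤ ((Finset.range (16 * m)).filter fun j => BadBlock r z.2 (k + j)).card
        · obtain ⟨S, hS, hc⟩ := Finset.exists_subset_card_eq hz
          have hmem : S ∈ (Finset.range (16 * m)).powersetCard m :=
            Finset.mem_powersetCard.2 ⟨hS.trans (Finset.filter_subset _ _), hc⟩
          have h1 : (1 : ℝ≥0∞) ≤ ∏ j ∈ S, ∏ i ∈ Finset.range r,
              bitWeight p (z.2 (r * (k + j) + i)) :=
            Finset.one_le_prod' fun j hj =>
              one_le_prod_of_badBlock hp hp' (Finset.mem_filter.1 (hS hj)).2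
          rw [Set.indicator_of_mem (by exact hz)]
          exact h1.trans (Finset.single_le_sum (f := fun S => ∏ j ∈ S, ∏ i ∈ Finset.range r,
              bitWeight p (z.2 (r * (k + j) + i))) (fun _ _ => zero_le) hmem)
        · rw [Set.indicator_of_notMem (by exact hz)]; exact zero_le
    _ = ∑ S ∈ (Finset.range (16 * m)).powersetCard m, _ := expect_sum _ _ _
    _ ≤ ∑ S ∈ (Finset.range (16 * m)).powersetCard m,
        ENNReal.ofReal (meanWeight p) ^ (r * m) := Finset.sum_le_sum hS
    _ = (Nat.choose (16 * m) m : ℝ≥0∞) * ENNReal.ofReal (meanWeight p) ^ (r * m) := by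
        rw [Finset.sum_const, Finset.card_powersetCard, Finset.card_range, nsmul_eq_mul]
    _ ≤ (2 ^ (16 * m) : ℝ≥0∞) * ENNReal.ofReal (meanWeight p) ^ (r * m) := by
        refine mul_le_mul_left ?_ _
        exact_mod_cast Nat.choose_le_two_pow _ _
    _ = _ := by rw [mul_pow, ← pow_mul, ← pow_mul]

/-- If a program succeeds whenever the error bits are reliable, then it fails only with small
probability. -/
theorem failure_le {p : ℝ} (hp : 0 < p) (hp' : p < 1 / 2) (hν : ν.ErrorAtMost p)
    (prog : Program) (t r m : ℕ) (hr : 0 < r) (hm : 0 < m) (Good : Config → Prop)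
    (hgood : ∀ h, Reliable r m h → Good ((detStep P h)^[t] (Config.init prog n))) :
    (run prog P ν t).toOuterMeasure {s | ¬ Good s} ≤
      (t + 1) * (2 ^ 16 * ENNReal.ofReal (meanWeight p) ^ r) ^ m := by
  rw [← historyRun_map_fst, toOuterMeasure_eq_expect, expect_map]
  calc _ ≤ expect (historyRun P ν prog t) (fun z => ∑ k ∈ Finset.range (t + 1),
        Set.indicator {z | m ≤ ((Finset.range (16 * m)).filter
          fun j => BadBlock r z.2 (k + j)).card} 1 z) := by
        refine expect_mono _ fun z hz => ?_
        obtain ⟨h1, h2, h3⟩ := historyRun_support P ν prog t z hz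
        by_cases hg : Good z.1
        · rw [Set.indicator_of_notMem (by simpa using hg)]; exact zero_le
        · have hnot : ¬ Reliable r m z.2 := fun hrel => hg (by
            rw [← h1 z.2 fun _ _ => rfl]; exact hgood _ hrel)
          simp only [Reliable, not_forall, not_lt] at hnot
          obtain ⟨k, hk⟩ := hnot
          -- Only windows that start at t or before matter. A later window lies beyond all calls
          -- made, where every recorded bit is `false`, so it has no bad block.
          have hkt : k < t + 1 := by
            by_contra hkt
            have hpos := hm.trans_le hk
            obtain ⟨j, hj⟩ := Finset.card_pos.1 hpos
            have hb := (Finset.mem_filter.1 hj).2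
            unfold BadBlock at hb
            have : ((Finset.range r).filter fun i => z.2 (r * (k + j) + i) = true) = ∅ := by
              refine Finset.filter_eq_empty_iff.2 fun i _ => ?_
              have hle : z.1.calls ≤ r * (k + j) + i := by nlinarith
              rw [h2 _ hle]; simp
            rw [this] at hb; simp at hb; omega
          rw [Set.indicator_of_mem (by exact hg)]
          refine le_trans ?_ (Finset.single_le_sum (f := fun k =>
            Set.indicator {z : Config × (ℕ → Bool) | m ≤ ((Finset.range (16 * m)).filter
              fun j => BadBlock r z.2 (k + j)).card} 1 z) (fun _ _ => zero_le)
            (Finset.mem_range.2 hkt))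
          rw [Set.indicator_of_mem (by exact hk)]
          simp
    _ = ∑ k ∈ Finset.range (t + 1), _ := expect_sum _ _ _
    _ ≤ ∑ k ∈ Finset.range (t + 1), (2 ^ 16 * ENNReal.ofReal (meanWeight p) ^ r) ^ m :=
        Finset.sum_le_sum fun k _ => expect_badWindow_le P ν hp hp' hν prog t r m k
    _ = _ := by simp

end Blocks

/-! ### Majority votes -/

namespace Primitive

/-- The variables that are read by a primitive. -/
def Below (b : ℕ) : Primitive ℕ → Prop
  | xLe i j => i < b ∧ j < b
  | yLe i j => i < b ∧ j < b
  | distLe i j k l => i < b ∧ j < b ∧ k < b ∧ l < b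
  | gapLe i j k l => i < b ∧ j < b ∧ k < b ∧ l < b

theorem Below.map_congr {b : ℕ} {q : Primitive ℕ} (hq : q.Below b) {v v' : ℕ → ℕ}
    (h : ∀ x < b, v x = v' x) : q.map v = q.map v' := by
  cases q <;> simp only [Below] at hq <;> simp only [map] <;> congr 1 <;> apply h <;> omega

theorem Below.mono {b b' : ℕ} {q : Primitive ℕ} (hq : q.Below b) (h : b ≤ b') : q.Below b' := by
  cases q <;> simp only [Below] at hq ⊢ <;> omega

end Primitive

section Queries

variable {n : ℕ} {P : Fin n → Plane} {e : ℕ → Bool}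

@[simp] theorem Mem.get_var (m : Mem) (x : ℕ) (q : Primitive ℕ) (y : ℕ) :
    (m.get P e x q).var y =
      if y = x then (xor (e m.calls) ((q.map m.var).answer P)).toNat else m.var y := by
  simp [Mem.get, Function.update_apply]
@[simp] theorem Mem.get_arr (m : Mem) (x : ℕ) (q : Primitive ℕ) :
    (m.get P e x q).arr = m.arr := rfl
@[simp] theorem Mem.get_calls (m : Mem) (x : ℕ) (q : Primitive ℕ) :
    (m.get P e x q).calls = m.calls + 1 := rfl
@[simp] theorem Mem.get_time (m : Mem) (x : ℕ) (q : Primitive ℕ) :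
    (m.get P e x q).time = m.time + 1 := rfl

/-- The majority vote of `r` evaluations of `q`, in variable 60. -/
def ask (r : ℕ) (q : Primitive ℕ) : Program :=
  seqs [.const 60 0, .const 61 r,
    .loop (.lt 2 61) (seqs [.query 62 q, .add 60 60 62, .sub 61 61 1]),
    .const 61 r, .add 62 60 60, .ite (.lt 61 62) (.const 60 1) (.const 60 0)]

/-- The running time of `ask`. -/
def askTime (r : ℕ) : ℕ := 6 * r + 20

theorem card_filter_range_shift (r a : ℕ) (p : ℕ → Bool) :
    ((Finset.range (r + 1)).filter fun i => p (a + i) = true).card =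
      ((Finset.range r).filter fun i => p (a + i) = true).card + (p (a + r)).toNat := by
  rw [Finset.range_add_one, Finset.filter_insert]
  split_ifs with h
  · rw [Finset.card_insert_of_notMem (by simp)]; simp [h]
  · simp at h; simp [h]

/-- A vote makes exactly r calls whatever the answers are, so votes stay aligned with blocks, and
vote number k is right unless block k is bad. A tie counts as bad, hence strictness of the majority
test does no harm. Here and below, the variables 0 to 4 hold the constants n, 1, 0, 16 w and 2^ℓ,
and high variable numbers are scratch space. -/
theorem wp_ask {r k : ℕ} {q : Primitive ℕ} (hq : q.Below 60) {m : Mem} {Q : Mem → Prop}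
    (h1 : m.var 1 = 1) (h2 : m.var 2 = 0) (hk : m.calls = r * k)
    (hQ : ∀ m' : Mem, (∀ x < 60, m'.var x = m.var x) → m'.arr = m.arr →
      m'.calls = r * (k + 1) → m'.time ≤ m.time + askTime r →
      (m'.var 60 = 0 ∨ m'.var 60 = 1) →
      (¬ BadBlock r e k → m'.var 60 = ((q.map m.var).answer P).toNat) → Q m') :
    wp P e (ask r q) Q m := by
  set ans := (q.map m.var).answer P with hans
  simp only [ask, seqs, wp]
  -- With f calls left, variable 60 counts the answers "yes" among the first r - f: these are the
  -- correct answers if the truth is "yes", and the errors otherwise.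
  refine wp.loop (fun f m' => f ≤ r ∧ m'.var 61 = f ∧ (∀ x < 60, m'.var x = m.var x) ∧
    m'.arr = m.arr ∧ m'.calls + f = r * (k + 1) ∧ m'.time + 6 * f ≤ m.time + 6 * r + 5 ∧
    m'.var 60 = if ans then
      (r - f) - ((Finset.range (r - f)).filter fun i => e (r * k + i) = true).card
      else ((Finset.range (r - f)).filter fun i => e (r * k + i) = true).card)
    ?_ ?_ r _ ?_
  · rintro f m' ⟨hf, h61, hv, ha, hc, ht, h60⟩ hb
    have e1 := hv 1 (by norm_num)
    have e2 := hv 2 (by norm_num)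
    simp only [Test.eval, e2, h2, h61, decide_eq_true_eq] at hb
    obtain ⟨f, rfl⟩ : ∃ g, f = g + 1 := ⟨f - 1, by omega⟩
    have hmap : q.map m'.var = q.map m.var := hq.map_congr hv
    have hrf : r - f = (r - (f + 1)) + 1 := by omega
    have hcl : m'.calls = r * k + (r - (f + 1)) := by
      rw [Nat.mul_succ] at hc; omega
    refine ⟨f, rfl, by omega, ?_, ?_, ?_, ?_, ?_, ?_⟩
    · simp [e1, h1, h61]
    · intro x hx
      simp [show x ≠ 60 by omega, show x ≠ 61 by omega, show x ≠ 62 by omega, hv x hx]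
    · simp [ha]
    · simp; omega
    · simp; omega
    · have hcard : ((Finset.range (r - (f + 1))).filter
          fun i => e (r * k + i) = true).card ≤ r - (f + 1) :=
        (Finset.card_filter_le _ _).trans (by simp)
      simp only [Mem.set_var, Mem.tick_var, Mem.get_var, hmap, ← hans, hcl, Mem.tick_calls, h60]
      rw [hrf, card_filter_range_shift]
      cases ans <;> cases e (r * k + (r - (f + 1))) <;> simp <;> omega
  · rintro f m' ⟨hf, h61, hv, ha, hc, ht, h60⟩ hb
    have e2 := hv 2 (by norm_num)
    simp only [Test.eval, e2, h2, h61, decide_eq_false_iff_not, not_lt, Nat.le_zero] at hb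
    subst hb
    simp only [Nat.sub_zero] at h60
    have hcard : ((Finset.range r).filter fun i => e (r * k + i) = true).card ≤ r :=
      (Finset.card_filter_le _ _).trans (by simp)
    refine ⟨fun hb => ?_, fun hb => ?_⟩
    all_goals
      simp only [Test.eval, Mem.set_var, Mem.tick_var, decide_eq_true_eq,
        decide_eq_false_iff_not] at hb
      norm_num at hb
      refine hQ _ ?_ ?_ ?_ ?_ ?_ ?_
      · intro x hx
        simp [show x ≠ 60 by omega, show x ≠ 61 by omega, show x ≠ 62 by omega, hv x hx]
      · simp [ha]
      · simpa using hc
      · simp [askTime]; omega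
      · simp
      · intro hbad
        simp only [BadBlock, not_le] at hbad
        cases hA : ans <;> simp [hA] at h60 ⊢ <;> omega
  · simp only [Mem.tick_var, Mem.set_var, Mem.tick_arr, Mem.set_arr, Mem.tick_calls,
      Mem.set_calls, Mem.tick_time, Mem.set_time]
    refine ⟨le_rfl, by norm_num, ?_, trivial, by rw [hk]; ring, by omega, by simp⟩
    intro x hx
    simp [show x ≠ 60 by omega, show x ≠ 61 by omega]

/-- The majority vote of `var 3` majority votes, in variable 50. -/
def sure (r : ℕ) (q : Primitive ℕ) : Program :=
  seqs [.const 50 0, .copy 51 3,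
    .loop (.lt 2 51) (seqs [ask r q, .add 50 50 60, .sub 51 51 1]),
    .add 52 50 50, .ite (.lt 3 52) (.const 50 1) (.const 50 0)]

/-- The running time of `sure` with `w` majority votes. -/
def sureTime (r w : ℕ) : ℕ := w * (askTime r + 5) + 20

/-- The number of bad blocks from number `k` to number `k'`. -/
def badCount (r : ℕ) (h : ℕ → Bool) (k k' : ℕ) : ℕ :=
  ((Finset.Ico k k').filter fun j => BadBlock r h j).card

theorem badCount_self (r : ℕ) (h : ℕ → Bool) (k : ℕ) : badCount r h k k = 0 := by
  simp [badCount]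

theorem badCount_add (r : ℕ) (h : ℕ → Bool) {k k' k'' : ℕ} (h1 : k ≤ k') (h2 : k' ≤ k'') :
    badCount r h k k'' = badCount r h k k' + badCount r h k' k'' := by
  unfold badCount
  rw [← Finset.Ico_union_Ico_eq_Ico h1 h2, Finset.filter_union, Finset.card_union_of_disjoint]
  exact Finset.disjoint_filter_filter (Finset.Ico_disjoint_Ico_consecutive _ _ _)

theorem badCount_succ (r : ℕ) (h : ℕ → Bool) {k k' : ℕ} (h1 : k ≤ k') :
    badCount r h k (k' + 1) = badCount r h k k' + if BadBlock r h k' then 1 else 0 := by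
  rw [badCount_add r h h1 (Nat.le_succ _)]
  congr 1
  unfold badCount
  rw [Nat.Ico_succ_singleton, Finset.filter_singleton]
  split_ifs <;> simp

theorem badCount_mono (r : ℕ) (h : ℕ → Bool) {k k' k'' : ℕ} (h2 : k' ≤ k'') :
    badCount r h k k' ≤ badCount r h k k'' :=
  Finset.card_le_card (Finset.filter_subset_filter _ (Finset.Ico_subset_Ico_right h2))

theorem Reliable.badCount_lt {r m : ℕ} {h : ℕ → Bool} (hr : Reliable r m h) (k : ℕ) :
    badCount r h k (k + 16 * m) < m := by
  have := hr k
  unfold badCount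
  rw [Finset.range_eq_Ico, ← Finset.card_map (addLeftEmbedding k)] at this
  convert this using 2
  ext j
  simp only [Finset.mem_filter, Finset.mem_Ico, Finset.mem_map, addLeftEmbedding_apply]
  constructor
  · rintro ⟨⟨h1, h2⟩, h3⟩
    obtain ⟨i, rfl⟩ := Nat.exists_eq_add_of_le h1
    exact ⟨i, ⟨⟨by omega, by omega⟩, h3⟩, rfl⟩
  · rintro ⟨i, ⟨⟨h1, h2⟩, h3⟩, rfl⟩
    exact ⟨⟨by omega, by omega⟩, h3⟩

/-- The 16 w votes fill one window, in which fewer than w blocks are bad. So the majority of the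
votes is right with certainty on a reliable sequence. -/
theorem wp_sure {r k w : ℕ} {q : Primitive ℕ} (hq : q.Below 50) {m : Mem} {Q : Mem → Prop}
    (hr : Reliable r w e)
    (h1 : m.var 1 = 1) (h2 : m.var 2 = 0) (h3 : m.var 3 = 16 * w) (hk : m.calls = r * k)
    (hQ : ∀ m' : Mem, (∀ x < 50, m'.var x = m.var x) → m'.arr = m.arr →
      m'.calls = r * (k + 16 * w) → m'.time ≤ m.time + sureTime r (16 * w) →
      m'.var 50 = ((q.map m.var).answer P).toNat → Q m') :
    wp P e (sure r q) Q m := by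
  set ans := (q.map m.var).answer P with hans
  have hw := hr.badCount_lt k
  simp only [sure, seqs, wp]
  refine wp.loop (fun f m' => f ≤ 16 * w ∧ m'.var 51 = f ∧ (∀ x < 50, m'.var x = m.var x) ∧
    m'.arr = m.arr ∧ m'.calls = r * (k + (16 * w - f)) ∧
    m'.time + (askTime r + 5) * f ≤ m.time + (askTime r + 5) * (16 * w) + 5 ∧
    (ans = true → (16 * w - f) ≤ m'.var 50 + badCount r e k (k + (16 * w - f))) ∧
    (ans = false → m'.var 50 ≤ badCount r e k (k + (16 * w - f))))
    ?_ ?_ (16 * w) _ ?_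
  · rintro f m' ⟨hf, h51, hv, ha, hc, ht, hy, hn⟩ hb
    have e1 := hv 1 (by norm_num)
    have e2 := hv 2 (by norm_num)
    simp only [Test.eval, e2, h2, h51, decide_eq_true_eq] at hb
    obtain ⟨f, rfl⟩ : ∃ g, f = g + 1 := ⟨f - 1, by omega⟩
    refine ⟨f, rfl, ?_⟩
    refine wp_ask (hq.mono (by norm_num)) (by simp [e1, h1]) (by simp [e2, h2]) (by simpa using hc)
      fun m'' hv' ha' hc' ht' h60 hans' => ?_
    simp only [Mem.tick_var, Mem.tick_arr, Mem.tick_time] at hv' ha' ht' hans'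
    rw [hq.map_congr hv, ← hans] at hans'
    have hs := badCount_succ r e (k := k) (k' := k + (16 * w - (f + 1))) (by omega)
    have hidx : k + (16 * w - (f + 1)) + 1 = k + (16 * w - f) := by omega
    rw [hidx] at hs hc'
    have e50 := hv' 50 (by norm_num)
    refine ⟨by omega, ?_, ?_, ?_, ?_, ?_, ?_, ?_⟩
    · simp [hv', e1, h1, h51]
    · intro x hx
      simp [show x ≠ 50 by omega, show x ≠ 51 by omega, hv' x (by omega), hv x hx]
    · simp [ha, ha']
    · simpa using hc'
    · simp; nlinarith
    · intro hA
      simp [e50]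
      have := hy hA
      by_cases hbad : BadBlock r e (k + (16 * w - (f + 1)))
      · simp only [hbad, if_true] at hs; omega
      · have := hans' hbad
        simp only [hbad, if_false, hA, Bool.toNat_true] at hs this; omega
    · intro hA
      simp [e50]
      have := hn hA
      by_cases hbad : BadBlock r e (k + (16 * w - (f + 1)))
      · simp only [hbad, if_true] at hs; omega
      · have := hans' hbad
        simp only [hbad, if_false, hA, Bool.toNat_false] at hs this; omega
  · rintro f m' ⟨hf, h51, hv, ha, hc, ht, hy, hn⟩ hb
    have e2 := hv 2 (by norm_num)
    have e3 := hv 3 (by norm_num)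
    simp only [Test.eval, e2, h2, h51, decide_eq_false_iff_not, not_lt, Nat.le_zero] at hb
    subst hb
    simp only [Nat.sub_zero] at hy hn hc
    refine ⟨fun hb => ?_, fun hb => ?_⟩
    all_goals
      simp only [Test.eval, Mem.set_var, Mem.tick_var, decide_eq_true_eq,
        decide_eq_false_iff_not] at hb
      norm_num [e3, h3] at hb
      refine hQ _ ?_ ?_ ?_ ?_ ?_
      · intro x hx
        simp [show x ≠ 50 by omega, show x ≠ 52 by omega, hv x hx]
      · simp [ha]
      · simpa using hc
      · simp [sureTime]; nlinarith
      · cases hA : ans <;> simp [hA] at hy hn ⊢ <;> omega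
  · simp only [Mem.tick_var, Mem.set_var, Mem.tick_arr, Mem.set_arr, Mem.tick_calls,
      Mem.set_calls, Mem.tick_time, Mem.set_time]
    refine ⟨le_rfl, by simp [h3], ?_, trivial, by rw [hk]; simp, by omega, by simp, by simp⟩
    intro x hx
    simp [show x ≠ 50 by omega, show x ≠ 51 by omega]

end Queries

/-! ### 2-3 trees and their representation in memory -/

/-- The trees that underlie 2-3 search trees. -/
inductive Tree : Type
  | nil : Tree
  | two (l : Tree) (a : ℕ) (r : Tree) : Tree
  | three (l : Tree) (a : ℕ) (m : Tree) (b : ℕ) (r : Tree) : Tree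

namespace Tree

/-- The keys of a tree from left to right. -/
def flat : Tree → List ℕ
  | nil => []
  | two l a r => l.flat ++ a :: r.flat
  | three l a m b r => l.flat ++ a :: (m.flat ++ b :: r.flat)

/-- All leaves have the same depth `h`. -/
def Bal : Tree → ℕ → Prop
  | nil, h => h = 0
  | two l _ r, h => ∃ h', h = h' + 1 ∧ l.Bal h' ∧ r.Bal h'
  | three l _ m _ r, h => ∃ h', h = h' + 1 ∧ l.Bal h' ∧ m.Bal h' ∧ r.Bal h'

theorem Bal.two_pow_le {t : Tree} : ∀ {h : ℕ}, t.Bal h → 2 ^ h ≤ t.flat.length + 1 := by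
  induction t with
  | nil => rintro h rfl; simp [flat]
  | two l a r ihl ihr =>
    rintro h ⟨h', rfl, hl, hr⟩
    have := ihl hl; have := ihr hr
    simp only [flat, List.length_append, List.length_cons, pow_succ]; omega
  | three l a m b r ihl ihm ihr =>
    rintro h ⟨h', rfl, hl, hm, hr⟩
    have := ihl hl; have := ihr hr
    simp only [flat, List.length_append, List.length_cons, pow_succ]; omega

/-- The arrays 0 to 4 hold, below address `al`, the tree `t` with root address `v`. -/
def Rep (A : ℕ → ℕ → ℕ) (n al : ℕ) : ℕ → Tree → Prop
  | v, nil => v = 0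
  | v, two l a r => 0 < v ∧ v < al ∧ A 1 v = a ∧ A 3 v = n ∧
      Rep A n al (A 0 v) l ∧ Rep A n al (A 2 v) r
  | v, three l a m b r => 0 < v ∧ v < al ∧ A 1 v = a ∧ A 3 v = b ∧ b ≠ n ∧
      Rep A n al (A 0 v) l ∧ Rep A n al (A 2 v) m ∧ Rep A n al (A 4 v) r

/-- Nodes are never overwritten, as insertion copies the search path. A represented tree therefore
survives every change at or above the allocation bound. -/
theorem Rep.mono {A A' : ℕ → ℕ → ℕ} {n al al' : ℕ} (hal : al ≤ al')
    (hA : ∀ B < 5, ∀ i < al, A' B i = A B i) {t : Tree} :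
    ∀ {v : ℕ}, Rep A n al v t → Rep A' n al' v t := by
  induction t with
  | nil => exact fun h => h
  | two l a r ihl ihr =>
    rintro v ⟨h1, h2, h3, h4, h5, h6⟩
    refine ⟨h1, h2.trans_le hal, ?_, ?_, ?_, ?_⟩
    · rw [hA _ (by norm_num) _ h2, h3]
    · rw [hA _ (by norm_num) _ h2, h4]
    · rw [hA _ (by norm_num) _ h2]; exact ihl h5
    · rw [hA _ (by norm_num) _ h2]; exact ihr h6
  | three l a m b r ihl ihm ihr =>
    rintro v ⟨h1, h2, h3, h4, h5, h6, h7, h8⟩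
    refine ⟨h1, h2.trans_le hal, ?_, ?_, h5, ?_, ?_, ?_⟩
    · rw [hA _ (by norm_num) _ h2, h3]
    · rw [hA _ (by norm_num) _ h2, h4]
    · rw [hA _ (by norm_num) _ h2]; exact ihl h6
    · rw [hA _ (by norm_num) _ h2]; exact ihm h7
    · rw [hA _ (by norm_num) _ h2]; exact ihr h8

end Tree

open NoisyGeometry.Tree

/-! ### Search paths and their potential -/

/-- A subtree together with the keys to its left and to its right. -/
structure Spot : Type where
  t : Tree
  pre : List ℕ
  post : List ℕ

namespace Spot

/-- The last key to the left, `x` if there is none. -/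
def lo (x : ℕ) (z : Spot) : ℕ := z.pre.getLastD x

/-- The first key to the right, `n` if there is none. -/
def hi (n : ℕ) (z : Spot) : ℕ := z.post.headD n

/-- The key sought by the test `b` lies in the subtree. -/
def on (b : ℕ → Bool) (x n : ℕ) (z : Spot) : Bool := b (z.lo x) && !b (z.hi n)

end Spot

/-- From a subtree to its child number `i`. -/
inductive Down : Spot → ℕ → Spot → Prop
  | two_left (l a r p s) : Down ⟨two l a r, p, s⟩ 0 ⟨l, p, a :: (r.flat ++ s)⟩
  | two_right (l a r p s) : Down ⟨two l a r, p, s⟩ 1 ⟨r, (p ++ l.flat) ++ [a], s⟩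
  | three_left (l a m b r p s) : Down ⟨three l a m b r, p, s⟩ 0
      ⟨l, p, a :: (m.flat ++ b :: (r.flat ++ s))⟩
  | three_mid (l a m b r p s) : Down ⟨three l a m b r, p, s⟩ 1
      ⟨m, (p ++ l.flat) ++ [a], b :: (r.flat ++ s)⟩
  | three_right (l a m b r p s) : Down ⟨three l a m b r, p, s⟩ 2
      ⟨r, (p ++ l.flat ++ a :: m.flat) ++ [b], s⟩

theorem Down.bal {z z' : Spot} {i h : ℕ} (hd : Down z i z') (hz : z.t.Bal h) :
    ∃ h', h = h' + 1 ∧ z'.t.Bal h' := by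
  cases hd <;> obtain ⟨h', h1, h2⟩ := hz <;> exact ⟨h', h1, by tauto⟩

/-- The arrays 5, 6 and 7 hold at index `j` a subtree and its bounds. -/
def Entry (A : ℕ → ℕ → ℕ) (n al x j : ℕ) (z : Spot) : Prop :=
  Rep A n al (A 5 j) z.t ∧ A 6 j = z.lo x ∧ A 7 j = z.hi n

/-- The arrays 5 to 8 hold a downward path in the tree `t₀`, the end of the path first. -/
def Stack (A : ℕ → ℕ → ℕ) (n al x : ℕ) (t₀ : Tree) : List Spot → Prop
  | [] => False
  | [z] => z = ⟨t₀, [], []⟩ ∧ Entry A n al x 0 z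
  | z :: z' :: r => Entry A n al x (r.length + 1) z ∧ Down z' (A 8 r.length) z ∧
      Stack A n al x t₀ (z' :: r)

theorem Stack.entry {A : ℕ → ℕ → ℕ} {n al x : ℕ} {t₀ : Tree} {z : Spot} {r : List Spot}
    (h : Stack A n al x t₀ (z :: r)) : Entry A n al x r.length z := by
  cases r with
  | nil => exact h.2
  | cons z' r => exact h.1

/-- Array 8 records at depth i the direction taken from there to depth i + 1, so its entry at the
end of the path is irrelevant. -/
theorem Stack.mono {A A' : ℕ → ℕ → ℕ} {n al al' x : ℕ} {t₀ : Tree} (hal : al ≤ al')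
    (hA : ∀ B < 5, ∀ i < al, A' B i = A B i) : ∀ {zs : List Spot},
    (∀ B, 5 ≤ B → B < 8 → ∀ i < zs.length, A' B i = A B i) →
    (∀ i, i + 1 < zs.length → A' 8 i = A 8 i) →
    Stack A n al x t₀ zs → Stack A' n al' x t₀ zs := by
  have key : ∀ {j z}, (∀ B, 5 ≤ B → B < 8 → A' B j = A B j) → Entry A n al x j z →
      Entry A' n al' x j z := by
    rintro j z h ⟨h1, h2, h3⟩
    refine ⟨?_, by rw [h 6 (by norm_num) (by norm_num), h2],
      by rw [h 7 (by norm_num) (by norm_num), h3]⟩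
    rw [h 5 (by norm_num) (by norm_num)]
    exact h1.mono hal hA
  intro zs
  induction zs with
  | nil => exact fun _ _ h => h
  | cons z r ih =>
    intro h1 h2 h
    cases r with
    | nil => exact ⟨h.1, key (fun B hB hB' => h1 B hB hB' 0 (by simp)) h.2⟩
    | cons z' r =>
      refine ⟨key (fun B hB hB' => h1 B hB hB' _ (by simp)) h.1, ?_, ih ?_ ?_ h.2.2⟩
      · rw [h2 _ (by simp)]; exact h.2.1
      · intro B hB hB' i hi; exact h1 B hB hB' i (by simp at hi ⊢; omega)
      · intro i hi; exact h2 i (by simp at hi ⊢; omega)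

/-- Every step down lowers the height by one, so depth and remaining height add up to the height of
the tree; in particular a path has at most h + 1 spots. -/
theorem Stack.length_add_le {A : ℕ → ℕ → ℕ} {n al x h : ℕ} {t₀ : Tree} (hb : t₀.Bal h)
    {z : Spot} {r : List Spot} (hs : Stack A n al x t₀ (z :: r)) :
    ∃ h', z.t.Bal h' ∧ h' + r.length = h := by
  induction r generalizing z with
  | nil => obtain ⟨rfl, -⟩ := hs; exact ⟨h, hb, rfl⟩
  | cons z' r ih =>
    obtain ⟨h', h1, h2⟩ := ih hs.2.2
    obtain ⟨h'', rfl, h3⟩ := hs.2.1.bal h1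
    exact ⟨h'', h3, by simp; omega⟩

/-- The potential of a search with backtracking: a bound for the number of correct steps until
the goal is reached. -/
def potential (on : Spot → Bool) (h : ℕ) (c : ℕ) : List Spot → ℤ
  | [] => 0
  | z :: r => h + 1 + (r.length + 1) - 2 * (z :: r).countP on + if on z then -(c : ℤ) else c

section Potential

variable (on : Spot → Bool) (h : ℕ)

/-- Together with `potential_push` this shows that every move of the search changes the potential by
one, downwards exactly if it confirms or enters a spot that contains the key, or withdraws a
confirmation from or leaves a spot that does not. -/
theorem potential_add (c : ℕ) (z : Spot) (r : List Spot) :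
    potential on h (c + 1) (z :: r) = potential on h c (z :: r) + if on z then -1 else 1 := by
  simp only [potential]; split_ifs <;> push_cast <;> ring

theorem potential_push (z' z : Spot) (r : List Spot) :
    potential on h 0 (z' :: z :: r) = potential on h 0 (z :: r) + if on z' then -1 else 1 := by
  simp only [potential, List.countP_cons, List.length_cons]
  by_cases h1 : on z' <;> by_cases h2 : on z <;> simp [h1, h2] <;> ring

/-- A path has at most h + 1 spots, each contributing at least -1, so without confirmations the
summand h + 1 keeps the potential nonnegative. A negative value thus requires confirmations for a
spot that contains the key. -/
theorem potential_neg {A : ℕ → ℕ → ℕ} {n al x : ℕ} {t₀ : Tree} (hb : t₀.Bal h) {c : ℕ}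
    {z : Spot} {r : List Spot} (hs : Stack A n al x t₀ (z :: r))
    (hneg : potential on h c (z :: r) < 0) : on z = true ∧ 0 < c := by
  obtain ⟨h', -, h2⟩ := hs.length_add_le hb
  have h3 := List.countP_le_length (p := on) (l := z :: r)
  simp only [potential, List.length_cons] at hneg h3
  by_cases h1 : on z = true
  · simp only [h1, if_true] at hneg
    exact ⟨h1, by omega⟩
  · simp only [h1] at hneg
    simp at hneg; omega

end Potential

/-! ### Noisy search with backtracking -/

/-- The primitive `prim` compares the values of `f`. -/
structure OrderQuery {n : ℕ} (P : Fin n → Plane) (prim : ℕ → ℕ → Primitive ℕ) (f : ℕ → ℝ) :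
    Prop where
  map_eq : ∀ i j v, (prim i j).map v = prim (v i) (v j)
  below : ∀ i j b, i < b → j < b → (prim i j).Below b
  answer_iff : ∀ i j, (prim i j).answer P = true ↔ i < n ∧ j < n ∧ f i ≤ f j

/-- Go from the subtree at the end of the path to the child that should contain the key. -/
def descend (r : ℕ) (prim : ℕ → ℕ → Primitive ℕ) : Program :=
  seqs [.load 27 1 23, .load 28 3 23, ask r (prim 27 10),
    .ite (.eq 60 2) (seqs [.load 23 0 23, .copy 25 27, .const 29 0])
      (.ite (.eq 28 0) (seqs [.load 23 2 23, .copy 24 27, .const 29 1])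
        (seqs [ask r (prim 28 10),
          .ite (.eq 60 2) (seqs [.load 23 2 23, .copy 24 27, .copy 25 28, .const 29 1])
            (seqs [.load 23 4 23, .copy 24 28, .const 29 2])])),
    .store 8 20 29, .add 20 20 1, .store 5 20 23, .store 6 20 24, .store 7 20 25]

/-- One step of the search with backtracking. -/
def walkStep (r : ℕ) (prim : ℕ → ℕ → Primitive ℕ) : Program :=
  seqs [.load 23 5 20, .load 24 6 20, .load 25 7 20,
    ask r (prim 24 10), .copy 26 60, ask r (prim 25 10),
    .ite (.lt 60 26) (.ite (.eq 23 2) (.add 21 21 1) (descend r prim))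
      (.ite (.lt 2 21) (.sub 21 21 1) (.sub 20 20 1))]

/-- The state of a search that has reached the spot `z` on the path `zs` and has `c` extra votes
for it. -/
structure WalkState (n al x : ℕ) (t₀ : Tree) (A₀ : ℕ → ℕ → ℕ) (V₀ : ℕ → ℕ) (m : Mem) (z : Spot)
    (zs : List Spot) (c : ℕ) : Prop where
  stack : Stack m.arr n al x t₀ (z :: zs)
  depth : m.var 20 = zs.length
  count : m.var 21 = c
  idle : 0 < c → z.t = nil
  arr : ∀ B i, B < 5 ∨ 8 < B → m.arr B i = A₀ B i
  var : ∀ y < 20, m.var y = V₀ y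

section Walk

variable {n : ℕ} {P : Fin n → Plane} {e : ℕ → Bool} {prim : ℕ → ℕ → Primitive ℕ} {f : ℕ → ℝ}
  {r al x : ℕ} {t₀ : Tree} {A₀ : ℕ → ℕ → ℕ} {V₀ : ℕ → ℕ} {m : Mem} {z : Spot} {zs : List Spot}

/-- The hypothesis `harr` leaves the new address in array 5 open; all that matters is that it
represents the child, which is `hrep`. -/
theorem WalkState.push {c i : ℕ} {z' : Spot} (hw : WalkState n al x t₀ A₀ V₀ m z zs c)
    (hd : Down z i z') {m' : Mem}
    (harr : ∀ B j, m'.arr B j = if B = 7 ∧ j = zs.length + 1 then z'.hi n else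
      if B = 6 ∧ j = zs.length + 1 then z'.lo x else
      if B = 5 ∧ j = zs.length + 1 then m'.arr 5 (zs.length + 1) else
      if B = 8 ∧ j = zs.length then i else m.arr B j)
    (hrep : Rep m.arr n al (m'.arr 5 (zs.length + 1)) z'.t)
    (hvar : ∀ y < 20, m'.var y = m.var y) (hdepth : m'.var 20 = m.var 20 + 1)
    (hcount : m'.var 21 = 0) : WalkState n al x t₀ A₀ V₀ m' z' (z :: zs) 0 := by
  have h04 : ∀ B < 5, ∀ j < al, m'.arr B j = m.arr B j := by
    intro B hB j _
    rw [harr]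
    simp [show B ≠ 5 by omega, show B ≠ 6 by omega, show B ≠ 7 by omega, show B ≠ 8 by omega]
  refine ⟨⟨⟨hrep.mono le_rfl h04, ?_, ?_⟩, ?_, hw.stack.mono le_rfl h04 ?_ ?_⟩, ?_, hcount,
    by omega, ?_, ?_⟩
  · rw [harr]; simp
  · rw [harr]; simp
  · rw [harr]; simpa using hd
  · intro B hB hB' j hj
    rw [harr]
    simp at hj
    simp [show j ≠ zs.length + 1 by omega, show B ≠ 8 by omega]
  · intro j hj
    rw [harr]
    simp at hj
    simp [show j ≠ zs.length by omega]
  · rw [hdepth, hw.depth]; simp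
  · intro B j hB
    rw [harr, ← hw.arr B j hB]
    simp [show B ≠ 5 by omega, show B ≠ 6 by omega, show B ≠ 7 by omega, show B ≠ 8 by omega]
  · intro y hy; rw [hvar y hy, hw.var y hy]

/-- Some child is entered in any case, so the path remains a genuine path in the tree even after
wrong votes. Only the claim that the child contains the key depends on the votes. The key between
two bounds is located by the bounds themselves, so no global order is required here. -/
theorem wp_descend (hq : OrderQuery P prim f) (h0 : V₀ 0 = n) (h1 : V₀ 1 = 1) (h2 : V₀ 2 = 0)
    (h10 : V₀ 10 = x) (hw : WalkState n al x t₀ A₀ V₀ m z zs 0) (hz : z.t ≠ nil)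
    (h23 : m.var 23 = m.arr 5 zs.length) (h24 : m.var 24 = z.lo x) (h25 : m.var 25 = z.hi n)
    {k : ℕ} (hk : m.calls = r * k) {Q : Mem → Prop}
    (hQ : ∀ m' z' i k', Down z i z' → WalkState n al x t₀ A₀ V₀ m' z' (z :: zs) 0 →
      (badCount r e k k' = 0 → z.on (fun y => (prim y x).answer P) x n = true →
        z'.on (fun y => (prim y x).answer P) x n = true) →
      m'.calls = r * k' → k ≤ k' → k' ≤ k + 2 → m'.var 22 = m.var 22 →
      m'.time ≤ m.time + 2 * askTime r + 30 → Q m') :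
    wp P e (descend r prim) Q m := by
  have v0 := (hw.var 0 (by norm_num)).trans h0
  have v1 := (hw.var 1 (by norm_num)).trans h1
  have v2 := (hw.var 2 (by norm_num)).trans h2
  have v10 := (hw.var 10 (by norm_num)).trans h10
  have v20 := hw.depth
  have v21 := hw.count
  have hrep := (hw.stack.entry).1
  rw [← h23] at hrep
  simp only [descend, seqs, wp]
  refine wp_ask (hq.below _ _ _ (by norm_num) (by norm_num)) (by simp [v1]) (by simp [v2])
    (k := k) (by simpa using hk) fun m₁ hv ha hc ht h60 hans => ?_
  simp only [hq.map_eq] at hans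
  simp [v10] at hv ha ht hans
  obtain ⟨t, p, s⟩ := z
  have hon : ∀ t' p' s', Spot.on (fun y => (prim y x).answer P) x n ⟨t', p', s'⟩ = true ↔
      (prim (p'.getLastD x) x).answer P = true ∧ (prim (s'.headD n) x).answer P = false := by
    intro t' p' s'; simp [Spot.on, Spot.lo, Spot.hi]
  cases t with
  | nil => exact absurd rfl hz
  | two l a s₁ =>
    obtain ⟨-, -, ra, rb, rl, rr⟩ := hrep
    rw [ra] at hans
    have hs := badCount_succ r e (le_refl k)
    rw [badCount_self] at hs
    refine ⟨fun hb => ?_, fun hb => ⟨fun hb' => ?_, fun hb' => ?_⟩⟩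
    · simp [Test.eval, hv, v2] at hb
      refine hQ _ ⟨l, p, a :: (s₁.flat ++ s)⟩ 0 (k + 1) (Down.two_left ..)
        (hw.push (Down.two_left ..) ?_ ?_ ?_ ?_ ?_) ?_ (by simpa using hc) (by omega) (by omega)
        ?_ ?_
      · intro B j; simp [hv, ha, v20, ra, v1, Spot.hi, Spot.lo, h24]
      · simp [hv, ha, v20, v1, rl]
      · intro y hy
        simp [hv y (by omega), show y ≠ 20 by omega, show y ≠ 23 by omega, show y ≠ 25 by omega,
          show y ≠ 29 by omega, show y ≠ 27 by omega, show y ≠ 28 by omega]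
      · simp [hv, v1]
      · simp [hv, v21]
      · intro hbad
        simp only [hon]
        rintro ⟨o1, o2⟩
        have hnb : ¬ BadBlock r e k := by intro hnb; simp [hnb] at hs; omega
        have := hans hnb
        rw [hb] at this
        refine ⟨o1, ?_⟩
        simpa using this.symm
      · simp [hv]
      · simp; omega
    · simp [Test.eval, hv, v2] at hb
      refine hQ _ ⟨s₁, (p ++ l.flat) ++ [a], s⟩ 1 (k + 1) (Down.two_right ..)
        (hw.push (Down.two_right ..) ?_ ?_ ?_ ?_ ?_) ?_ (by simpa using hc) (by omega) (by omega)
        ?_ ?_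
      · intro B j; simp [hv, ha, v20, ra, v1, Spot.hi, Spot.lo, h25]
      · simp [hv, ha, v20, v1, rr]
      · intro y hy
        simp [hv y (by omega), show y ≠ 20 by omega, show y ≠ 23 by omega, show y ≠ 24 by omega,
          show y ≠ 29 by omega, show y ≠ 27 by omega, show y ≠ 28 by omega]
      · simp [hv, v1]
      · simp [hv, v21]
      · intro hbad
        simp only [hon]
        rintro ⟨o1, o2⟩
        have hnb : ¬ BadBlock r e k := by intro hnb; simp [hnb] at hs; omega
        have := hans hnb
        have h61 : m₁.var 60 = 1 := by omega
        rw [h61] at this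
        refine ⟨?_, o2⟩
        simp only [List.getLastD_concat]
        cases hA : (prim a x).answer P with
        | true => rfl
        | false => rw [hA] at this; simp at this
      · simp [hv]
      · simp; omega
    -- A node with one key has n in place of its second key, so the test for a third child cannot
    -- succeed.
    · simp [Test.eval, hv, v0, rb] at hb'
  | three l a m₀ b s₁ =>
    obtain ⟨-, -, ra, rb, rn, rl, rm, rr⟩ := hrep
    rw [ra] at hans
    have hs := badCount_succ r e (le_refl k)
    rw [badCount_self] at hs
    refine ⟨fun hb => ?_, fun hb => ⟨fun hb' => ?_, fun hb' => ?_⟩⟩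
    · simp [Test.eval, hv, v2] at hb
      refine hQ _ ⟨l, p, a :: (m₀.flat ++ b :: (s₁.flat ++ s))⟩ 0 (k + 1) (Down.three_left ..)
        (hw.push (Down.three_left ..) ?_ ?_ ?_ ?_ ?_) ?_ (by simpa using hc) (by omega) (by omega)
        ?_ ?_
      · intro B j; simp [hv, ha, v20, ra, v1, Spot.hi, Spot.lo, h24]
      · simp [hv, ha, v20, v1, rl]
      · intro y hy
        simp [hv y (by omega), show y ≠ 20 by omega, show y ≠ 23 by omega, show y ≠ 25 by omega,
          show y ≠ 29 by omega, show y ≠ 27 by omega, show y ≠ 28 by omega]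
      · simp [hv, v1]
      · simp [hv, v21]
      · intro hbad
        simp only [hon]
        rintro ⟨o1, o2⟩
        have hnb : ¬ BadBlock r e k := by intro hnb; simp [hnb] at hs; omega
        have := hans hnb
        rw [hb] at this
        refine ⟨o1, ?_⟩
        simpa using this.symm
      · simp [hv]
      · simp; omega
    · simp [Test.eval, hv, v0, rb, rn] at hb'
    · simp [Test.eval, hv, v2] at hb
      refine wp_ask (hq.below _ _ _ (by norm_num) (by norm_num)) (by simp [hv, v1])
        (by simp [hv, v2]) (k := k + 1) (by simpa using hc) fun m₂ hv' ha' hc' ht' h60' hans' => ?_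
      simp only [hq.map_eq] at hans'
      simp [v10, hv, rb] at hv' ha' ht' hans'
      have hs' := badCount_succ r e (show k ≤ k + 1 by omega)
      have h61 : m₁.var 60 = 1 := by omega
      rw [h61] at hans
      have hka : badCount r e k (k + 1 + 1) = 0 → (prim a x).answer P = true := by
        intro hbad
        have hnb : ¬ BadBlock r e k := by
          intro hnb; simp [hnb] at hs; omega
        have := hans hnb
        cases hA : (prim a x).answer P with
        | true => rfl
        | false => rw [hA] at this; simp at this
      have hkb : badCount r e k (k + 1 + 1) = 0 → ¬ BadBlock r e (k + 1) := by
        intro hbad hnb; simp [hnb] at hs'; omega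
      refine ⟨fun hb' => ?_, fun hb' => ?_⟩
      · simp [Test.eval, hv', hv, v2] at hb'
        refine hQ _ ⟨m₀, (p ++ l.flat) ++ [a], b :: (s₁.flat ++ s)⟩ 1 (k + 2) (Down.three_mid ..)
          (hw.push (Down.three_mid ..) ?_ ?_ ?_ ?_ ?_) ?_ (by simpa using hc') (by omega)
          (by omega) ?_ ?_
        · intro B j; simp [hv', ha', hv, ha, v20, ra, rb, v1, Spot.hi, Spot.lo]
        · simp [hv', ha', hv, ha, v20, v1, rm]
        · intro y hy
          simp [hv' y (by omega), hv y (by omega), show y ≠ 20 by omega, show y ≠ 23 by omega,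
            show y ≠ 24 by omega, show y ≠ 25 by omega, show y ≠ 29 by omega,
            show y ≠ 27 by omega, show y ≠ 28 by omega]
        · simp [hv', hv, v1]
        · simp [hv', hv, v21]
        · intro hbad
          simp only [hon]
          rintro ⟨o1, o2⟩
          have := hans' (hkb hbad)
          rw [hb'] at this
          simp only [List.getLastD_concat, List.headD_cons]
          refine ⟨hka hbad, ?_⟩
          simpa using this.symm
        · simp [hv', hv]
        · simp; omega
      · simp [Test.eval, hv', hv, v2] at hb'
        refine hQ _ ⟨s₁, (p ++ l.flat ++ a :: m₀.flat) ++ [b], s⟩ 2 (k + 2)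
          (Down.three_right ..)
          (hw.push (Down.three_right ..) ?_ ?_ ?_ ?_ ?_) ?_ (by simpa using hc') (by omega)
          (by omega) ?_ ?_
        · intro B j
          have hl : (p ++ l.flat ++ a :: m₀.flat ++ [b]).getLastD x = b :=
            List.getLastD_concat ..
          simp only [Spot.hi, Spot.lo, hl]
          simp [hv', ha', hv, ha, v20, rb, v1, h25, Spot.hi]
        · simp [hv', ha', hv, ha, v20, v1, rr]
        · intro y hy
          simp [hv' y (by omega), hv y (by omega), show y ≠ 20 by omega, show y ≠ 23 by omega,
            show y ≠ 24 by omega, show y ≠ 29 by omega,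
            show y ≠ 27 by omega, show y ≠ 28 by omega]
        · simp [hv', hv, v1]
        · simp [hv', hv, v21]
        · intro hbad
          simp only [hon]
          rintro ⟨o1, o2⟩
          have := hans' (hkb hbad)
          have h62 : m₂.var 60 = 1 := by omega
          rw [h62] at this
          simp only [List.getLastD_concat]
          refine ⟨?_, o2⟩
          cases hA : (prim b x).answer P with
          | true => rfl
          | false => rw [hA] at this; simp at this
        · simp [hv', hv]
        · simp; omega

end Walk

/-- Search for the place of the key in variable 10 in the tree with root in variable 11. -/
def walk (r : ℕ) (prim : ℕ → ℕ → Primitive ℕ) : Program :=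
  seqs [.const 20 0, .const 21 0, .store 5 20 11, .store 6 20 10, .store 7 20 0, .copy 22 3,
    .loop (.lt 2 22) (seqs [walkStep r prim, .sub 22 22 1])]

section Walk

variable {n : ℕ} {P : Fin n → Plane} {e : ℕ → Bool} {prim : ℕ → ℕ → Primitive ℕ} {f : ℕ → ℝ}
  {r al x : ℕ} {t₀ : Tree} {A₀ : ℕ → ℕ → ℕ} {V₀ : ℕ → ℕ} {m : Mem} {z : Spot} {zs : List Spot}

theorem Spot.on_iff (z : Spot) (b : ℕ → Bool) :
    z.on b x n = true ↔ b (z.lo x) = true ∧ b (z.hi n) = false := by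
  simp [Spot.on]

theorem WalkState.congr {c c' : ℕ} {m' : Mem} (hw : WalkState n al x t₀ A₀ V₀ m z zs c)
    (harr : m'.arr = m.arr) (hdepth : m'.var 20 = m.var 20) (hcount : m'.var 21 = c')
    (hidle : 0 < c' → z.t = nil) (hvar : ∀ y < 20, m'.var y = m.var y) :
    WalkState n al x t₀ A₀ V₀ m' z zs c' :=
  ⟨by rw [harr]; exact hw.stack, by rw [hdepth, hw.depth], hcount, hidle,
    by rw [harr]; exact hw.arr, fun y hy => by rw [hvar y hy, hw.var y hy]⟩

theorem WalkState.pop {z' : Spot} {m' : Mem} (hw : WalkState n al x t₀ A₀ V₀ m z (z' :: zs) 0)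
    (harr : m'.arr = m.arr) (hdepth : m'.var 20 = m.var 20 - 1) (hcount : m'.var 21 = 0)
    (hvar : ∀ y < 20, m'.var y = m.var y) :
    WalkState n al x t₀ A₀ V₀ m' z' zs 0 :=
  ⟨by rw [harr]; exact hw.stack.2.2, by rw [hdepth, hw.depth]; simp, hcount, by omega,
    by rw [harr]; exact hw.arr, fun y hy => by rw [hvar y hy, hw.var y hy]⟩

/-- Without a bad block the two bound tests tell whether the current spot contains the key, and the
move lowers the potential by one. With a bad block the potential rises by at most one, which the
term 2 * `badCount` pays for together with the missing decrease. The sentinels fit the tests: the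
key itself is a lower bound that passes, and n is an invalid index, for which the correct answer is
"no". -/
theorem wp_walkStep (hq : OrderQuery P prim f) (hx : x < n) (h0 : V₀ 0 = n) (h1 : V₀ 1 = 1)
    (h2 : V₀ 2 = 0) (h10 : V₀ 10 = x) (h : ℕ) {c : ℕ} (hw : WalkState n al x t₀ A₀ V₀ m z zs c)
    {k : ℕ} (hk : m.calls = r * k) {Q : Mem → Prop}
    (hQ : ∀ m' z' zs' c' k', WalkState n al x t₀ A₀ V₀ m' z' zs' c' →
      potential (Spot.on (fun y => (prim y x).answer P) x n) h c' (z' :: zs') + 1 ≤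
        potential (Spot.on (fun y => (prim y x).answer P) x n) h c (z :: zs) +
          2 * badCount r e k k' →
      m'.calls = r * k' → k ≤ k' → k' ≤ k + 4 → m'.var 22 = m.var 22 →
      m'.time ≤ m.time + 4 * askTime r + 60 → Q m') :
    wp P e (walkStep r prim) Q m := by
  have v0 := (hw.var 0 (by norm_num)).trans h0
  have v1 := (hw.var 1 (by norm_num)).trans h1
  have v2 := (hw.var 2 (by norm_num)).trans h2
  have v10 := (hw.var 10 (by norm_num)).trans h10
  have v20 := hw.depth
  have v21 := hw.count
  obtain ⟨hrep, e6, e7⟩ := hw.stack.entry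
  simp only [walkStep, seqs, wp]
  refine wp_ask (hq.below _ _ _ (by norm_num) (by norm_num)) (by simp [v1]) (by simp [v2])
    (k := k) (by simpa using hk) fun m₁ hv₁ ha₁ hc₁ ht₁ h60 hans₁ => ?_
  simp only [hq.map_eq] at hans₁
  simp [v10, v20, e6, e7] at hv₁ ha₁ ht₁ hans₁
  refine wp_ask (hq.below _ _ _ (by norm_num) (by norm_num)) (by simp [hv₁, v1])
    (by simp [hv₁, v2]) (k := k + 1) (by simpa using hc₁) fun m₂ hv₂ ha₂ hc₂ ht₂ h60' hans₂ => ?_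
  simp only [hq.map_eq] at hans₂
  simp [v10, hv₁] at hv₂ ha₂ ht₂ hans₂
  set b : ℕ → Bool := fun y => (prim y x).answer P with hbdef
  set on := Spot.on b x n with hondef
  have hs := badCount_succ r e (le_refl k)
  rw [badCount_self] at hs
  have hs' := badCount_succ r e (show k ≤ k + 1 by omega)
  have hvar : ∀ y < 20, m₂.var y = m.var y := by
    intro y hy
    rw [hv₂ y (by omega), if_neg (by omega), hv₁ y (by omega)]
    simp [show y ≠ 23 by omega, show y ≠ 24 by omega, show y ≠ 25 by omega]
  have w2 : m₂.var 2 = 0 := (hvar 2 (by norm_num)).trans v2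
  have w26 : m₂.var 26 = m₁.var 60 := by simp [hv₂]
  have w20 : m₂.var 20 = m.var 20 := by simp [hv₂, hv₁]
  have w21 : m₂.var 21 = m.var 21 := by simp [hv₂, hv₁]
  have w22 : m₂.var 22 = m.var 22 := by simp [hv₂, hv₁]
  have w23 : m₂.var 23 = m.arr 5 zs.length := by simp [hv₂, hv₁]
  have w24 : m₂.var 24 = z.lo x := by simp [hv₂, hv₁]
  have w25 : m₂.var 25 = z.hi n := by simp [hv₂, hv₁]
  have harr : m₂.arr = m.arr := by rw [ha₂]; simpa using ha₁
  have hcorrect : badCount r e k (k + 1 + 1) = 0 →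
      (m₁.var 60 = (b (z.lo x)).toNat ∧ m₂.var 60 = (b (z.hi n)).toNat) := by
    intro hbad
    have n1 : ¬ BadBlock r e k := by intro hnb; simp [hnb] at hs; omega
    have n2 : ¬ BadBlock r e (k + 1) := by intro hnb; simp [hnb] at hs'; omega
    exact ⟨hans₁ n1, hans₂ n2⟩
  have hw₂ : WalkState n al x t₀ A₀ V₀ m₂ z zs c :=
    hw.congr harr w20 (w21.trans v21) hw.idle hvar
  refine ⟨fun hb => ⟨fun hz => ?_, fun hz => ?_⟩, fun hb => ⟨fun hz => ?_, fun hz => ?_⟩⟩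
  · simp only [Test.eval, Mem.tick_var, w23, w2, w26, decide_eq_true_eq] at hz hb
    have hnil : z.t = nil := by
      rw [hz] at hrep
      cases ht : z.t with
      | nil => rfl
      | two l a s => rw [ht] at hrep; exact absurd hrep.1 (lt_irrefl _)
      | three l a s b' s' => rw [ht] at hrep; exact absurd hrep.1 (lt_irrefl _)
    refine hQ _ z zs (c + 1) (k + 1 + 1) (hw₂.congr ?_ ?_ ?_ (fun _ => hnil) ?_) ?_
      (by simpa using hc₂) (by omega) (by omega) ?_ ?_
    · simp
    · simp
    · simp [w21, v21, hvar, v1]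
    · intro y hy; simp [show y ≠ 21 by omega]
    · rw [potential_add]
      by_cases hbad : badCount r e k (k + 1 + 1) = 0
      · obtain ⟨c1, c2⟩ := hcorrect hbad
        have : on z = true := by
          rw [hondef, Spot.on_iff]
          cases hA : b (z.lo x) <;> cases hB : b (z.hi n) <;> simp [hA, hB] at c1 c2 <;>
            first | exact ⟨rfl, rfl⟩ | omega
        simp [this, hbad]
      · split_ifs <;> omega
    · simp [w22]
    · simp; omega
  · simp only [Test.eval, Mem.tick_var, w23, w2, w26, decide_eq_true_eq,
      decide_eq_false_iff_not] at hz hb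
    have hnil : z.t ≠ nil := by
      intro hnil; rw [hnil] at hrep; exact hz hrep
    obtain rfl : c = 0 := by
      by_contra hc; exact hnil (hw.idle (by omega))
    have hw₃ : WalkState n al x t₀ A₀ V₀ m₂.tick.tick z zs 0 :=
      hw₂.congr (by simp) (by simp) (by simp [w21, v21]) (by omega) (fun _ _ => by simp)
    refine wp_descend (m := m₂.tick.tick) hq h0 h1 h2 h10 hw₃ hnil
      (by simp [w23, harr]) (by simp [w24]) (by simp [w25]) (k := k + 1 + 1) (by simpa using hc₂)
      fun m' z' i k' hd hw' hgood hc' hk1 hk2 h22 ht => ?_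
    have hadd := badCount_add r e (show k ≤ k + 1 + 1 by omega) hk1
    refine hQ m' z' (z :: zs) 0 k' hw' ?_ hc' (by omega) (by omega) (by rw [h22]; simp [w22]) ?_
    · rw [potential_push]
      by_cases hbad : badCount r e k k' = 0
      · obtain ⟨c1, c2⟩ := hcorrect (by omega)
        have : on z = true := by
          rw [hondef, Spot.on_iff]
          cases hA : b (z.lo x) <;> cases hB : b (z.hi n) <;> simp [hA, hB] at c1 c2 <;>
            first | exact ⟨rfl, rfl⟩ | omega
        have hz' : on z' = true := hgood (by omega) this
        simp [hz', hbad]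
      · split_ifs <;> omega
    · simp at ht; omega
  · simp only [Test.eval, Mem.tick_var, w21, v21, w2, w26, decide_eq_true_eq,
      decide_eq_false_iff_not] at hz hb
    obtain ⟨c, rfl⟩ : ∃ g, c = g + 1 := ⟨c - 1, by omega⟩
    refine hQ _ z zs c (k + 1 + 1) (hw₂.congr ?_ ?_ ?_ (fun _ => hw.idle (by omega)) ?_) ?_
      (by simpa using hc₂) (by omega) (by omega) ?_ ?_
    · simp
    · simp
    · simp [w21, v21, hvar, v1]
    · intro y hy; simp [show y ≠ 21 by omega]
    · rw [potential_add]
      by_cases hbad : badCount r e k (k + 1 + 1) = 0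
      · obtain ⟨c1, c2⟩ := hcorrect hbad
        have : ¬ on z = true := by
          rw [hondef, Spot.on_iff]
          rintro ⟨o1, o2⟩
          simp [o1, o2] at c1 c2; omega
        simp [this, hbad]
      · split_ifs <;> omega
    · simp [w22]
    · simp; omega
  · simp only [Test.eval, Mem.tick_var, w21, v21, w2, w26,
      decide_eq_false_iff_not] at hz hb
    obtain rfl : c = 0 := by omega
    cases zs with
    | nil =>
      refine hQ _ z [] 0 (k + 1 + 1) (hw₂.congr ?_ ?_ ?_ (by omega) ?_) ?_
        (by simpa using hc₂) (by omega) (by omega) ?_ ?_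
      · simp
      · simp [w20, v20]
      · simp [w21, v21]
      · intro y hy; simp [show y ≠ 20 by omega]
      -- At the root the truncated subtraction leaves the depth at 0, so nothing is gained. But the
      -- root always contains the key, so the search gets here only through a wrong vote.
      · have hne : badCount r e k (k + 1 + 1) ≠ 0 := by
          intro hbad
          obtain ⟨c1, c2⟩ := hcorrect hbad
          obtain ⟨rfl, -⟩ := hw.stack
          have hx1 : b x = true := (hq.answer_iff x x).2 ⟨hx, hx, le_rfl⟩
          have hx2 : b n = false := by
            cases hA : b n with
            | false => rfl
            | true => exact absurd ((hq.answer_iff n x).1 hA).1 (lt_irrefl _)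
          simp [Spot.lo, Spot.hi, hx1, hx2] at c1 c2
          omega
        omega
      · simp [w22]
      · simp; omega
    | cons z' zs =>
      refine hQ _ z' zs 0 (k + 1 + 1) (hw₂.pop ?_ ?_ ?_ ?_) ?_
        (by simpa using hc₂) (by omega) (by omega) ?_ ?_
      · simp
      · simp [hvar, v1]
      · simp [w21, v21]
      · intro y hy; simp [show y ≠ 20 by omega]
      · rw [potential_push]
        by_cases hbad : badCount r e k (k + 1 + 1) = 0
        · obtain ⟨c1, c2⟩ := hcorrect hbad
          have : ¬ on z = true := by
            rw [hondef, Spot.on_iff]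
            rintro ⟨o1, o2⟩
            simp [o1, o2] at c1 c2; omega
          simp [this, hbad]
        · split_ifs <;> omega
      · simp [w22]
      · simp; omega

/-- The running time of `walk` with `w` steps. -/
def walkTime (r w : ℕ) : ℕ := w * (4 * askTime r + 65) + 20

/-- The potential starts at h < 8 w. The 16 w steps cast at most 64 w votes, fewer than 4 w of them
bad, so it ends below h + 8 w - 16 w < 0. By `potential_neg` the search then stands at a spot that
contains the key and has confirmations, hence at a leaf. -/
theorem wp_walk (hq : OrderQuery P prim f) (hx : x < n) {w h k : ℕ} (hr : Reliable r w e)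
    (h0 : m.var 0 = n) (h1 : m.var 1 = 1) (h2 : m.var 2 = 0) (h3 : m.var 3 = 16 * w)
    (h10 : m.var 10 = x) (hrep : Rep m.arr n al (m.var 11) t₀) (hbal : t₀.Bal h)
    (hh : h < 8 * w) (hk : m.calls = r * k) {Q : Mem → Prop}
    (hQ : ∀ m' z zs c k', WalkState n al x t₀ m.arr m.var m' z zs c → 0 < c →
      z.on (fun y => (prim y x).answer P) x n = true → m'.calls = r * k' →
      m'.time ≤ m.time + walkTime r (16 * w) → Q m') :
    wp P e (walk r prim) Q m := by
  -- A step casts at most four votes, two at the bounds and two on the way down, so the whole walk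
  -- fits into four consecutive windows.
  have hb1 := hr.badCount_lt k
  have hb2 := hr.badCount_lt (k + 16 * w)
  have hb3 := hr.badCount_lt (k + 16 * w + 16 * w)
  have hb4 := hr.badCount_lt (k + 16 * w + 16 * w + 16 * w)
  have hb : badCount r e k (k + 16 * w + 16 * w + 16 * w + 16 * w) < 4 * w := by
    rw [badCount_add r e (k' := k + 16 * w + 16 * w + 16 * w) (by omega) (by omega),
      badCount_add r e (k' := k + 16 * w + 16 * w) (by omega) (by omega),
      badCount_add r e (k' := k + 16 * w) (by omega) (by omega)]
    omega
  set on := Spot.on (fun y => (prim y x).answer P) x n with hondef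
  simp only [walk, seqs, wp]
  refine wp.loop (fun j m' => ∃ z zs c k', WalkState n al x t₀ m.arr m.var m' z zs c ∧
    potential on h c (z :: zs) + (16 * w - j : ℕ) ≤ h + 2 * badCount r e k k' ∧
    m'.calls = r * k' ∧ k ≤ k' ∧ k' ≤ k + 4 * (16 * w - j) ∧ m'.var 22 = j ∧ j ≤ 16 * w ∧
    m'.time + j * (4 * askTime r + 65) ≤ m.time + 12 + 16 * w * (4 * askTime r + 65))
    ?_ ?_ (16 * w) _ ?_
  · rintro j m' ⟨z, zs, c, k', hw, hpot, hc, hk1, hk2, h22, hj, ht⟩ hb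
    have u2 := (hw.var 2 (by norm_num)).trans h2
    simp only [Test.eval, h22, u2, decide_eq_true_eq] at hb
    obtain ⟨j, rfl⟩ : ∃ g, j = g + 1 := ⟨j - 1, by omega⟩
    refine ⟨j, rfl, ?_⟩
    refine wp_walkStep (m := m'.tick.tick) hq hx h0 h1 h2 h10 h (hw.congr rfl rfl hw.count hw.idle fun _ _ => rfl)
      (by simpa using hc) fun m'' z' zs' c' k'' hw' hpot' hc' hk1' hk2' h22' ht' => ?_
    have u1 := (hw'.var 1 (by norm_num)).trans h1
    have hadd := badCount_add r e hk1 hk1'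
    refine ⟨z', zs', c', k'', hw'.congr ?_ ?_ ?_ hw'.idle ?_, ?_, ?_, by omega, by omega, ?_,
      by omega, ?_⟩
    · simp
    · simp
    · simp [hw'.count]
    · intro y hy; simp [show y ≠ 22 by omega]
    · have e1 : ((16 * w - j : ℕ) : ℤ) = (16 * w - (j + 1) : ℕ) + 1 := by omega
      rw [← hondef] at hpot'
      rw [e1, hadd]
      push_cast
      omega
    · simpa using hc'
    · simp [h22', h22, u1]
    · simp at ht' ⊢
      rw [add_mul] at ht
      omega
  · rintro j m' ⟨z, zs, c, k', hw, hpot, hc, hk1, hk2, h22, hj, ht⟩ hb'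
    have u2 := (hw.var 2 (by norm_num)).trans h2
    simp only [Test.eval, h22, u2, decide_eq_false_iff_not, not_lt, Nat.le_zero] at hb'
    subst hb'
    have hb4' := badCount_mono r e (k := k)
      (show k' ≤ k + 16 * w + 16 * w + 16 * w + 16 * w by omega)
    obtain ⟨hon, hc0⟩ := potential_neg on h hbal hw.stack (c := c) (by omega)
    refine hQ _ z zs c k' (hw.congr ?_ ?_ ?_ hw.idle ?_) hc0 hon (by simpa using hc) ?_
    · simp
    · simp
    · simp [hw.count]
    · intro y hy; simp
    · simp [walkTime]; omega
  · have hone : on ⟨t₀, [], []⟩ = true := by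
      rw [hondef, Spot.on_iff]
      refine ⟨(hq.answer_iff x x).2 ⟨hx, hx, le_rfl⟩, ?_⟩
      cases hA : (prim n x).answer P with
      | false => exact hA
      | true => exact absurd ((hq.answer_iff n x).1 hA).1 (lt_irrefl _)
    refine ⟨⟨t₀, [], []⟩, [], 0, k, ⟨⟨rfl, ?_, ?_, ?_⟩, ?_, ?_, by omega, ?_, ?_⟩, ?_, ?_, le_rfl,
      by omega, ?_, le_rfl, ?_⟩
    · simp
      refine hrep.mono le_rfl ?_
      intro B hB i _
      simp [show B ≠ 5 by omega, show B ≠ 6 by omega, show B ≠ 7 by omega]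
    · simp [Spot.lo, h10]
    · simp [Spot.hi, h0]
    · simp
    · simp
    · intro B i hB
      simp [show B ≠ 5 by omega, show B ≠ 6 by omega, show B ≠ 7 by omega]
    · intro y hy
      simp [show y ≠ 20 by omega, show y ≠ 21 by omega, show y ≠ 22 by omega]
    · simp [potential, hone, badCount_self]
    · simpa using hk
    · simp [h3]
    · simp

end Walk

/-! ### Rebuilding the tree along the search path -/

/-- Allocate a node; `l`, `a`, `s`, `b`, `t` are the variables that hold its fields. -/
def mkNode (l a s b t out : ℕ) : Program :=
  seqs [.store 0 5 l, .store 1 5 a, .store 2 5 s, .store 3 5 b, .store 4 5 t, .copy out 5,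
    .add 5 5 1]

/-- Rebuild a node with a changed child. -/
def zipBuild : Program :=
  .ite (.eq 31 2)
    (seqs [.ite (.eq 29 2) (.copy 35 32) (.ite (.eq 29 1) (.copy 37 32) (.copy 39 32)),
      mkNode 35 36 37 38 39 32])
    (.ite (.eq 38 0)
      (seqs [.ite (.eq 29 2) (mkNode 32 33 34 36 37 32) (mkNode 35 36 32 33 34 32),
        .const 31 0])
      (.ite (.eq 29 2)
        (seqs [mkNode 32 33 34 0 39 32, mkNode 37 38 39 0 39 34, .copy 33 36])
        (.ite (.eq 29 1)
          (seqs [mkNode 35 36 32 0 39 32, mkNode 34 38 39 0 39 34])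
          (seqs [mkNode 32 33 34 0 39 34, mkNode 35 36 37 0 39 32, .copy 33 38]))))

/-- Rebuild the tree along the search path, one level up. -/
def zipStep : Program :=
  seqs [.sub 20 20 1, .load 23 5 20, .load 29 8 20, .load 35 0 23, .load 36 1 23, .load 37 2 23,
    .load 38 3 23, .load 39 4 23, zipBuild]

/-- Either one tree of height `h` with keys `l`, or two such trees with a key in between. -/
def Pieces (A : ℕ → ℕ → ℕ) (n al u v a v' h : ℕ) (l : List ℕ) : Prop :=
  (u = 0 ∧ ∃ t, Rep A n al v t ∧ t.Bal h ∧ t.flat = l) ∨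
  (u = 1 ∧ ∃ t t', Rep A n al v t ∧ Rep A n al v' t' ∧ t.Bal h ∧ t'.Bal h ∧
    t.flat ++ a :: t'.flat = l)

section Zip

variable {n : ℕ} {P : Fin n → Plane} {e : ℕ → Bool} {m : Mem}

theorem wp_mkNode {l a s b t out : ℕ} (h1 : m.var 1 = 1) (hout : out ≠ 5) (hout1 : out ≠ 1)
    {Q : Mem → Prop}
    (hQ : ∀ m' : Mem, (∀ B, ∀ i, i ≠ m.var 5 → m'.arr B i = m.arr B i) →
      (∀ B i, 5 ≤ B → m'.arr B i = m.arr B i) →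
      m'.arr 0 (m.var 5) = m.var l → m'.arr 1 (m.var 5) = m.var a →
      m'.arr 2 (m.var 5) = m.var s → m'.arr 3 (m.var 5) = m.var b →
      m'.arr 4 (m.var 5) = m.var t →
      (∀ y, m'.var y = if y = 5 then m.var 5 + 1 else if y = out then m.var 5 else m.var y) →
      m'.calls = m.calls → m'.time = m.time + 13 → Q m') :
    wp P e (mkNode l a s b t out) Q m := by
  simp only [mkNode, seqs, wp]
  refine hQ _ ?_ ?_ ?_ ?_ ?_ ?_ ?_ ?_ ?_ ?_
  · intro B i hi; simp [hi]
  · intro B i hB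
    simp [show B ≠ 0 by omega, show B ≠ 1 by omega, show B ≠ 2 by omega, show B ≠ 3 by omega,
      show B ≠ 4 by omega]
  · simp
  · simp
  · simp
  · simp
  · simp
  · intro y; simp [hout.symm, hout1.symm, h1]
  · simp
  · simp

theorem wp_mkTwo {l a s b t out : ℕ} {tl tr : Tree} (h0 : m.var b = n) (h1 : m.var 1 = 1)
    (hout : out ≠ 5) (hout1 : out ≠ 1) (hal : 0 < m.var 5)
    (hl : Rep m.arr n (m.var 5) (m.var l) tl) (hr : Rep m.arr n (m.var 5) (m.var s) tr)
    {Q : Mem → Prop}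
    (hQ : ∀ m' : Mem, (∀ B < 5, ∀ i < m.var 5, m'.arr B i = m.arr B i) →
      (∀ B i, 5 ≤ B → m'.arr B i = m.arr B i) →
      Rep m'.arr n (m.var 5 + 1) (m.var 5) (.two tl (m.var a) tr) →
      (∀ y, m'.var y = if y = 5 then m.var 5 + 1 else if y = out then m.var 5 else m.var y) →
      m'.calls = m.calls → m'.time = m.time + 13 → Q m') :
    wp P e (mkNode l a s b t out) Q m := by
  refine wp_mkNode h1 hout hout1 fun m' g1 g2 a0 a1 a2 a3 a4 g3 g4 g5 => ?_
  have g : ∀ B < 5, ∀ i < m.var 5, m'.arr B i = m.arr B i := fun B _ i hi => g1 B i (by omega)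
  refine hQ m' g g2 ⟨hal, by omega, a1, by rw [a3, h0], ?_, ?_⟩ g3 g4 g5
  · rw [a0]; exact hl.mono (by omega) g
  · rw [a2]; exact hr.mono (by omega) g

theorem wp_mkThree {l a s b t out : ℕ} {tl tm tr : Tree} (h1 : m.var 1 = 1)
    (hout : out ≠ 5) (hout1 : out ≠ 1) (hal : 0 < m.var 5)
    (hl : Rep m.arr n (m.var 5) (m.var l) tl) (hm : Rep m.arr n (m.var 5) (m.var s) tm)
    (hr : Rep m.arr n (m.var 5) (m.var t) tr) (hb : m.var b ≠ n)
    {Q : Mem → Prop}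
    (hQ : ∀ m' : Mem, (∀ B < 5, ∀ i < m.var 5, m'.arr B i = m.arr B i) →
      (∀ B i, 5 ≤ B → m'.arr B i = m.arr B i) →
      Rep m'.arr n (m.var 5 + 1) (m.var 5) (.three tl (m.var a) tm (m.var b) tr) →
      (∀ y, m'.var y = if y = 5 then m.var 5 + 1 else if y = out then m.var 5 else m.var y) →
      m'.calls = m.calls → m'.time = m.time + 13 → Q m') :
    wp P e (mkNode l a s b t out) Q m := by
  refine wp_mkNode h1 hout hout1 fun m' g1 g2 a0 a1 a2 a3 a4 g3 g4 g5 => ?_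
  have g : ∀ B < 5, ∀ i < m.var 5, m'.arr B i = m.arr B i := fun B _ i hi => g1 B i (by omega)
  refine hQ m' g g2 ⟨hal, by omega, a1, a3, hb, ?_, ?_, ?_⟩ g3 g4 g5
  · rw [a0]; exact hl.mono (by omega) g
  · rw [a2]; exact hm.mono (by omega) g
  · rw [a4]; exact hr.mono (by omega) g

theorem Down.shape {z z' : Spot} {i : ℕ} (hd : Down z i z') :
    ∃ left right, z'.pre = z.pre ++ left ∧ z'.post = right ++ z.post ∧
      z.t.flat = left ++ z'.t.flat ++ right := by
  cases hd with
  | two_left l a r p s => exact ⟨[], a :: r.flat, by simp, by simp, by simp [flat]⟩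
  | two_right l a r p s => exact ⟨l.flat ++ [a], [], by simp, by simp, by simp [flat]⟩
  | three_left l a m b r p s =>
    exact ⟨[], a :: (m.flat ++ b :: r.flat), by simp, by simp, by simp [flat]⟩
  | three_mid l a m b r p s =>
    exact ⟨l.flat ++ [a], b :: r.flat, by simp, by simp, by simp [flat]⟩
  | three_right l a m b r p s =>
    exact ⟨l.flat ++ a :: m.flat ++ [b], [], by simp, by simp, by simp [flat]⟩

theorem Stack.flat_eq {A : ℕ → ℕ → ℕ} {al x : ℕ} {t₀ : Tree} {z : Spot} {zs : List Spot}
    (hs : Stack A n al x t₀ (z :: zs)) : z.pre ++ z.t.flat ++ z.post = t₀.flat := by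
  induction zs generalizing z with
  | nil => obtain ⟨rfl, -⟩ := hs; simp
  | cons z' zs ih =>
    obtain ⟨left, right, h1, h2, h3⟩ := hs.2.1.shape
    rw [← ih hs.2.2, h1, h2, h3]; simp

/-- This is one level of insertion into a 2-3 tree. A single piece from below just replaces the old
child. Two pieces turn a node with one key into a node with two keys; at a node with two keys they
make it split into two nodes of equal height, and the middle one of its three keys moves up. The
lists `left` and `right` are the keys of the node on either side of the child. -/
theorem wp_zipBuild {h v : ℕ} {z z' : Spot} {L left right : List ℕ}
    (h0 : m.var 0 = n) (h1 : m.var 1 = 1) (h2 : m.var 2 = 0) (hal : 0 < m.var 5)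
    (hd : Down z' (m.var 29) z) (hrep : Rep m.arr n (m.var 5) v z'.t) (hz : z'.t.Bal (h + 1))
    (f35 : m.var 35 = m.arr 0 v) (f36 : m.var 36 = m.arr 1 v) (f37 : m.var 37 = m.arr 2 v)
    (f38 : m.var 38 = m.arr 3 v) (f39 : m.var 39 = m.arr 4 v)
    (hlt : ∀ y ∈ z'.t.flat, y < n) (hL : ∀ y ∈ L, y < n)
    (hpre : z.pre = z'.pre ++ left) (hpost : z.post = right ++ z'.post)
    (hp : Pieces m.arr n (m.var 5) (m.var 31) (m.var 32) (m.var 33) (m.var 34) h L)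
    {Q : Mem → Prop}
    (hQ : ∀ m' : Mem, m.var 5 ≤ m'.var 5 →
      (∀ B < 5, ∀ i < m.var 5, m'.arr B i = m.arr B i) →
      (∀ B i, 5 ≤ B → m'.arr B i = m.arr B i) →
      (∀ y < 31, y ≠ 5 → m'.var y = m.var y) → m'.calls = m.calls → m'.time ≤ m.time + 40 →
      Pieces m'.arr n (m'.var 5) (m'.var 31) (m'.var 32) (m'.var 33) (m'.var 34) (h + 1)
        (left ++ L ++ right) → Q m') :
    wp P e zipBuild Q m := by
  simp only [zipBuild, seqs, wp]
  generalize hi : m.var 29 = i at hd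
  have vars : ∀ y < 31, y ≠ 31 ∧ y ≠ 32 ∧ y ≠ 33 ∧ y ≠ 34 ∧ y ≠ 35 ∧ y ≠ 37 ∧ y ≠ 39 := by omega
  rcases hp with ⟨hu, t, r1, b1, rfl⟩ | ⟨hu, t, t', r1, r1', b1, b1', rfl⟩
  · refine ⟨fun _ => ?_, fun hb => by simp [Test.eval, hu, h2] at hb⟩
    cases hd with
    | two_left l a r p s =>
      obtain ⟨-, -, ra, rb, rl, rr⟩ := hrep
      obtain ⟨_, hh, c1, c2⟩ := hz
      obtain rfl := Nat.succ_injective hh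
      obtain rfl : left = [] := List.append_cancel_left (as := p) (by simpa using hpre.symm)
      obtain rfl : right = a :: r.flat :=
        List.append_cancel_right (bs := s) (by simpa using hpost.symm)
      refine ⟨fun _ => ?_, fun hb => by simp [Test.eval, hi, h2] at hb⟩
      refine wp_mkTwo (n := n) (tl := t) (tr := r) (by simp [f38, rb]) (by simp [h1])
        (by norm_num) (by norm_num) (by simpa using hal) (by simpa using r1)
        (by simpa [f37] using rr)
        fun m' g1 g2 g3 g4 g5 g6 => ?_
      refine hQ _ (by simp [g4]) (fun B hB j hj => by simpa using g1 B hB j (by simpa using hj))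
          (fun B j hB => by simpa using g2 B j hB) (fun y hy hy5 => by simp [g4, hy5, vars y hy])
          (by simp [g5]) (by simp [g6]) ?_
      refine Or.inl ⟨by simp [g4, hu], .two t a r, by simpa [g4, f36, ra] using g3,
        ⟨_, rfl, b1, c2⟩, ?_⟩
      simp [flat]
    | two_right l a r p s =>
      obtain ⟨-, -, ra, rb, rl, rr⟩ := hrep
      obtain ⟨_, hh, c1, c2⟩ := hz
      obtain rfl := Nat.succ_injective hh
      obtain rfl : left = l.flat ++ [a] := List.append_cancel_left (as := p) (by simpa using hpre.symm)
      obtain rfl : right = [] :=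
        List.append_cancel_right (bs := s) (by simpa using hpost.symm)
      refine ⟨fun hb => by simp [Test.eval, hi, h2] at hb,
        fun _ => ⟨fun _ => ?_, fun hb => by simp [Test.eval, hi, h1] at hb⟩⟩
      refine wp_mkTwo (n := n) (tl := l) (tr := t) (by simp [f38, rb]) (by simp [h1])
        (by norm_num) (by norm_num) (by simpa using hal) (by simpa [f35] using rl)
        (by simpa using r1)
        fun m' g1 g2 g3 g4 g5 g6 => ?_
      refine hQ _ (by simp [g4]) (fun B hB j hj => by simpa using g1 B hB j (by simpa using hj))
          (fun B j hB => by simpa using g2 B j hB) (fun y hy hy5 => by simp [g4, hy5, vars y hy])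
          (by simp [g5]) (by simp [g6]) ?_
      refine Or.inl ⟨by simp [g4, hu], .two l a t, by simpa [g4, f36, ra] using g3,
        ⟨_, rfl, c1, b1⟩, ?_⟩
      simp [flat]
    | three_left l a q b r p s =>
      obtain ⟨-, -, ra, rb, rn, rl, rm, rr⟩ := hrep
      obtain ⟨_, hh, c1, c2, c3⟩ := hz
      obtain rfl := Nat.succ_injective hh
      obtain rfl : left = [] := List.append_cancel_left (as := p) (by simpa using hpre.symm)
      obtain rfl : right = a :: (q.flat ++ b :: r.flat) :=
        List.append_cancel_right (bs := s) (by simpa using hpost.symm)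
      refine ⟨fun _ => ?_, fun hb => by simp [Test.eval, hi, h2] at hb⟩
      refine wp_mkThree (n := n) (tl := t) (tm := q) (tr := r) (by simp [h1])
        (by norm_num) (by norm_num) (by simpa using hal) (by simpa using r1)
        (by simpa [f37] using rm) (by simpa [f39] using rr)
        (by simpa [f38, rb] using rn)
        fun m' g1 g2 g3 g4 g5 g6 => ?_
      refine hQ _ (by simp [g4]) (fun B hB j hj => by simpa using g1 B hB j (by simpa using hj))
          (fun B j hB => by simpa using g2 B j hB) (fun y hy hy5 => by simp [g4, hy5, vars y hy])
          (by simp [g5]) (by simp [g6]) ?_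
      refine Or.inl ⟨by simp [g4, hu], .three t a q b r, by simpa [g4, f36, ra, f38, rb] using g3,
        ⟨_, rfl, b1, c2, c3⟩, ?_⟩
      simp [flat]
    | three_mid l a q b r p s =>
      obtain ⟨-, -, ra, rb, rn, rl, rm, rr⟩ := hrep
      obtain ⟨_, hh, c1, c2, c3⟩ := hz
      obtain rfl := Nat.succ_injective hh
      obtain rfl : left = l.flat ++ [a] := List.append_cancel_left (as := p) (by simpa using hpre.symm)
      obtain rfl : right = b :: r.flat :=
        List.append_cancel_right (bs := s) (by simpa using hpost.symm)
      refine ⟨fun hb => by simp [Test.eval, hi, h2] at hb,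
        fun _ => ⟨fun _ => ?_, fun hb => by simp [Test.eval, hi, h1] at hb⟩⟩
      refine wp_mkThree (n := n) (tl := l) (tm := t) (tr := r) (by simp [h1])
        (by norm_num) (by norm_num) (by simpa using hal) (by simpa [f35] using rl)
        (by simpa using r1) (by simpa [f39] using rr)
        (by simpa [f38, rb] using rn)
        fun m' g1 g2 g3 g4 g5 g6 => ?_
      refine hQ _ (by simp [g4]) (fun B hB j hj => by simpa using g1 B hB j (by simpa using hj))
          (fun B j hB => by simpa using g2 B j hB) (fun y hy hy5 => by simp [g4, hy5, vars y hy])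
          (by simp [g5]) (by simp [g6]) ?_
      refine Or.inl ⟨by simp [g4, hu], .three l a t b r, by simpa [g4, f36, ra, f38, rb] using g3,
        ⟨_, rfl, c1, b1, c3⟩, ?_⟩
      simp [flat]
    | three_right l a q b r p s =>
      obtain ⟨-, -, ra, rb, rn, rl, rm, rr⟩ := hrep
      obtain ⟨_, hh, c1, c2, c3⟩ := hz
      obtain rfl := Nat.succ_injective hh
      obtain rfl : left = l.flat ++ a :: q.flat ++ [b] := List.append_cancel_left (as := p) (by simpa using hpre.symm)
      obtain rfl : right = [] :=
        List.append_cancel_right (bs := s) (by simpa using hpost.symm)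
      refine ⟨fun hb => by simp [Test.eval, hi, h2] at hb,
        fun _ => ⟨fun hb => by simp [Test.eval, hi, h1] at hb, fun _ => ?_⟩⟩
      refine wp_mkThree (n := n) (tl := l) (tm := q) (tr := t) (by simp [h1])
        (by norm_num) (by norm_num) (by simpa using hal) (by simpa [f35] using rl)
        (by simpa [f37] using rm) (by simpa using r1)
        (by simpa [f38, rb] using rn)
        fun m' g1 g2 g3 g4 g5 g6 => ?_
      refine hQ _ (by simp [g4]) (fun B hB j hj => by simpa using g1 B hB j (by simpa using hj))
          (fun B j hB => by simpa using g2 B j hB) (fun y hy hy5 => by simp [g4, hy5, vars y hy])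
          (by simp [g5]) (by simp [g6]) ?_
      refine Or.inl ⟨by simp [g4, hu], .three l a q b t, by simpa [g4, f36, ra, f38, rb] using g3,
        ⟨_, rfl, c1, c2, b1⟩, ?_⟩
      simp [flat]
  · refine ⟨fun hb => by simp [Test.eval, hu, h2] at hb, fun _ => ?_⟩
    -- Keys are below n, hence cannot be confused with the mark n of nodes with a single key.
    have hav : m.var 33 < n := hL _ (by simp)
    cases hd with
    | two_left l a r p s =>
      obtain ⟨-, -, ra, rb, rl, rr⟩ := hrep
      obtain ⟨_, hh, c1, c2⟩ := hz
      obtain rfl := Nat.succ_injective hh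
      obtain rfl : left = [] := List.append_cancel_left (as := p) (by simpa using hpre.symm)
      obtain rfl : right = a :: r.flat :=
        List.append_cancel_right (bs := s) (by simpa using hpost.symm)
      refine ⟨fun _ => ?_, fun hb => by simp [Test.eval, f38, rb, h0] at hb⟩
      refine ⟨fun _ => ?_, fun hb => by simp [Test.eval, hi, h2] at hb⟩
      have han : a < n := hlt a (by simp [flat])
      refine wp_mkThree (n := n) (tl := t) (tm := t') (tr := r) (by simp [h1])
        (by norm_num) (by norm_num) (by simpa using hal) (by simpa using r1)
        (by simpa using r1') (by simpa [f37] using rr) (by simp [f36, ra]; omega)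
        fun m' g1 g2 g3 g4 g5 g6 => ?_
      refine hQ _ (by simp [g4]) (fun B hB j hj => by simpa using g1 B hB j (by simpa using hj))
          (fun B j hB => by simpa using g2 B j hB) (fun y hy hy5 => by simp [g4, hy5, vars y hy])
          (by simp [g5]) (by simp [g6]) ?_
      refine Or.inl ⟨by simp, .three t (m.var 33) t' a r, by simpa [g4, f36, ra] using g3,
        ⟨_, rfl, b1, b1', c2⟩, ?_⟩
      simp [flat]
    | two_right l a r p s =>
      obtain ⟨-, -, ra, rb, rl, rr⟩ := hrep
      obtain ⟨_, hh, c1, c2⟩ := hz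
      obtain rfl := Nat.succ_injective hh
      obtain rfl : left = l.flat ++ [a] := List.append_cancel_left (as := p) (by simpa using hpre.symm)
      obtain rfl : right = [] :=
        List.append_cancel_right (bs := s) (by simpa using hpost.symm)
      refine ⟨fun _ => ?_, fun hb => by simp [Test.eval, f38, rb, h0] at hb⟩
      refine ⟨fun hb => by simp [Test.eval, hi, h2] at hb, fun _ => ?_⟩
      refine wp_mkThree (n := n) (tl := l) (tm := t) (tr := t') (by simp [h1])
        (by norm_num) (by norm_num) (by simpa using hal) (by simpa [f35] using rl)
        (by simpa using r1) (by simpa using r1') (by simp; omega)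
        fun m' g1 g2 g3 g4 g5 g6 => ?_
      refine hQ _ (by simp [g4]) (fun B hB j hj => by simpa using g1 B hB j (by simpa using hj))
          (fun B j hB => by simpa using g2 B j hB) (fun y hy hy5 => by simp [g4, hy5, vars y hy])
          (by simp [g5]) (by simp [g6]) ?_
      refine Or.inl ⟨by simp, .three l a t (m.var 33) t', by simpa [g4, f36, ra] using g3,
        ⟨_, rfl, c1, b1, b1'⟩, ?_⟩
      simp [flat]
    | three_left l a q b r p s =>
      obtain ⟨-, -, ra, rb, rn, rl, rm, rr⟩ := hrep
      obtain ⟨_, hh, c1, c2, c3⟩ := hz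
      obtain rfl := Nat.succ_injective hh
      obtain rfl : left = [] := List.append_cancel_left (as := p) (by simpa using hpre.symm)
      obtain rfl : right = a :: (q.flat ++ b :: r.flat) :=
        List.append_cancel_right (bs := s) (by simpa using hpost.symm)
      refine ⟨fun hb => by simp [Test.eval, f38, rb, h0, rn] at hb, fun _ => ?_⟩
      refine ⟨fun _ => ?_, fun hb => by simp [Test.eval, hi, h2] at hb⟩
      refine wp_mkTwo (n := n) (tl := t) (tr := t') (by simp [h0]) (by simp [h1])
        (by norm_num) (by norm_num) (by simpa using hal) (by simpa using r1)
        (by simpa using r1') fun m₁ k1 k2 k3 k4 k5 k6 => ?_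
      have e5 : m₁.var 5 = m.var 5 + 1 := by simp [k4]
      -- The second half of the split is allocated after the first, so the old subtrees have to be
      -- carried over to the enlarged memory.
      have up : ∀ {v t}, Rep m.arr n (m.var 5) v t → Rep m₁.arr n (m₁.var 5) v t := fun h =>
        h.mono (by omega) fun B hB j hj => by simpa using k1 B hB j (by simpa using hj)
      refine wp_mkTwo (n := n) (tl := q) (tr := r) (by simp [k4, h0]) (by simp [k4, h1])
        (by norm_num) (by norm_num) (by simp [e5]) (by simpa [f37, k4] using up rm)
        (by simpa [f39, k4] using up rr) fun m' g1 g2 g3 g4 g5 g6 => ?_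
      refine hQ _ (by simp [g4, e5]; omega) (fun B hB j hj => ?_) (fun B j hB => ?_)
        (fun y hy hy5 => by simp [g4, k4, hy5, vars y hy]) (by simp [g5, k5])
        (by simp [g6, k6]) ?_
      · have e1 : m'.arr B j = m₁.arr B j := by simpa using g1 B hB j (by simp [e5]; omega)
        simpa [e1] using k1 B hB j (by simpa using hj)
      · have e1 : m'.arr B j = m₁.arr B j := by simpa using g2 B j hB
        simpa [e1] using k2 B j hB
      have k3' := k3.mono (A' := m'.arr) (al' := m.var 5 + 1 + 1) (by simp) (fun B hB j hj => by
        simpa using g1 B hB j (by simpa [e5] using hj))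
      refine Or.inr ⟨by simp [g4, k4, hu], .two t (m.var 33) t', .two q b r,
        (by simpa [g4, k4, f36, ra] using k3'), (by simpa [g4, k4, e5, f36, f38, ra, rb] using g3),
        ⟨_, rfl, b1, b1'⟩, ⟨_, rfl, c2, c3⟩, ?_⟩
      simp [flat, g4, k4, f36, ra]
    | three_mid l a q b r p s =>
      obtain ⟨-, -, ra, rb, rn, rl, rm, rr⟩ := hrep
      obtain ⟨_, hh, c1, c2, c3⟩ := hz
      obtain rfl := Nat.succ_injective hh
      obtain rfl : left = l.flat ++ [a] := List.append_cancel_left (as := p) (by simpa using hpre.symm)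
      obtain rfl : right = b :: r.flat :=
        List.append_cancel_right (bs := s) (by simpa using hpost.symm)
      refine ⟨fun hb => by simp [Test.eval, f38, rb, h0, rn] at hb, fun _ => ?_⟩
      refine ⟨fun hb => by simp [Test.eval, hi, h2] at hb,
        fun _ => ⟨fun _ => ?_, fun hb => by simp [Test.eval, hi, h1] at hb⟩⟩
      refine wp_mkTwo (n := n) (tl := l) (tr := t) (by simp [h0]) (by simp [h1])
        (by norm_num) (by norm_num) (by simpa using hal) (by simpa [f35] using rl)
        (by simpa using r1) fun m₁ k1 k2 k3 k4 k5 k6 => ?_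
      have e5 : m₁.var 5 = m.var 5 + 1 := by simp [k4]
      have up : ∀ {v t}, Rep m.arr n (m.var 5) v t → Rep m₁.arr n (m₁.var 5) v t := fun h =>
        h.mono (by omega) fun B hB j hj => by simpa using k1 B hB j (by simpa using hj)
      refine wp_mkTwo (n := n) (tl := t') (tr := r) (by simp [k4, h0]) (by simp [k4, h1])
        (by norm_num) (by norm_num) (by simp [e5]) (by simpa [k4] using up r1')
        (by simpa [f39, k4] using up rr) fun m' g1 g2 g3 g4 g5 g6 => ?_
      refine hQ _ (by simp [g4, e5]; omega) (fun B hB j hj => ?_) (fun B j hB => ?_)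
        (fun y hy hy5 => by simp [g4, k4, hy5, vars y hy]) (by simp [g5, k5])
        (by simp [g6, k6]) ?_
      · have e1 : m'.arr B j = m₁.arr B j := by simpa using g1 B hB j (by simp [e5]; omega)
        simpa [e1] using k1 B hB j (by simpa using hj)
      · have e1 : m'.arr B j = m₁.arr B j := by simpa using g2 B j hB
        simpa [e1] using k2 B j hB
      have k3' := k3.mono (A' := m'.arr) (al' := m.var 5 + 1 + 1) (by simp) (fun B hB j hj => by
        simpa using g1 B hB j (by simpa [e5] using hj))
      refine Or.inr ⟨by simp [g4, k4, hu], .two l a t, .two t' b r,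
        (by simpa [g4, k4, f36, ra] using k3'), (by simpa [g4, k4, e5, f36, f38, ra, rb] using g3),
        ⟨_, rfl, c1, b1⟩, ⟨_, rfl, b1', c3⟩, ?_⟩
      simp [flat, g4, k4]
    | three_right l a q b r p s =>
      obtain ⟨-, -, ra, rb, rn, rl, rm, rr⟩ := hrep
      obtain ⟨_, hh, c1, c2, c3⟩ := hz
      obtain rfl := Nat.succ_injective hh
      obtain rfl : left = l.flat ++ a :: q.flat ++ [b] := List.append_cancel_left (as := p) (by simpa using hpre.symm)
      obtain rfl : right = [] :=
        List.append_cancel_right (bs := s) (by simpa using hpost.symm)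
      refine ⟨fun hb => by simp [Test.eval, f38, rb, h0, rn] at hb, fun _ => ?_⟩
      refine ⟨fun hb => by simp [Test.eval, hi, h2] at hb,
        fun _ => ⟨fun hb => by simp [Test.eval, hi, h1] at hb, fun _ => ?_⟩⟩
      refine wp_mkTwo (n := n) (tl := t) (tr := t') (by simp [h0]) (by simp [h1])
        (by norm_num) (by norm_num) (by simpa using hal) (by simpa using r1)
        (by simpa using r1') fun m₁ k1 k2 k3 k4 k5 k6 => ?_
      have e5 : m₁.var 5 = m.var 5 + 1 := by simp [k4]
      have up : ∀ {v t}, Rep m.arr n (m.var 5) v t → Rep m₁.arr n (m₁.var 5) v t := fun h =>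
        h.mono (by omega) fun B hB j hj => by simpa using k1 B hB j (by simpa using hj)
      refine wp_mkTwo (n := n) (tl := l) (tr := q) (by simp [k4, h0]) (by simp [k4, h1])
        (by norm_num) (by norm_num) (by simp [e5]) (by simpa [f35, k4] using up rl)
        (by simpa [f37, k4] using up rm) fun m' g1 g2 g3 g4 g5 g6 => ?_
      refine hQ _ (by simp [g4, e5]; omega) (fun B hB j hj => ?_) (fun B j hB => ?_)
        (fun y hy hy5 => by simp [g4, k4, hy5, vars y hy]) (by simp [g5, k5])
        (by simp [g6, k6]) ?_
      · have e1 : m'.arr B j = m₁.arr B j := by simpa using g1 B hB j (by simp [e5]; omega)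
        simpa [e1] using k1 B hB j (by simpa using hj)
      · have e1 : m'.arr B j = m₁.arr B j := by simpa using g2 B j hB
        simpa [e1] using k2 B j hB
      have k3' := k3.mono (A' := m'.arr) (al' := m.var 5 + 1 + 1) (by simp) (fun B hB j hj => by
        simpa using g1 B hB j (by simpa [e5] using hj))
      refine Or.inr ⟨by simp [g4, k4, hu], .two l a q, .two t (m.var 33) t',
        (by simpa [g4, k4, e5, f36, f38, ra, rb] using g3), (by simpa [g4, k4, f36, ra] using k3'),
        ⟨_, rfl, c1, c2⟩, ⟨_, rfl, b1, b1'⟩, ?_⟩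
      simp [flat, g4, k4, f38, rb]

theorem wp_zipStep {x h k : ℕ} {t₀ : Tree} {z z' : Spot} {zs : List Spot} {L : List ℕ}
    (h0 : m.var 0 = n) (h1 : m.var 1 = 1) (h2 : m.var 2 = 0) (h20 : m.var 20 = zs.length + 1)
    (hal : 0 < m.var 5)
    (hs : Stack m.arr n (m.var 5) x t₀ (z :: z' :: zs)) (hz : z'.t.Bal (h + 1))
    (hlt : ∀ y ∈ t₀.flat, y < n) (hL : ∀ y ∈ L, y < n) (hk : m.calls = k)
    (hp : Pieces m.arr n (m.var 5) (m.var 31) (m.var 32) (m.var 33) (m.var 34) h L)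
    {Q : Mem → Prop}
    (hQ : ∀ (m' : Mem) left right, z.pre = z'.pre ++ left → z.post = right ++ z'.post →
      (∀ y ∈ left, y < n) → (∀ y ∈ right, y < n) →
      Pieces m'.arr n (m'.var 5) (m'.var 31) (m'.var 32) (m'.var 33) (m'.var 34) (h + 1)
        (left ++ L ++ right) →
      Stack m'.arr n (m'.var 5) x t₀ (z' :: zs) → m'.var 20 = zs.length →
      (∀ B i, 5 ≤ B → m'.arr B i = m.arr B i) → (∀ y < 20, y ≠ 5 → m'.var y = m.var y) →
      0 < m'.var 5 → m'.calls = k → m'.time ≤ m.time + 60 → Q m') :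
    wp P e zipStep Q m := by
  obtain ⟨he, hd, hs'⟩ := hs
  have hrep := hs'.entry.1
  have hflat := hs'.flat_eq
  have e1 : m.var 20 - m.var 1 = zs.length := by omega
  obtain ⟨left, right, hpre, hpost, hfl⟩ := hd.shape
  have hleft : ∀ y ∈ left, y < n := fun y hy => hlt y (by rw [← hflat, hfl]; simp [hy])
  have hright : ∀ y ∈ right, y < n := fun y hy => hlt y (by rw [← hflat, hfl]; simp [hy])
  have hall : ∀ y ∈ z'.t.flat, y < n := fun y hy => hlt y (by rw [← hflat]; simp [hy])
  have fin : ∀ m' : Mem, m.var 5 ≤ m'.var 5 →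
      (∀ B < 5, ∀ i < m.var 5, m'.arr B i = m.arr B i) →
      (∀ B i, 5 ≤ B → m'.arr B i = m.arr B i) → m'.var 20 = zs.length →
      (∀ y < 20, y ≠ 5 → m'.var y = m.var y) → m'.calls = k → m'.time ≤ m.time + 60 →
      Pieces m'.arr n (m'.var 5) (m'.var 31) (m'.var 32) (m'.var 33) (m'.var 34) (h + 1)
        (left ++ L ++ right) → Q m' := by
    intro m' g1 g2 g3 g4 g5 g6 g7 g8
    refine hQ m' left right hpre hpost hleft hright g8 (hs'.mono g1 g2 ?_ ?_) g4 g3 g5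
      (by omega) g6 g7
    · intro B hB _ i _; exact g3 B i hB
    · intro i _; exact g3 8 i (by norm_num)
  clear hQ
  simp only [zipStep, seqs, wp]
  refine wp_zipBuild (z := z) (z' := z') (v := m.arr 5 zs.length) (left := left) (right := right)
    (L := L) (h := h) (n := n) ?_ ?_ ?_ ?_ ?_ ?_ hz ?_ ?_ ?_ ?_ ?_ hall hL hpre hpost ?_
    fun m' k1 k2 k3 k4 k5 k6 k7 => ?_
  · simp [h0]
  · simp [h1]
  · simp [h2]
  · simpa using hal
  · simpa [e1] using hd
  · simpa using hrep
  · simp [e1]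
  · simp [e1]
  · simp [e1]
  · simp [e1]
  · simp [e1]
  · simpa using hp
  · refine fin m' (by simpa using k1) (by simpa using k2) (by simpa using k3)
      (by rw [k4 20 (by norm_num) (by norm_num)]; simp [e1]) (fun y hy hy5 => ?_)
      (by simp [k5, hk]) (by simp at k6; omega) k7
    rw [k4 y (by omega) hy5]
    simp [show y ≠ 20 by omega, show y ≠ 23 by omega, show y ≠ 29 by omega,
      show y ≠ 35 by omega, show y ≠ 36 by omega, show y ≠ 37 by omega, show y ≠ 38 by omega,
      show y ≠ 39 by omega]

end Zip

/-! ### The linked list and the insertion of a point -/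

/-- The function `f` leads from `a` through the list to `z`. -/
def Linked (f : ℕ → ℕ) : ℕ → List ℕ → ℕ → Prop
  | a, [], z => f a = z
  | a, b :: l, z => f a = b ∧ Linked f b l z

theorem Linked.congr {f f' : ℕ → ℕ} {z : ℕ} : ∀ {l : List ℕ} {a : ℕ},
    (∀ y ∈ a :: l, f' y = f y) → Linked f a l z → Linked f' a l z
  | [], a, h, hl => by rw [Linked, h a (by simp)]; exact hl
  | b :: l, a, h, hl => ⟨by rw [h a (by simp)]; exact hl.1,
      Linked.congr (fun y hy => h y (List.mem_cons_of_mem _ hy)) hl.2⟩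

/-- Only the links of the predecessor and of the new element change. As the list has no repetitions,
all other links are untouched. -/
theorem Linked.insert {f f' : ℕ → ℕ} {x z : ℕ} {post : List ℕ} : ∀ {pre : List ℕ} {a : ℕ},
    Linked f a (pre ++ post) z → (a :: (pre ++ post)).Nodup → x ∉ a :: (pre ++ post) →
    (∀ y, y ≠ pre.getLastD a → y ≠ x → f' y = f y) → f' (pre.getLastD a) = x →
    f' x = post.headD z → Linked f' a (pre ++ x :: post) z
  | [], a, hl, hn, hx, h1, h2, h3 => by
    refine ⟨h2, ?_⟩
    cases post with
    | nil => exact h3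
    | cons b l =>
      refine ⟨h3, hl.2.congr fun y hy => h1 y ?_ ?_⟩
      · rintro rfl; exact (List.nodup_cons.1 hn).1 hy
      · rintro rfl; exact hx (List.mem_cons_of_mem _ hy)
  | c :: pre, a, hl, hn, hx, h1, h2, h3 => by
    have hlast : (c :: pre).getLastD a = pre.getLastD c := List.getLastD_cons ..
    have hmem : pre.getLastD c ∈ c :: pre := by
      rcases List.eq_nil_or_concat' pre with rfl | ⟨q, d, rfl⟩
      · simp
      · simp
    refine ⟨?_, hl.2.insert (List.nodup_cons.1 hn).2 (fun h => hx (List.mem_cons_of_mem _ h))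
      (by rwa [hlast] at h1) (by rwa [hlast] at h2) h3⟩
    rw [h1 a, hl.1]
    · rw [hlast]
      intro h
      rw [← h] at hmem
      exact (List.nodup_cons.1 hn).1 (List.mem_append_left _ hmem)
    · rintro rfl; exact hx (by simp)

/-- Insert the key in variable 10 at the place that has been found. -/
def insertHere : Program :=
  seqs [.store 9 24 10, .store 9 10 25, .const 31 1, .const 32 0, .copy 33 10, .const 34 0,
    .loop (.lt 2 20) zipStep, .ite (.eq 31 2) (.copy 11 32) (mkNode 32 33 34 0 39 11)]

/-- Insert the key in variable 10 into the search tree and into the linked list. -/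
def insertPoint (r : ℕ) (prim : ℕ → ℕ → Primitive ℕ) : Program :=
  seqs [walk r prim, .load 24 6 20, .load 25 7 20, .ite (.eq 24 10) (.copy 24 0) (.copy 24 24),
    insertHere]

/-- The running time of `insertPoint`. -/
def insertTime (r w : ℕ) : ℕ := walkTime r (16 * w) + 8 * w * 62 + 60

/-- The memory holds the list `l` as a search tree and as a linked list. -/
def HoldsList (n : ℕ) (m : Mem) (l : List ℕ) : Prop :=
  0 < m.var 5 ∧ Linked (m.arr 9) n l n ∧
    ∃ t h, Rep m.arr n (m.var 5) (m.var 11) t ∧ t.Bal h ∧ t.flat = l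

section Insert

variable {n : ℕ} {P : Fin n → Plane} {e : ℕ → Bool} {prim : ℕ → ℕ → Primitive ℕ} {f : ℕ → ℝ}
  {r x : ℕ} {m : Mem}

/-- In a sorted list the comparison with the two neighbours implies the comparisons with all
elements. If there is no left neighbour, the default x makes the first hypothesis trivial. -/
theorem pairwise_insert {pre post : List ℕ} (hs : (pre ++ post).Pairwise (f · ≤ f ·))
    (h1 : f (pre.getLastD x) ≤ f x) (h2 : ∀ y ∈ post.head?, f x ≤ f y) :
    (pre ++ x :: post).Pairwise (f · ≤ f ·) := by
  obtain ⟨s1, s2, s3⟩ := List.pairwise_append.1 hs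
  have hpre : ∀ y ∈ pre, f y ≤ f x := by
    rcases List.eq_nil_or_concat' pre with rfl | ⟨q, d, rfl⟩
    · simp
    · intro y hy
      have hd : f d ≤ f x := by
        have : (q ++ [d]).getLastD x = d := List.getLastD_concat ..
        rwa [this] at h1
      rcases List.mem_append.1 hy with hy | hy
      · exact ((List.pairwise_append.1 s1).2.2 y hy d (by simp)).trans hd
      · rw [List.mem_singleton.1 hy]; exact hd
  have hpost : ∀ y ∈ post, f x ≤ f y := by
    cases post with
    | nil => simp
    | cons b l =>
      have hb := h2 b (by simp)
      intro y hy
      rcases List.mem_cons.1 hy with rfl | hy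
      · exact hb
      · exact hb.trans ((List.pairwise_cons.1 s2).1 y hy)
  refine List.pairwise_append.2 ⟨s1, List.pairwise_cons.2 ⟨hpost, s2⟩, fun a ha b hb => ?_⟩
  rcases List.mem_cons.1 hb with rfl | hb
  · exact hpre a ha
  · exact s3 a ha b hb

/-- The leaf found is replaced by two empty trees with the new key between them, which are pieces of
height 0. Each level upwards adds the keys of one node, until the pieces at the root hold the whole
list. -/
theorem wp_zipLoop {x h k : ℕ} {t₀ : Tree} {z : Spot} {zs : List Spot}
    (h0 : m.var 0 = n) (h1 : m.var 1 = 1) (h2 : m.var 2 = 0) (h20 : m.var 20 = zs.length)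
    (hal : 0 < m.var 5) (hs : Stack m.arr n (m.var 5) x t₀ (z :: zs)) (hbal : t₀.Bal h)
    (hz : z.t = nil) (hlt : ∀ y ∈ t₀.flat, y < n) (hx : x < n) (hk : m.calls = k)
    (h31 : m.var 31 = 1) (h32 : m.var 32 = 0) (h33 : m.var 33 = x) (h34 : m.var 34 = 0)
    {Q : Mem → Prop}
    (hQ : ∀ m' : Mem,
      Pieces m'.arr n (m'.var 5) (m'.var 31) (m'.var 32) (m'.var 33) (m'.var 34) h
        (z.pre ++ x :: z.post) →
      (∀ B i, 5 ≤ B → m'.arr B i = m.arr B i) → (∀ y < 20, y ≠ 5 → m'.var y = m.var y) →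
      0 < m'.var 5 → m'.calls = k → m'.time ≤ m.time + h * 62 + 1 → Q m') :
    wp P e (.loop (.lt 2 20) zipStep) Q m := by
  have hfl := hs.flat_eq
  rw [hz] at hfl
  simp only [flat, List.append_nil] at hfl
  obtain ⟨h', hz', hlen⟩ := hs.length_add_le hbal
  obtain rfl : h' = 0 := by rw [hz] at hz'; exact hz'
  rw [Nat.zero_add] at hlen
  -- The lists α and β are the keys already collected to the left and to the right of the new one;
  -- with the keys outside the current spot they make up those around the leaf.
  refine wp.loop (fun j m' => ∃ z' zs' h' α β, zs'.length = j ∧ m'.var 20 = j ∧ 0 < m'.var 5 ∧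
    Stack m'.arr n (m'.var 5) x t₀ (z' :: zs') ∧ z'.t.Bal h' ∧ h' + j = h ∧
    z'.pre ++ α = z.pre ∧ β ++ z'.post = z.post ∧
    Pieces m'.arr n (m'.var 5) (m'.var 31) (m'.var 32) (m'.var 33) (m'.var 34) h'
        (α ++ x :: β) ∧
    (∀ B i, 5 ≤ B → m'.arr B i = m.arr B i) ∧ (∀ y < 20, y ≠ 5 → m'.var y = m.var y) ∧
    m'.calls = k ∧ m'.time + j * 62 ≤ m.time + h * 62) ?_ ?_ zs.length _ ?_
  · rintro j m' ⟨z', zs', h', α, β, hj, h20', hal', hs', hb', hh, hα, hβ, hp, ha, hv, hc, ht⟩ hb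
    have u2 := (hv 2 (by norm_num) (by norm_num)).trans h2
    simp only [Test.eval, h20', u2, decide_eq_true_eq] at hb
    obtain ⟨z'', zs'', rfl⟩ : ∃ z'' zs'', zs' = z'' :: zs'' := by
      cases zs' with
      | nil => simp at hj; omega
      | cons a b => exact ⟨a, b, rfl⟩
    simp only [List.length_cons] at hj
    subst hj
    obtain ⟨h'', hb'', hl''⟩ := hs'.2.2.length_add_le hbal
    obtain rfl : h'' = h' + 1 := by omega
    have hmem : ∀ y ∈ α ++ x :: β, y < n := by
      intro y hy
      rcases List.mem_append.1 hy with hy | hy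
      · exact hlt y (by rw [← hfl, ← hα]; simp [hy])
      · rcases List.mem_cons.1 hy with rfl | hy
        · exact hx
        · exact hlt y (by rw [← hfl, ← hβ]; simp [hy])
    refine ⟨_, rfl, wp_zipStep (h := h') (n := n) (m := m'.tick)
      ((hv 0 (by norm_num) (by norm_num)).trans h0)
      ((hv 1 (by norm_num) (by norm_num)).trans h1) u2 h20' hal' hs' hb'' hlt hmem hc hp
      fun m'' left right e1 e2 _ _ hp' hs'' h20'' ha'' hv'' hal'' hc'' ht'' =>
        ⟨z'', zs'', h' + 1, left ++ α, β ++ right, rfl, h20'', hal'', hs'', hb'', by omega,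
          ?_, ?_, ?_, ?_, ?_, hc'', ?_⟩⟩
    · rw [← hα, e1]; simp
    · rw [← hβ, e2]; simp
    · simpa using hp'
    · intro B i hB; rw [ha'' B i hB]; exact ha B i hB
    · intro y hy hy5; rw [hv'' y hy hy5]; exact hv y hy hy5
    · simp at ht''; omega
  · rintro j m' ⟨z', zs', h', α, β, hj, h20', hal', hs', hb', hh, hα, hβ, hp, ha, hv, hc, ht⟩ hb
    have u2 := (hv 2 (by norm_num) (by norm_num)).trans h2
    simp only [Test.eval, h20', u2, decide_eq_false_iff_not, not_lt, Nat.le_zero] at hb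
    obtain rfl : zs' = [] := by
      rw [← List.length_eq_zero_iff]; omega
    obtain ⟨rfl, -⟩ := hs'
    simp only [List.nil_append, List.append_nil] at hα hβ
    subst hα hβ
    obtain rfl : h' = h := by omega
    exact hQ _ hp ha hv hal' hc (by simp; omega)
  · refine ⟨z, zs, 0, [], [], rfl, h20, hal, hs, by rw [hz]; rfl, by omega, by simp, by simp,
      Or.inr ⟨h31, nil, nil, h32, h34, rfl, rfl, by simp [flat, h33]⟩, fun _ _ _ => rfl,
      fun _ _ _ => rfl, hk, by rw [hlen]⟩

/-- If two pieces arrive at the top, a new root joins them; this is the only way in which the tree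
gains height. -/
theorem wp_insertHere {h k : ℕ} {t : Tree} {z : Spot} {zs : List Spot}
    (h0 : m.var 0 = n) (h1 : m.var 1 = 1) (h2 : m.var 2 = 0) (h10 : m.var 10 = x)
    (h20 : m.var 20 = zs.length) {lo : ℕ} (hlo : z.pre.getLastD n = lo)
    (h24 : m.var 24 = lo) (h25 : m.var 25 = z.hi n)
    (hal : 0 < m.var 5) (hs : Stack m.arr n (m.var 5) x t (z :: zs)) (hbal : t.Bal h)
    (hnil : z.t = nil) (hlt : ∀ y ∈ t.flat, y < n) (hnd : t.flat.Nodup) (hxl : x ∉ t.flat)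
    (hx : x < n) (hlink : Linked (m.arr 9) n t.flat n) (hk : m.calls = k) {Q : Mem → Prop}
    (hQ : ∀ m', HoldsList n m' (z.pre ++ x :: z.post) →
      (∀ B i, 10 ≤ B → m'.arr B i = m.arr B i) →
      (∀ y < 20, y ≠ 5 → y ≠ 11 → m'.var y = m.var y) → m'.calls = k →
      m'.time ≤ m.time + h * 62 + 40 → Q m') :
    wp P e insertHere Q m := by
  have hfl := hs.flat_eq
  rw [hnil] at hfl
  simp only [flat, List.append_nil] at hfl
  -- The two writes into the array of links must hit different cells.
  have hlox : lo ≠ x := by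
    rintro rfl
    rcases List.eq_nil_or_concat' z.pre with hp | ⟨q, d, hp⟩
    · rw [hp] at hlo; simp at hlo; omega
    · rw [hp, List.getLastD_concat] at hlo
      exact hxl (by rw [← hfl, hp, hlo]; simp)
  simp only [insertHere, seqs, wp]
  refine wp_zipLoop (z := z) (zs := zs) (h := h) (t₀ := t) (x := x) (n := n) (k := k)
    (by simp [h0]) (by simp [h1]) (by simp [h2]) (by simp [h20]) (by simp [hal]) ?_ hbal hnil hlt
    hx (by simp [hk]) (by simp) (by simp) (by simp [h10]) (by simp)
    fun m₃ hp ha hv₃ hal₃ hc₃ ht₃ => ?_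
  · refine hs.mono (by simp) ?_ ?_ ?_
    · intro B hB i _; simp [show B ≠ 9 by omega]
    · intro B _ hB i _; simp [show B ≠ 9 by omega]
    · intro i _; simp
  simp [h10, h24, h25] at ha
  have hlinked : Linked (m₃.arr 9) n (z.pre ++ x :: z.post) n := by
    refine Linked.insert (f := m.arr 9) (by rw [hfl]; exact hlink) ?_ ?_ ?_ ?_ ?_
    · rw [hfl]
      exact List.nodup_cons.2 ⟨fun hmem => lt_irrefl _ (hlt n hmem), hnd⟩
    · rw [hfl]
      simp only [List.mem_cons, not_or]
      exact ⟨by omega, hxl⟩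
    · rw [hlo]
      intro y hy1 hy2
      rw [ha 9 y (by norm_num)]
      simp [hy1, hy2]
    · rw [hlo, ha 9 _ (by norm_num)]
      simp [hlox]
    · rw [ha 9 _ (by norm_num)]; simp [Spot.hi]
  have hv : ∀ y < 20, y ≠ 5 → m₃.var y = m.var y := by
    intro y hy hy5
    rw [hv₃ y hy hy5]
    simp [show y ≠ 31 by omega, show y ≠ 32 by omega, show y ≠ 33 by omega,
      show y ≠ 34 by omega]
  have htime : m₃.time ≤ m.time + h * 62 + 20 := by
    simp only [Mem.set_time, Mem.put_time, Mem.tick_time] at ht₃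
    omega
  have ha' : ∀ B i, 10 ≤ B → m₃.arr B i = m.arr B i := by
    intro B i hB
    rw [ha B i (by omega)]
    simp [show B ≠ 9 by omega]
  have u2 := (hv 2 (by norm_num) (by norm_num)).trans h2
  clear hv₃ ha ht₃
  rcases hp with ⟨hu, t', r1, b1, f1⟩ | ⟨hu, t', t'', r1, r2, b1, b2, f1⟩
  · refine ⟨fun _ => ?_, fun hb => by simp [Test.eval, hu, u2] at hb⟩
    refine hQ _ ⟨by simpa using hal₃, by simpa using hlinked,
      t', h, by simpa using r1, b1, f1⟩ ?_ ?_ (by simpa using hc₃) (by simp; omega)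
    · intro B i hB; simpa using ha' B i hB
    · intro y hy hy5 hy11; simpa [hy11] using hv y hy hy5
  · refine ⟨fun hb => by simp [Test.eval, hu, u2] at hb, fun _ => ?_⟩
    refine wp_mkTwo (n := n) (by simpa using (hv 0 (by norm_num) (by norm_num)).trans h0)
      (by simpa using (hv 1 (by norm_num) (by norm_num)).trans h1) (by norm_num)
      (by norm_num) (by simpa using hal₃) (by simpa using r1) (by simpa using r2)
      fun m₄ g1 g2 g3 g4 g5 g6 => ?_
    refine hQ _ ⟨by simp [g4], hlinked.congr fun y _ => g2 9 y (by norm_num),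
      .two t' (m₃.var 33) t'', h + 1, by simpa [g4] using g3, ⟨h, rfl, b1, b2⟩, f1⟩ ?_ ?_
      (by simpa [g5] using hc₃) (by simp [g6]; omega)
    · intro B i hB; rw [g2 B i (by omega)]; exact ha' B i hB
    · intro y hy hy5 hy11
      rw [g4]
      simpa [hy11, hy5] using hv y hy hy5

/-- At the leaf that is found, the bounds are the neighbours of the key in the list, and their
correct comparisons with it hold: the left one is at most the key, the right one is not. This gives
the sorted order, and ties are harmless. -/
theorem wp_insert (hq : OrderQuery P prim f) (hx : x < n) {w k : ℕ} (hr : Reliable r w e)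
    (h0 : m.var 0 = n) (h1 : m.var 1 = 1) (h2 : m.var 2 = 0) (h3 : m.var 3 = 16 * w)
    (h10 : m.var 10 = x) (hk : m.calls = r * k) (hn : n < 2 ^ (8 * w)) {l : List ℕ}
    (hl : HoldsList n m l) (hlt : ∀ y ∈ l, y < n) (hnd : l.Nodup) (hxl : x ∉ l)
    (hlen : l.length < n) (hsort : l.Pairwise (f · ≤ f ·)) {Q : Mem → Prop}
    (hQ : ∀ m' l' k', l'.Perm (x :: l) → l'.Pairwise (f · ≤ f ·) → HoldsList n m' l' →
      (∀ B i, 10 ≤ B → m'.arr B i = m.arr B i) →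
      (∀ y < 20, y ≠ 5 → y ≠ 11 → m'.var y = m.var y) → m'.calls = r * k' →
      m'.time ≤ m.time + insertTime r w → Q m') :
    wp P e (insertPoint r prim) Q m := by
  obtain ⟨hal, hlink, t, h, hrep, hbal, rfl⟩ := hl
  -- A tree of height h has at least 2^h - 1 keys, and fewer than n keys are present.
  have hh : h < 8 * w := by
    have := hbal.two_pow_le
    exact (Nat.pow_lt_pow_iff_right (a := 2) (by norm_num)).1 (by omega)
  simp only [insertPoint, seqs, wp]
  refine wp_walk (m := m.tick) hq hx hr h0 h1 h2 h3 h10 hrep hbal hh hk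
    fun m₁ z zs c k' hw hc hon hk' ht => ?_
  have hnil := hw.idle hc
  rw [Spot.on_iff] at hon
  have hfl := hw.stack.flat_eq
  rw [hnil] at hfl
  simp only [flat, List.append_nil] at hfl
  have hv := hw.var
  have h20 := hw.depth
  obtain ⟨-, e6, e7⟩ := hw.stack.entry
  simp only [Mem.tick_var] at hv
  have v0 := (hv 0 (by norm_num)).trans h0
  have v1 := (hv 1 (by norm_num)).trans h1
  have v2 := (hv 2 (by norm_num)).trans h2
  have v10 := (hv 10 (by norm_num)).trans h10
  -- The search uses the new key itself as the default left bound, while the list uses n as its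
  -- head. The key is not yet in the list, so equality with it identifies the default.
  have hlo : (if z.lo x = x then n else z.lo x) = z.pre.getLastD n := by
    rcases List.eq_nil_or_concat' z.pre with hp | ⟨q, d, hp⟩
    · simp [Spot.lo, hp]
    · have : d ≠ x := by
        rintro rfl; exact hxl (by rw [← hfl, hp]; simp)
      simp [Spot.lo, hp, this]
  have hperm : (z.pre ++ x :: z.post).Perm (x :: t.flat) := by
    rw [← hfl]; exact List.perm_middle
  have hsorted : (z.pre ++ x :: z.post).Pairwise (f · ≤ f ·) := by
    refine pairwise_insert (by rw [hfl]; exact hsort) ((hq.answer_iff _ _).1 hon.1).2.2 ?_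
    intro y hy
    have hyn : y < n := hlt y (by rw [← hfl]; exact List.mem_append_right _ (List.mem_of_mem_head? hy))
    have h2 := hon.2
    have : z.hi n = y := by
      rw [Spot.hi, List.headD_eq_head?_getD, Option.mem_def.1 hy]; rfl
    rw [this] at h2
    by_contra hcon
    have := (hq.answer_iff y x).2 ⟨hyn, hx, (not_le.1 hcon).le⟩
    simp [this] at h2
  obtain ⟨lo', hlo'⟩ : ∃ lo', lo' = z.pre.getLastD n := ⟨_, rfl⟩
  rw [← hlo'] at hlo
  have rest : ∀ m₂ : Mem, m₂.var 24 = lo' → m₂.var 25 = z.hi n →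
      m₂.arr = m₁.arr → (∀ y, y ≠ 24 → y ≠ 25 → m₂.var y = m₁.var y) →
      m₂.calls = m₁.calls → m₂.time ≤ m₁.time + 8 → wp P e insertHere Q m₂ := by
    intro m₂ g24 g25 ga gv gc gt
    have e5 : m₂.var 5 = m.var 5 := (gv 5 (by norm_num) (by norm_num)).trans (hv 5 (by norm_num))
    refine wp_insertHere (z := z) (zs := zs) (h := h) (t := t) (x := x) (n := n) (k := r * k')
      (by simp [gv, v0]) (by simp [gv, v1]) (by simp [gv, v2]) (by simp [gv, v10])
      (by simp [gv, h20]) hlo'.symm g24 g25 (by rw [e5]; exact hal)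
      (by rw [ga, e5]; exact hw.stack) hbal hnil hlt hnd hxl hx ?_ (by rw [gc, hk'])
      fun m₃ hh ha hv₃ hc₃ ht₃ => hQ m₃ _ k' hperm hsorted hh ?_ ?_ hc₃ ?_
    · refine hlink.congr fun y _ => ?_
      rw [ga]; exact hw.arr 9 y (by norm_num)
    · intro B i hB
      rw [ha B i hB, ga]; exact hw.arr B i (by omega)
    · intro y hy hy5 hy11
      rw [hv₃ y hy hy5 hy11, gv y (by omega) (by omega), hv y hy]
    · simp only [Mem.tick_time] at ht
      unfold insertTime
      omega
  refine ⟨fun hb => ?_, fun hb => ?_⟩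
  all_goals
    simp [Test.eval, h20, e6, v10] at hb
    refine rest _ ?_ ?_ ?_ ?_ ?_ ?_
  · rw [← hlo, if_pos hb]; simp [v0]
  · simp [h20, e7]
  · simp
  · intro y hy hy'; simp [hy, hy']
  · simp
  · simp
  · rw [← hlo, if_neg hb]; simp [h20, e6]
  · simp [h20, e7]
  · simp
  · intro y hy hy'; simp [hy, hy']
  · simp
  · simp

end Insert

/-! ### Sorting -/

/-- The array `O` lists the numbers below `n` in the order of their values under `f`, and `K` is
the inverse of `O`. -/
structure SortedBy (n : ℕ) (f : ℕ → ℝ) (O K : ℕ → ℕ) : Prop where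
  lt : ∀ i < n, O i < n
  rank_lt : ∀ p < n, K p < n
  rank_apply : ∀ i < n, K (O i) = i
  apply_rank : ∀ p < n, O (K p) = p
  mono : ∀ i j, i ≤ j → j < n → f (O i) ≤ f (O j)

/-- Insert all points into an empty search tree. -/
def insertAll (r : ℕ) (prim : ℕ → ℕ → Primitive ℕ) : Program :=
  seqs [.const 5 1, .const 11 0, .store 9 0 0, .const 10 0,
    .loop (.lt 10 0) (seqs [insertPoint r prim, .add 10 10 1])]

/-- Write the linked list, its inverse, and the same for the reversed list, to arrays. -/
def traverse (o k o' k' : ℕ) : Program :=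
  seqs [.load 12 9 0, .const 13 0,
    .loop (.lt 13 0) (seqs [.store o 13 12, .store k 12 13, .sub 14 0 13, .sub 14 14 1,
      .store o' 14 12, .store k' 12 14, .load 12 9 12, .add 13 13 1])]

/-- Sort the points. -/
def sortPoints (r : ℕ) (prim : ℕ → ℕ → Primitive ℕ) (o k o' k' : ℕ) : Program :=
  seqs [insertAll r prim, traverse o k o' k']

/-- The running time of `sortPoints`. -/
def sortTime (r w n : ℕ) : ℕ := n * (insertTime r w + 30) + 40

section Sorting

variable {n : ℕ} {P : Fin n → Plane} {e : ℕ → Bool} {prim : ℕ → ℕ → Primitive ℕ} {f : ℕ → ℝ}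
  {r : ℕ} {m : Mem}

theorem wp_insertAll (hq : OrderQuery P prim f) {w k : ℕ} (hr : Reliable r w e)
    (h0 : m.var 0 = n) (h1 : m.var 1 = 1) (h2 : m.var 2 = 0) (h3 : m.var 3 = 16 * w)
    (hk : m.calls = r * k) (hn : n < 2 ^ (8 * w)) {Q : Mem → Prop}
    (hQ : ∀ m' l k', l.Perm (List.range n) → l.Pairwise (f · ≤ f ·) →
      Linked (m'.arr 9) n l n → (∀ B i, 10 ≤ B → m'.arr B i = m.arr B i) →
      (∀ y < 5, m'.var y = m.var y) → m'.calls = r * k' →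
      m'.time ≤ m.time + n * (insertTime r w + 5) + 12 → Q m') :
    wp P e (insertAll r prim) Q m := by
  simp only [insertAll, seqs, wp]
  refine wp.loop (fun j m' => ∃ x l k', x + j = n ∧ m'.var 10 = x ∧ l.Perm (List.range x) ∧
    l.Pairwise (f · ≤ f ·) ∧ HoldsList n m' l ∧ (∀ B i, 10 ≤ B → m'.arr B i = m.arr B i) ∧
    (∀ y < 5, m'.var y = m.var y) ∧ m'.calls = r * k' ∧
    m'.time + j * (insertTime r w + 5) ≤ m.time + n * (insertTime r w + 5) + 8) ?_ ?_ n _ ?_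
  · rintro j m' ⟨x, l, k', hxj, h10, hl, hs, hh, ha, hv, hc, ht⟩ hb
    have u0 := (hv 0 (by norm_num)).trans h0
    simp only [Test.eval, h10, u0, decide_eq_true_eq] at hb
    obtain ⟨j, rfl⟩ : ∃ g, j = g + 1 := ⟨j - 1, by omega⟩
    have hmem : ∀ y, y ∈ l ↔ y < x := fun y => by rw [hl.mem_iff, List.mem_range]
    refine ⟨j, rfl, ?_⟩
    refine wp_insert (m := m'.tick.tick) hq hb hr u0 ((hv 1 (by norm_num)).trans h1)
      ((hv 2 (by norm_num)).trans h2) ((hv 3 (by norm_num)).trans h3) h10 hc hn hh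
      (fun y hy => ((hmem y).1 hy).trans hb) (hl.nodup_iff.2 List.nodup_range)
      (fun hx => lt_irrefl _ ((hmem x).1 hx)) (by rw [hl.length_eq, List.length_range]; exact hb)
      hs fun m'' l' k'' hl' hs' hh' ha' hv' hc' ht' => ?_
    have w1 : m''.var 1 = 1 :=
      (hv' 1 (by norm_num) (by norm_num) (by norm_num)).trans ((hv 1 (by norm_num)).trans h1)
    have w10 : m''.var 10 = x :=
      (hv' 10 (by norm_num) (by norm_num) (by norm_num)).trans h10
    refine ⟨x + 1, l', k'', by omega, ?_, ?_, hs', ?_, ?_, ?_, ?_, ?_⟩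
    · simp [w1, w10]
    · rw [List.range_succ]
      exact hl'.trans ((hl.cons x).trans (List.perm_append_singleton x _).symm)
    · simpa [HoldsList] using hh'
    · intro B i hB; simpa using (ha' B i hB).trans (ha B i hB)
    · intro y hy
      have := (hv' y (by omega) (by omega) (by omega)).trans (hv y hy)
      simpa [show y ≠ 10 by omega] using this
    · simpa using hc'
    · simp only [Mem.tick_time, Mem.set_time] at ht' ⊢
      rw [add_mul] at ht
      omega
  · rintro j m' ⟨x, l, k', hxj, h10, hl, hs, hh, ha, hv, hc, ht⟩ hb
    have u0 := (hv 0 (by norm_num)).trans h0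
    simp only [Test.eval, h10, u0, decide_eq_false_iff_not, not_lt] at hb
    obtain rfl : x = n := by omega
    exact hQ _ l k' hl hs hh.2.1 ha hv hc (by simp; omega)
  · refine ⟨0, [], k, by omega, by simp, by simp, by simp, ⟨by simp, ?_, nil, 0, ?_, rfl, rfl⟩,
      ?_, ?_, by simpa using hk, by simp; omega⟩
    · simp [Linked, h0]
    · simp [Tree.Rep]
    · intro B i hB; simp [show B ≠ 9 by omega]
    · intro y hy
      simp [show y ≠ 5 by omega, show y ≠ 11 by omega, show y ≠ 10 by omega]

/-- The reversed order is written at the same time, with ranks n - 1 - i. It lets the sweep find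
neighbours on the other side with the same program, and it is an exact reversal even among points
with equal values. -/
theorem wp_traverse {o k o' k' : ℕ} (ho : 10 ≤ o) (hk : 10 ≤ k) (ho' : 10 ≤ o') (hk' : 10 ≤ k')
    (hd : [o, k, o', k'].Nodup) (h0 : m.var 0 = n) (h1 : m.var 1 = 1) {l : List ℕ}
    (hl : l.Perm (List.range n)) (hs : l.Pairwise (f · ≤ f ·)) (hlink : Linked (m.arr 9) n l n)
    {Q : Mem → Prop}
    (hQ : ∀ m', SortedBy n f (m'.arr o) (m'.arr k) →
      SortedBy n (fun i => -f i) (m'.arr o') (m'.arr k') →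
      (∀ p < n, m'.arr k' p = n - 1 - m'.arr k p) →
      (∀ B i, 10 ≤ B → B ∉ [o, k, o', k'] → m'.arr B i = m.arr B i) →
      (∀ y < 5, m'.var y = m.var y) → m'.calls = m.calls → m'.time ≤ m.time + n * 20 + 10 →
      Q m') :
    wp P e (traverse o k o' k') Q m := by
  have hnd : l.Nodup := hl.nodup_iff.2 List.nodup_range
  have hlen : l.length = n := by rw [hl.length_eq, List.length_range]
  have hmem : ∀ y, y ∈ l ↔ y < n := fun y => by rw [hl.mem_iff, List.mem_range]
  simp only [List.nodup_cons, List.mem_cons, List.not_mem_nil, or_false, not_or] at hd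
  obtain ⟨⟨d1, d2, d3⟩, ⟨d4, d5⟩, d6, -⟩ := hd
  simp only [traverse, seqs, wp]
  refine wp.loop (fun j m' => ∃ l₁ l₂, l = l₁ ++ l₂ ∧ l₂.length = j ∧ m'.var 12 = l₂.headD n ∧
    m'.var 13 = l₁.length ∧ (∀ b l₃, l₂ = b :: l₃ → Linked (m.arr 9) b l₃ n) ∧
    (∀ i b, l₁[i]? = some b → m'.arr o i = b ∧ m'.arr k b = i ∧ m'.arr o' (n - 1 - i) = b ∧
      m'.arr k' b = n - 1 - i) ∧ (∀ i, m'.arr 9 i = m.arr 9 i) ∧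
    (∀ B i, 10 ≤ B → B ∉ [o, k, o', k'] → m'.arr B i = m.arr B i) ∧
    (∀ y < 5, m'.var y = m.var y) ∧ m'.calls = m.calls ∧
    m'.time + j * 20 ≤ m.time + n * 20 + 6) ?_ ?_ n _ ?_
  · rintro j m' ⟨l₁, l₂, hll, hj, h12, h13, hlk, harr, h9, ha, hv, hc, ht⟩ hb
    have u0 := (hv 0 (by norm_num)).trans h0
    have u1 := (hv 1 (by norm_num)).trans h1
    have hlen' : l₁.length + l₂.length = n := by rw [← hlen, hll, List.length_append]
    simp only [Test.eval, h13, u0, decide_eq_true_eq] at hb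
    obtain ⟨b, l₃, rfl⟩ : ∃ b l₃, l₂ = b :: l₃ := by
      cases l₂ with
      | nil => simp at hlen'; omega
      | cons b l₃ => exact ⟨b, l₃, rfl⟩
    have hlkb := hlk b l₃ rfl
    simp only [List.length_cons] at hj hlen'
    simp only [List.headD_cons] at h12
    have hb₁ : b ∉ l₁ := by
      intro hb₁
      rw [hll] at hnd
      exact (List.nodup_append.1 hnd).2.2 b hb₁ b (by simp) rfl
    refine ⟨l₃.length, hj.symm, l₁ ++ [b], l₃, by simp [hll], rfl, ?_, ?_, ?_, ?_, ?_, ?_, ?_, ?_,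
      ?_⟩
    · have : m.arr 9 b = l₃.headD n := by
        cases l₃ with
        | nil => exact hlkb
        | cons c l₄ => exact hlkb.1
      simp [h12, h9, this, show 9 ≠ o by omega, show 9 ≠ k by omega, show 9 ≠ o' by omega,
        show 9 ≠ k' by omega]
    · simp [h13, u1]
    · rintro c l₄ rfl; exact hlkb.2
    · intro i c hi
      rcases lt_trichotomy i l₁.length with hlt | rfl | hgt
      · rw [List.getElem?_append_left hlt] at hi
        obtain ⟨a1, a2, a3, a4⟩ := harr i c hi
        have hcb : c ≠ b := by
          rintro rfl; exact hb₁ (List.mem_of_getElem? hi)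
        simp only [Mem.set_arr, Mem.put_arr, Mem.tick_arr, Mem.set_var, Mem.tick_var, Mem.put_var]
        simp [h12, h13, u0, u1, d1, d2, d3, d4, d5, d6, Ne.symm d1, Ne.symm d2, Ne.symm d3,
          Ne.symm d4, Ne.symm d5, Ne.symm d6, hcb, hlt.ne, a1, a2, a3, a4]
        omega
      · rw [List.getElem?_append_right le_rfl] at hi
        simp at hi
        subst hi
        simp [h12, h13, u0, u1, d1, d2, d3, d4, d5, d6, Ne.symm d2, Ne.symm d4]
        omega
      · rw [List.getElem?_append_right hgt.le, List.getElem?_eq_none (by simp; omega)] at hi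
        simp at hi
    · intro i
      simp [h9, show 9 ≠ o by omega, show 9 ≠ k by omega, show 9 ≠ o' by omega,
        show 9 ≠ k' by omega]
    · intro B i hB hBn
      have := ha B i hB hBn
      simp only [List.mem_cons, List.not_mem_nil, or_false, not_or] at hBn
      simp [hBn, this]
    · intro y hy
      simp [show y ≠ 12 by omega, show y ≠ 13 by omega, show y ≠ 14 by omega, hv y hy]
    · simpa using hc
    · simp; omega
  · rintro j m' ⟨l₁, l₂, hll, hj, h12, h13, hlk, harr, h9, ha, hv, hc, ht⟩ hb
    have u0 := (hv 0 (by norm_num)).trans h0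
    have hlen' : l₁.length + l₂.length = n := by rw [← hlen, hll, List.length_append]
    simp only [Test.eval, h13, u0, decide_eq_false_iff_not, not_lt] at hb
    obtain rfl : l₂ = [] := by
      rw [← List.length_eq_zero_iff]; omega
    rw [List.append_nil] at hll
    subst hll
    have hget : ∀ p < n, ∃ i, i < n ∧ l[i]? = some p := by
      intro p hp
      obtain ⟨i, hi, rfl⟩ := List.getElem_of_mem ((hmem p).2 hp)
      exact ⟨i, by omega, List.getElem?_eq_getElem hi⟩
    have hget' : ∀ i < n, ∃ p, p < n ∧ l[i]? = some p := by
      intro i hi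
      have hi' : i < l.length := by omega
      exact ⟨l[i], (hmem _).1 (List.getElem_mem hi'), List.getElem?_eq_getElem hi'⟩
    have hmono : ∀ i j p q : ℕ, i ≤ j → l[i]? = some p → l[j]? = some q → f p ≤ f q := by
      intro i j p q hij hp hq
      obtain ⟨hi, rfl⟩ := List.getElem?_eq_some_iff.1 hp
      obtain ⟨hj, rfl⟩ := List.getElem?_eq_some_iff.1 hq
      rcases hij.lt_or_eq with h | rfl
      · exact List.pairwise_iff_getElem.1 hs i j hi hj h
      · exact le_rfl
    refine hQ _ ⟨?_, ?_, ?_, ?_, ?_⟩ ⟨?_, ?_, ?_, ?_, ?_⟩ ?_ ha hv hc (by simp; omega)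
    · intro i hi
      obtain ⟨p, hp, h⟩ := hget' i hi
      simpa [(harr i p h).1] using hp
    · intro p hp
      obtain ⟨i, hi, h⟩ := hget p hp
      simpa [(harr i p h).2.1] using hi
    · intro i hi
      obtain ⟨p, hp, h⟩ := hget' i hi
      simp [(harr i p h).1, (harr i p h).2.1]
    · intro p hp
      obtain ⟨i, hi, h⟩ := hget p hp
      simp [(harr i p h).1, (harr i p h).2.1]
    · intro i j hij hj
      obtain ⟨p, hp, h⟩ := hget' i (by omega)
      obtain ⟨q, hq, h'⟩ := hget' j hj
      simpa [(harr i p h).1, (harr j q h').1] using hmono i j p q hij h h'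
    · intro i hi
      obtain ⟨p, hp, h⟩ := hget' (n - 1 - i) (by omega)
      have := (harr _ p h).2.2.1
      rw [show n - 1 - (n - 1 - i) = i by omega] at this
      simpa [this] using hp
    · intro p hp
      obtain ⟨i, hi, h⟩ := hget p hp
      simp [(harr i p h).2.2.2]; omega
    · intro i hi
      obtain ⟨p, hp, h⟩ := hget' (n - 1 - i) (by omega)
      have h3 := (harr _ p h).2.2.1
      have h4 := (harr _ p h).2.2.2
      rw [show n - 1 - (n - 1 - i) = i by omega] at h3 h4
      simp [h3, h4]
    · intro p hp
      obtain ⟨i, hi, h⟩ := hget p hp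
      simp [(harr i p h).2.2.1, (harr i p h).2.2.2]
    · intro i j hij hj
      obtain ⟨p, hp, h⟩ := hget' (n - 1 - i) (by omega)
      obtain ⟨q, hq, h'⟩ := hget' (n - 1 - j) (by omega)
      have h3 := (harr _ p h).2.2.1
      have h4 := (harr _ q h').2.2.1
      rw [show n - 1 - (n - 1 - i) = i by omega] at h3
      rw [show n - 1 - (n - 1 - j) = j by omega] at h4
      simpa [h3, h4] using hmono _ _ q p (by omega) h' h
    · intro p hp
      obtain ⟨i, hi, h⟩ := hget p hp
      simp [(harr i p h).2.1, (harr i p h).2.2.2]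
  · refine ⟨[], l, rfl, hlen, ?_, by simp, ?_, by simp, by simp, by simp, ?_, by simp, by simp; omega⟩
    · cases l with
      | nil => simpa [h0, Linked] using hlink
      | cons b l => simpa [h0] using hlink.1
    · rintro b l₃ rfl; exact hlink.2
    · intro y hy
      simp [show y ≠ 12 by omega, show y ≠ 13 by omega]

theorem wp_sortPoints (hq : OrderQuery P prim f) {w j o k o' k' : ℕ} (hr : Reliable r w e)
    (ho : 10 ≤ o) (hk : 10 ≤ k) (ho' : 10 ≤ o') (hk' : 10 ≤ k') (hd : [o, k, o', k'].Nodup)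
    (h0 : m.var 0 = n) (h1 : m.var 1 = 1) (h2 : m.var 2 = 0) (h3 : m.var 3 = 16 * w)
    (hj : m.calls = r * j) (hn : n < 2 ^ (8 * w)) {Q : Mem → Prop}
    (hQ : ∀ m' j', SortedBy n f (m'.arr o) (m'.arr k) →
      SortedBy n (fun i => -f i) (m'.arr o') (m'.arr k') →
      (∀ p < n, m'.arr k' p = n - 1 - m'.arr k p) →
      (∀ B i, 10 ≤ B → B ∉ [o, k, o', k'] → m'.arr B i = m.arr B i) →
      (∀ y < 5, m'.var y = m.var y) → m'.calls = r * j' → m'.time ≤ m.time + sortTime r w n →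
      Q m') :
    wp P e (sortPoints r prim o k o' k') Q m := by
  simp only [sortPoints, seqs, wp]
  refine wp_insertAll (m := m.tick) hq hr h0 h1 h2 h3 hj hn
    fun m₁ l j' hl hs hlink ha hv hc ht => ?_
  refine wp_traverse ho hk ho' hk' hd ((hv 0 (by norm_num)).trans h0)
    ((hv 1 (by norm_num)).trans h1) hl hs hlink fun m₂ s1 s2 s3 ha' hv' hc' ht' =>
      hQ m₂ j' s1 s2 s3 ?_ ?_ (hc'.trans hc) ?_
  · intro B i hB hBn; rw [ha' B i hB hBn, ha B i hB]; rfl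
  · intro y hy; rw [hv' y hy, hv y hy]; rfl
  · simp only [Mem.tick_time] at ht
    unfold sortTime
    nlinarith

end Sorting

/-! ### Trees of maxima and the search for the previous active leaf -/

/-- Compute the constants in the variables 1 to 4, and halves in array 19. -/
def setup (K : ℕ) : Program :=
  seqs [.const 1 1, .const 2 0, .const 3 0, .const 4 1, .const 10 (16 * K),
    .loop (.lt 4 0) (seqs [.add 4 4 4, .add 3 3 10]), .const 10 1,
    .loop (.lt 10 4) (seqs [.add 11 10 10, .store 19 11 10, .add 11 11 1, .store 19 11 10,
      .add 10 10 1])]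

/-- Give the point in variable 10 the mark `var 6 + 1`, at its leaf and above. -/
def mark (mt k : ℕ) : Program :=
  seqs [.load 12 k 10, .add 12 12 4, .add 13 6 1,
    .loop (.lt 2 12) (seqs [.store mt 12 13, .load 12 19 12])]

/-- Climb from the node in variable 20 until a marked node is found on the left. -/
def climb (mt : ℕ) : Program :=
  .loop (.eq 21 1) (seqs [.load 22 19 20, .ite (.eq 22 2) (seqs [.const 21 0, .const 20 0])
    (seqs [.add 23 22 22, .ite (.eq 23 20) (.copy 20 22)
      (seqs [.load 24 mt 23, .ite (.lt 7 24) (seqs [.copy 20 23, .const 21 0])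
        (.copy 20 22)])])])

/-- Go down from the node in variable 20 to its rightmost marked leaf. -/
def sink (mt : ℕ) : Program :=
  .loop (.lt 20 4) (seqs [.add 23 20 20, .add 24 23 1, .load 25 mt 24,
    .ite (.lt 7 25) (.copy 20 24) (.copy 20 23)])

/-- Find the last marked leaf before the leaf in variable 12. -/
def previous (mt : ℕ) : Program :=
  seqs [.copy 20 12, .const 21 1, climb mt, .ite (.eq 20 2) (.copy 20 20) (sink mt)]

/-- A tree of maxima over `2 ^ ℓ` leaves in heap order; `T` is the largest mark. -/
structure MaxTree (M : ℕ → ℕ) (ℓ T : ℕ) : Prop where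
  up : ∀ i < 2 ^ ℓ, ∀ j ≤ ℓ, M (2 ^ ℓ + i) ≤ M ((2 ^ ℓ + i) / 2 ^ j)
  down : ∀ v, 1 ≤ v → v < 2 ^ ℓ → M v ≤ max (M (2 * v)) (M (2 * v + 1))
  le : ∀ v, M v ≤ T

theorem heap_div_pos {ℓ j i : ℕ} (hj : j ≤ ℓ) : 2 ^ (ℓ - j) ≤ (2 ^ ℓ + i) / 2 ^ j := by
  rw [Nat.le_div_iff_mul_le (by positivity), ← pow_add, Nat.sub_add_cancel hj]; omega

theorem heap_div_top {ℓ i : ℕ} (hi : i < 2 ^ ℓ) : (2 ^ ℓ + i) / 2 ^ ℓ = 1 := by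
  rw [Nat.add_div_left _ (by positivity), Nat.div_eq_of_lt hi]

/-- The new mark exceeds all old ones, so it may be written on the whole path to the root without
comparisons. Off the path nothing changes and on it marks only grow, which preserves `up`; an inner
node on the path has a child on the path with the same mark, which preserves `down`. -/
theorem MaxTree.mark {M M' : ℕ → ℕ} {ℓ T i : ℕ} (h : MaxTree M ℓ T) (hi : i < 2 ^ ℓ)
    (h1 : ∀ j ≤ ℓ, M' ((2 ^ ℓ + i) / 2 ^ j) = T + 1)
    (h2 : ∀ v, (∀ j ≤ ℓ, v ≠ (2 ^ ℓ + i) / 2 ^ j) → M' v = M v) : MaxTree M' ℓ (T + 1) := by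
  have hle : ∀ v, M' v ≤ T + 1 := by
    intro v
    by_cases hv : ∃ j ≤ ℓ, v = (2 ^ ℓ + i) / 2 ^ j
    · obtain ⟨j, hj, rfl⟩ := hv; exact (h1 j hj).le
    · push Not at hv
      rw [h2 v hv]; exact (h.le v).trans (Nat.le_succ _)
  have hge : ∀ v, M v ≤ M' v := by
    intro v
    by_cases hv : ∃ j ≤ ℓ, v = (2 ^ ℓ + i) / 2 ^ j
    · obtain ⟨j, hj, rfl⟩ := hv
      rw [h1 j hj]; exact (h.le _).trans (Nat.le_succ _)
    · push Not at hv
      rw [h2 v hv]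
  refine ⟨fun i' hi' j hj => ?_, fun v hv hv' => ?_, hle⟩
  · by_cases hij : ∃ j' ≤ ℓ, (2 ^ ℓ + i') / 2 ^ j = (2 ^ ℓ + i) / 2 ^ j'
    · obtain ⟨j', hj', e⟩ := hij
      rw [e, h1 j' hj']; exact hle _
    · push Not at hij
      -- A leaf off the path is unchanged: proper ancestors have numbers below 2^ℓ, and the path's
      -- own leaf would have all its ancestors on the path.
      have hne : ∀ j' ≤ ℓ, 2 ^ ℓ + i' ≠ (2 ^ ℓ + i) / 2 ^ j' := by
        intro j' hj' e
        have : j' = 0 := by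
          by_contra h0
          have : (2 ^ ℓ + i) / 2 ^ j' < 2 ^ ℓ := by
            rw [Nat.div_lt_iff_lt_mul (by positivity)]
            have : 2 ^ 1 ≤ 2 ^ j' := Nat.pow_le_pow_right (by norm_num) (by omega)
            nlinarith
          omega
        subst this
        simp only [pow_zero, Nat.div_one] at e
        exact hij j hj (by rw [e])
      rw [h2 _ hne]
      exact (h.up i' hi' j hj).trans (hge _)
  · by_cases hvj : ∃ j ≤ ℓ, v = (2 ^ ℓ + i) / 2 ^ j
    · obtain ⟨j, hj, rfl⟩ := hvj
      obtain ⟨j, rfl⟩ : ∃ g, j = g + 1 := by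
        refine ⟨j - 1, ?_⟩
        rcases j with _ | j
        · simp at hv'
        · simp
      rw [h1 _ hj]
      have hc := h1 j (by omega)
      have : (2 ^ ℓ + i) / 2 ^ (j + 1) = (2 ^ ℓ + i) / 2 ^ j / 2 := by
        rw [pow_succ, Nat.div_div_eq_div_mul]
      rw [this]
      rcases Nat.mod_two_eq_zero_or_one ((2 ^ ℓ + i) / 2 ^ j) with hm | hm
      · rw [show 2 * ((2 ^ ℓ + i) / 2 ^ j / 2) = (2 ^ ℓ + i) / 2 ^ j by omega, hc]
        exact le_max_left _ _
      · rw [show 2 * ((2 ^ ℓ + i) / 2 ^ j / 2) + 1 = (2 ^ ℓ + i) / 2 ^ j by omega, hc]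
        exact le_max_right _ _
    · push Not at hvj
      rw [h2 v hvj]
      exact (h.down v hv hv').trans (max_le_max (hge _) (hge _))

section Trees

variable {n : ℕ} {P : Fin n → Plane} {e : ℕ → Bool} {m : Mem}

/-- The machine cannot divide, so parents in the heap order are read from a table of halves, filled
by writing v at 2 v and 2 v + 1. The power 2^ℓ and the vote number 16 K ℓ come from repeated
addition while doubling. -/
theorem wp_setup {K : ℕ} (hn : 2 ≤ n) (h0 : m.var 0 = n) (h19 : ∀ v, m.arr 19 v = 0)
    {Q : Mem → Prop}
    (hQ : ∀ m' ℓ, 1 ≤ ℓ → n ≤ 2 ^ ℓ → 2 ^ ℓ < 2 * n → m'.var 0 = n → m'.var 1 = 1 →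
      m'.var 2 = 0 → m'.var 3 = 16 * (K * ℓ) → m'.var 4 = 2 ^ ℓ →
      (∀ v < 2 * 2 ^ ℓ, m'.arr 19 v = v / 2) → (∀ B v, B ≠ 19 → m'.arr B v = m.arr B v) →
      m'.calls = m.calls → m'.time ≤ m.time + n * 40 + 40 → Q m') :
    wp P e (setup K) Q m := by
  simp only [setup, seqs, wp]
  refine wp.loop (fun f m' => ∃ i, f + i = n ∧ m'.var 4 = 2 ^ i ∧ m'.var 3 = 16 * (K * i) ∧
    2 ^ i < 2 * n ∧ m'.var 10 = 16 * K ∧ m'.var 0 = n ∧ m'.var 1 = 1 ∧ m'.var 2 = 0 ∧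
    m'.arr = m.arr ∧ m'.calls = m.calls ∧ m'.time ≤ m.time + 12 + i * 4) ?_ ?_ n _ ?_
  · rintro f m' ⟨i, hf, h4, h3, hi, h10, h0', h1, h2, ha, hc, ht⟩ hb
    simp only [Test.eval, h4, h0', decide_eq_true_eq] at hb
    have := Nat.lt_two_pow_self (n := i)
    refine ⟨f - 1, by omega, i + 1, by omega, ?_, ?_, ?_, ?_, ?_, ?_, ?_, ?_, ?_, ?_⟩
    · simp [h4, pow_succ]; ring
    · simp [h3, h10]; ring
    · rw [pow_succ]; omega
    · simp [h10]
    · simp [h0']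
    · simp [h1]
    · simp [h2]
    · simp [ha]
    · simpa using hc
    · simp; omega
  · rintro f m' ⟨i, hf, h4, h3, hi, h10, h0', h1, h2, ha, hc, ht⟩ hb
    simp only [Test.eval, h4, h0', decide_eq_false_iff_not, not_lt] at hb
    refine wp.loop (fun f m'' => ∃ v, f + v = 2 ^ i ∧ 1 ≤ v ∧ m''.var 10 = v ∧
      m''.var 4 = 2 ^ i ∧ m''.var 3 = 16 * (K * i) ∧ m''.var 0 = n ∧ m''.var 1 = 1 ∧
      m''.var 2 = 0 ∧ (∀ u < 2 * v, m''.arr 19 u = u / 2) ∧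
      (∀ B v, B ≠ 19 → m''.arr B v = m.arr B v) ∧ m''.calls = m.calls ∧
      m''.time ≤ m.time + 20 + i * 4 + v * 10) ?_ ?_ (2 ^ i - 1) _ ?_
    · rintro f m'' ⟨v, hf, hv, g10, g4, g3, g0, g1, g2, g19, ga, gc, gt⟩ hb'
      simp only [Test.eval, g4, g10, decide_eq_true_eq] at hb'
      refine ⟨f - 1, by omega, v + 1, by omega, by omega, ?_, ?_, ?_, ?_, ?_, ?_, ?_, ?_, ?_, ?_⟩
      · simp [g10, g1]
      · simp [g4]
      · simp [g3]
      · simp [g0]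
      · simp [g1]
      · simp [g2]
      · intro u hu
        simp [g10, g1]
        split_ifs with c1 c2
        · omega
        · omega
        · exact g19 u (by omega)
      · intro B u hB; simp [hB, ga B u hB]
      · simpa using gc
      · simp; omega
    · rintro f m'' ⟨v, hf, hv, g10, g4, g3, g0, g1, g2, g19, ga, gc, gt⟩ hb'
      simp only [Test.eval, g4, g10, decide_eq_false_iff_not, not_lt] at hb'
      obtain rfl : v = 2 ^ i := by omega
      have hi1 : 1 ≤ i := by
        by_contra h
        obtain rfl : i = 0 := by omega
        simp at hb; omega
      refine hQ _ i hi1 hb hi ?_ ?_ ?_ ?_ ?_ ?_ ?_ ?_ ?_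
      · simp [g0]
      · simp [g1]
      · simp [g2]
      · simp [g3]
      · simp [g4]
      · simpa using g19
      · simpa using ga
      · simpa using gc
      · simp; omega
    · have : 1 ≤ 2 ^ i := Nat.one_le_two_pow
      refine ⟨1, by omega, le_rfl, ?_, ?_, ?_, ?_, ?_, ?_, ?_, ?_, ?_, ?_⟩
      · simp
      · simp [h4]
      · simp [h3]
      · simp [h0']
      · simp [h1]
      · simp [h2]
      -- The entries 0 and 1 of the table keep their initial value 0, which is their half.
      · intro u hu
        simp [ha, h19]; omega
      · intro B u hB; simp [ha]
      · simpa using hc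
      · simp; omega
  · refine ⟨0, by omega, ?_, ?_, by omega, ?_, ?_, ?_, ?_, ?_, ?_, ?_⟩
    · simp
    · simp
    · simp
    · simp [h0]
    · simp
    · simp
    · simp
    · simp
    · simp

/-- The running time of `mark` and `previous`. -/
def treeTime (ℓ : ℕ) : ℕ := ℓ * 40 + 80

theorem wp_mark {mt k ℓ p i T : ℕ} (hmt : mt ≠ 19) (h1 : m.var 1 = 1) (h2 : m.var 2 = 0)
    (h4 : m.var 4 = 2 ^ ℓ) (h10 : m.var 10 = p) (hk : m.arr k p = i) (hi : i < 2 ^ ℓ)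
    (h6 : m.var 6 = T) (h19 : ∀ v < 2 * 2 ^ ℓ, m.arr 19 v = v / 2)
    (hM : MaxTree (m.arr mt) ℓ T) {Q : Mem → Prop}
    (hQ : ∀ m', MaxTree (m'.arr mt) ℓ (T + 1) →
      (∀ j < 2 ^ ℓ, m'.arr mt (2 ^ ℓ + j) = if j = i then T + 1 else m.arr mt (2 ^ ℓ + j)) →
      (∀ B v, B ≠ mt → m'.arr B v = m.arr B v) → (∀ y < 12, m'.var y = m.var y) →
      m'.calls = m.calls → m'.time ≤ m.time + treeTime ℓ → Q m') :
    wp P e (mark mt k) Q m := by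
  simp only [mark, seqs, wp]
  refine wp.loop (fun f m' => ∃ j, f + j = ℓ + 1 ∧ m'.var 12 = (2 ^ ℓ + i) / 2 ^ j ∧
    m'.var 13 = T + 1 ∧ (∀ j' < j, m'.arr mt ((2 ^ ℓ + i) / 2 ^ j') = T + 1) ∧
    (∀ v, (∀ j' < j, v ≠ (2 ^ ℓ + i) / 2 ^ j') → m'.arr mt v = m.arr mt v) ∧
    (∀ B v, B ≠ mt → m'.arr B v = m.arr B v) ∧ (∀ y < 12, m'.var y = m.var y) ∧
    m'.calls = m.calls ∧ m'.time ≤ m.time + 10 + j * 4) ?_ ?_ (ℓ + 1) _ ?_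
  · rintro f m' ⟨j, hf, h12, h13, hs, hu, ha, hv, hc, ht⟩ hb
    have u2 := (hv 2 (by norm_num)).trans h2
    simp only [Test.eval, h12, u2, decide_eq_true_eq] at hb
    have hj : j < ℓ + 1 := by
      by_contra hj
      have : (2 ^ ℓ + i) / 2 ^ j = 0 := by
        apply Nat.div_eq_of_lt
        have : 2 ^ (ℓ + 1) ≤ 2 ^ j := Nat.pow_le_pow_right (by norm_num) (by omega)
        rw [pow_succ] at this; omega
      omega
    have hlt : (2 ^ ℓ + i) / 2 ^ j < 2 * 2 ^ ℓ :=
      (Nat.div_le_self _ _).trans_lt (by omega)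
    refine ⟨f - 1, by omega, j + 1, by omega, ?_, ?_, ?_, ?_, ?_, ?_, ?_, ?_⟩
    · simp [h12, hmt.symm, ha, h19 _ hlt]
      rw [pow_succ, Nat.div_div_eq_div_mul]
    · simp [h13]
    · intro j' hj'
      simp [h12, h13]
      intro hne
      have : j' ≠ j := by rintro rfl; exact hne rfl
      exact hs j' (by omega)
    · intro v hv'
      have hne := hv' j (by omega)
      simp [h12, hne]
      exact hu v fun j' hj' => hv' j' (by omega)
    · intro B v hB; simp [hB, ha B v hB]
    · intro y hy; simp [show y ≠ 12 by omega, hv y hy]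
    · simpa using hc
    · simp; omega
  · rintro f m' ⟨j, hf, h12, h13, hs, hu, ha, hv, hc, ht⟩ hb
    have u2 := (hv 2 (by norm_num)).trans h2
    simp only [Test.eval, h12, u2, decide_eq_false_iff_not, not_lt, Nat.le_zero] at hb
    have hj : j = ℓ + 1 := by
      by_contra hj
      have := heap_div_pos (ℓ := ℓ) (i := i) (show j ≤ ℓ by omega)
      have : 0 < 2 ^ (ℓ - j) := by positivity
      omega
    subst hj
    refine hQ _ ?_ ?_ ?_ ?_ ?_ ?_
    · exact hM.mark hi (fun j hj => hs j (by omega)) fun v hv => hu v fun j hj => hv j (by omega)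
    · intro j hj
      split_ifs with hji
      · subst hji
        simpa using hs 0 (by omega)
      · refine hu _ fun j' hj' e' => ?_
        have : j' = 0 := by
          by_contra h0
          have : (2 ^ ℓ + i) / 2 ^ j' < 2 ^ ℓ := by
            rw [Nat.div_lt_iff_lt_mul (by positivity)]
            have : 2 ^ 1 ≤ 2 ^ j' := Nat.pow_le_pow_right (by norm_num) (by omega)
            nlinarith
          omega
        subst this
        simp at e'; omega
    · exact ha
    · exact hv
    · exact hc
    · simp [treeTime]; omega
  · refine ⟨0, by omega, ?_, ?_, by omega, ?_, ?_, ?_, ?_, ?_⟩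
    · simp [h10, hk, h4]; ring
    · simp [h6, h1]
    · intro v _; simp
    · intro B v _; simp
    · intro y hy; simp [show y ≠ 12 by omega, show y ≠ 13 by omega]
    · simp
    · simp

/-- During the climb, all active leaves before leaf i have their ancestors at the current level
strictly to the left of the current node. If the node is a right child whose sibling has a mark
above L, that sibling is the last candidate at this level. Otherwise the sibling, if it lies on the
left, covers no active leaf by `MaxTree.up`, and the parent inherits the invariant. The table sends
the root to 0, which signals that there is no such leaf. -/
theorem wp_climb {mt ℓ i L T : ℕ} (h1 : m.var 1 = 1) (h2 : m.var 2 = 0)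
    (h7 : m.var 7 = L) (h20 : m.var 20 = 2 ^ ℓ + i) (h21 : m.var 21 = 1) (hi : i < 2 ^ ℓ)
    (h19 : ∀ v < 2 * 2 ^ ℓ, m.arr 19 v = v / 2) (hM : MaxTree (m.arr mt) ℓ T)
    {Q : Mem → Prop}
    (hQ : ∀ m' : Mem, ((m'.var 20 = 0 ∧ ∀ i' < i, m.arr mt (2 ^ ℓ + i') ≤ L) ∨
      (∃ j ≤ ℓ, L < m.arr mt (m'.var 20) ∧ 2 ^ (ℓ - j) ≤ m'.var 20 ∧
        m'.var 20 < (2 ^ ℓ + i) / 2 ^ j ∧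
        ∀ i' < i, L < m.arr mt (2 ^ ℓ + i') → (2 ^ ℓ + i') / 2 ^ j ≤ m'.var 20)) →
      m'.arr = m.arr → (∀ y < 20, m'.var y = m.var y) → m'.calls = m.calls →
      m'.time ≤ m.time + ℓ * 20 + 30 → Q m') :
    wp P e (climb mt) Q m := by
  simp only [climb, seqs]
  refine wp.loop (fun f m' => ((m'.var 21 = 1 ∧ ∃ j ≤ ℓ, f + j = ℓ + 1 ∧
      m'.var 20 = (2 ^ ℓ + i) / 2 ^ j ∧
      (∀ i' < i, L < m.arr mt (2 ^ ℓ + i') → (2 ^ ℓ + i') / 2 ^ j < m'.var 20) ∧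
      m'.time ≤ m.time + j * 20) ∨
    (m'.var 21 = 0 ∧ m'.time ≤ m.time + ℓ * 20 + 20 ∧
      ((m'.var 20 = 0 ∧ ∀ i' < i, m.arr mt (2 ^ ℓ + i') ≤ L) ∨
      (∃ j ≤ ℓ, L < m.arr mt (m'.var 20) ∧ 2 ^ (ℓ - j) ≤ m'.var 20 ∧
        m'.var 20 < (2 ^ ℓ + i) / 2 ^ j ∧
        ∀ i' < i, L < m.arr mt (2 ^ ℓ + i') → (2 ^ ℓ + i') / 2 ^ j ≤ m'.var 20)))) ∧
    m'.arr = m.arr ∧ (∀ y < 20, m'.var y = m.var y) ∧ m'.calls = m.calls) ?_ ?_ (ℓ + 1) _ ?_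
  · rintro f m' ⟨hcase, ha, hv, hc⟩ hb
    have u1 := (hv 1 (by norm_num)).trans h1
    have u2 := (hv 2 (by norm_num)).trans h2
    have u7 := (hv 7 (by norm_num)).trans h7
    simp only [Test.eval, u1, decide_eq_true_eq] at hb
    rcases hcase with ⟨-, j, hj, hf, g20, hact, ht⟩ | ⟨h, -⟩
    swap
    · omega
    have hlt : (2 ^ ℓ + i) / 2 ^ j < 2 * 2 ^ ℓ := (Nat.div_le_self _ _).trans_lt (by omega)
    have hdiv : ∀ i', (2 ^ ℓ + i') / 2 ^ (j + 1) = (2 ^ ℓ + i') / 2 ^ j / 2 := fun i' => by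
      rw [pow_succ, Nat.div_div_eq_div_mul]
    have hpos := heap_div_pos (ℓ := ℓ) (i := i) hj
    set v := (2 ^ ℓ + i) / 2 ^ j with hvdef
    have hp0 : 0 < 2 ^ (ℓ - j) := by positivity
    have hjl : v / 2 ≠ 0 → j + 1 ≤ ℓ := by
      intro h0
      by_contra hcon
      obtain rfl : j = ℓ := by omega
      rw [hvdef, heap_div_top hi] at h0
      simp at h0
    refine ⟨f - 1, by omega, ?_⟩
    simp only [wp]
    refine ⟨fun hb => ?_, fun hb => ⟨fun hb' => ?_, fun hb' => ⟨fun hb'' => ?_, fun hb'' => ?_⟩⟩⟩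
    · simp [Test.eval, ha, g20, h19 _ hlt, u2] at hb
      have hv1 : v = 1 := by omega
      have hjl : j = ℓ := by
        by_contra hne
        have : 2 ^ 1 ≤ 2 ^ (ℓ - j) := Nat.pow_le_pow_right (by norm_num) (by omega)
        omega
      refine ⟨Or.inr ⟨by simp, ?_, Or.inl ⟨by simp, fun i' hi' => ?_⟩⟩, ?_, ?_, ?_⟩
      · subst hjl; simp; omega
      · by_contra hcon
        have := hact i' hi' (by omega)
        rw [g20, hv1, hjl, heap_div_top (by omega)] at this
        omega
      · simp [ha]
      · intro y hy
        simp [show y ≠ 20 by omega, show y ≠ 21 by omega, show y ≠ 22 by omega, hv y hy]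
      · simpa using hc
    · simp [Test.eval, ha, g20, h19 _ hlt, u2] at hb hb'
      have hj1 := hjl (by omega)
      refine ⟨Or.inl ⟨by simp [‹m'.var 21 = 1›], j + 1, hj1, by omega, ?_, ?_, ?_⟩, ?_, ?_, ?_⟩
      · simp [ha, g20, h19 _ hlt]; rw [hdiv]
      · intro i' hi' hL
        have := hact i' hi' hL
        simp [ha, g20, h19 _ hlt]
        rw [hdiv]; omega
      · simp; omega
      · simp [ha]
      · intro y hy
        simp [show y ≠ 20 by omega, show y ≠ 22 by omega, show y ≠ 23 by omega, hv y hy]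
      · simpa using hc
    · simp [Test.eval, ha, g20, h19 _ hlt, u2, u7] at hb hb' hb''
      have hj1 := hjl (by omega)
      have heven : 2 ^ (ℓ - j) = 2 * 2 ^ (ℓ - (j + 1)) := by
        rw [← pow_succ']; congr 1; omega
      refine ⟨Or.inr ⟨by simp, by simp; nlinarith, Or.inr ⟨j, hj, ?_, ?_, ?_, ?_⟩⟩, ?_, ?_, ?_⟩
      · simpa [ha, g20, h19 _ hlt] using hb''
      · simp [ha, g20, h19 _ hlt]; omega
      · simp [ha, g20, h19 _ hlt]; omega
      · intro i' hi' hL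
        have := hact i' hi' hL
        simp [ha, g20, h19 _ hlt]; omega
      · simp [ha]
      · intro y hy
        simp [show y ≠ 20 by omega, show y ≠ 21 by omega, show y ≠ 22 by omega,
          show y ≠ 23 by omega, show y ≠ 24 by omega, hv y hy]
      · simpa using hc
    · simp [Test.eval, ha, g20, h19 _ hlt, u2, u7] at hb hb' hb''
      have hj1 := hjl (by omega)
      refine ⟨Or.inl ⟨by simp [‹m'.var 21 = 1›], j + 1, hj1, by omega, ?_, ?_, ?_⟩, ?_, ?_, ?_⟩
      · simp [ha, g20, h19 _ hlt]; rw [hdiv]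
      · intro i' hi' hL
        have h3 := hact i' hi' hL
        have h4 := hM.up i' (by omega) j hj
        have h5 : (2 ^ ℓ + i') / 2 ^ j ≠ v / 2 + v / 2 := by
          intro h5; rw [h5] at h4; omega
        simp [ha, g20, h19 _ hlt]
        rw [hdiv]; omega
      · simp; omega
      · simp [ha]
      · intro y hy
        simp [show y ≠ 20 by omega, show y ≠ 22 by omega, show y ≠ 23 by omega,
          show y ≠ 24 by omega, hv y hy]
      · simpa using hc
  · rintro f m' ⟨hcase, ha, hv, hc⟩ hb
    have u1 := (hv 1 (by norm_num)).trans h1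
    simp only [Test.eval, u1, decide_eq_false_iff_not] at hb
    rcases hcase with ⟨h, -⟩ | ⟨-, ht, hcase⟩
    · omega
    · exact hQ _ hcase ha hv hc (by simp; omega)
  · refine ⟨Or.inl ⟨h21, 0, by omega, by omega, by simpa using h20, ?_, by simp⟩, rfl,
      fun _ _ => rfl, rfl⟩
    intro i' hi' _
    simp [h20, hi']

/-- The current node has a mark above L, and no active leaf before i lies below a later node of its
level. By `MaxTree.down` one of its children again has a mark above L. If the right one has not,
`MaxTree.up` shows that no active leaf is missed by going left. -/
theorem wp_sink {mt ℓ i L T j : ℕ} (h1 : m.var 1 = 1) (h4 : m.var 4 = 2 ^ ℓ)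
    (h7 : m.var 7 = L) (hi : i < 2 ^ ℓ) (hM : MaxTree (m.arr mt) ℓ T) (hj : j ≤ ℓ)
    (hL : L < m.arr mt (m.var 20)) (hlow : 2 ^ (ℓ - j) ≤ m.var 20)
    (hhigh : m.var 20 < (2 ^ ℓ + i) / 2 ^ j)
    (hact : ∀ i' < i, L < m.arr mt (2 ^ ℓ + i') → (2 ^ ℓ + i') / 2 ^ j ≤ m.var 20)
    {Q : Mem → Prop}
    (hQ : ∀ m' : Mem, (∃ i₁ < i, m'.var 20 = 2 ^ ℓ + i₁ ∧ L < m.arr mt (2 ^ ℓ + i₁) ∧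
      ∀ i', i₁ < i' → i' < i → m.arr mt (2 ^ ℓ + i') ≤ L) →
      m'.arr = m.arr → (∀ y < 20, m'.var y = m.var y) → m'.calls = m.calls →
      m'.time ≤ m.time + ℓ * 20 + 30 → Q m') :
    wp P e (sink mt) Q m := by
  simp only [sink, seqs]
  refine wp.loop (fun f m' => f ≤ ℓ ∧ L < m.arr mt (m'.var 20) ∧ 2 ^ (ℓ - f) ≤ m'.var 20 ∧
    m'.var 20 < (2 ^ ℓ + i) / 2 ^ f ∧
    (∀ i' < i, L < m.arr mt (2 ^ ℓ + i') → (2 ^ ℓ + i') / 2 ^ f ≤ m'.var 20) ∧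
    m'.arr = m.arr ∧ (∀ y < 20, m'.var y = m.var y) ∧ m'.calls = m.calls ∧
    m'.time + f * 20 ≤ m.time + ℓ * 20) ?_ ?_ j _ ?_
  · rintro f m' ⟨hf, gL, glow, ghigh, gact, ha, hv, hc, ht⟩ hb
    have u1 := (hv 1 (by norm_num)).trans h1
    have u4 := (hv 4 (by norm_num)).trans h4
    have u7 := (hv 7 (by norm_num)).trans h7
    simp only [Test.eval, u4, decide_eq_true_eq] at hb
    obtain ⟨f, rfl⟩ : ∃ g, f = g + 1 := by
      refine ⟨f - 1, ?_⟩
      rcases f with _ | f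
      · simp at glow; omega
      · simp
    have hdiv : ∀ i', (2 ^ ℓ + i') / 2 ^ (f + 1) = (2 ^ ℓ + i') / 2 ^ f / 2 := fun i' => by
      rw [pow_succ, Nat.div_div_eq_div_mul]
    have hpow : 2 ^ (ℓ - f) = 2 * 2 ^ (ℓ - (f + 1)) := by
      rw [← pow_succ']; congr 1; omega
    set v := m'.var 20 with hvdef
    rw [hdiv] at ghigh
    have hp0 : 0 < 2 ^ (ℓ - (f + 1)) := by positivity
    have hdown := hM.down v (by omega) hb
    refine ⟨f, rfl, ?_⟩
    simp only [wp]
    refine ⟨fun hb' => ?_, fun hb' => ?_⟩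
    · simp [Test.eval, u7, ha, ← hvdef, u1] at hb'
      refine ⟨by omega, ?_, ?_, ?_, ?_, ?_, ?_, ?_, ?_⟩
      · simpa [u1, ← hvdef] using hb'
      · simp [u1, ← hvdef]; omega
      · simp [u1, ← hvdef]; omega
      · intro i' hi' hL'
        have := gact i' hi' hL'
        rw [hdiv] at this
        simp [u1, ← hvdef]; omega
      · simp [ha]
      · intro y hy
        simp [show y ≠ 20 by omega, show y ≠ 23 by omega, show y ≠ 24 by omega,
          show y ≠ 25 by omega, hv y hy]
      · simpa using hc
      · simp; omega
    · simp [Test.eval, u7, ha, ← hvdef, u1] at hb'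
      rw [← two_mul] at hb'
      have hL2 : L < m.arr mt (2 * v) := by
        rcases le_max_iff.1 hdown with h | h <;> omega
      refine ⟨by omega, ?_, ?_, ?_, ?_, ?_, ?_, ?_, ?_⟩
      · simpa [← hvdef, ← two_mul] using hL2
      · simp [← hvdef]; omega
      · simp [← hvdef]; omega
      · intro i' hi' hL'
        have h3 := gact i' hi' hL'
        rw [hdiv] at h3
        have h4 := hM.up i' (by omega) f (by omega)
        have h5 : (2 ^ ℓ + i') / 2 ^ f ≠ 2 * v + 1 := by
          intro h5; rw [h5] at h4; omega
        simp [← hvdef]; omega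
      · simp [ha]
      · intro y hy
        simp [show y ≠ 20 by omega, show y ≠ 23 by omega, show y ≠ 24 by omega,
          show y ≠ 25 by omega, hv y hy]
      · simpa using hc
      · simp; omega
  · rintro f m' ⟨hf, gL, glow, ghigh, gact, ha, hv, hc, ht⟩ hb
    have u4 := (hv 4 (by norm_num)).trans h4
    simp only [Test.eval, u4, decide_eq_false_iff_not, not_lt] at hb
    have hf0 : f = 0 := by
      by_contra h0
      have : (2 ^ ℓ + i) / 2 ^ f < 2 ^ ℓ := by
        rw [Nat.div_lt_iff_lt_mul (by positivity)]
        have : 2 ^ 1 ≤ 2 ^ f := Nat.pow_le_pow_right (by norm_num) (by omega)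
        nlinarith
      omega
    subst hf0
    simp only [pow_zero, Nat.div_one] at ghigh gact
    obtain ⟨i₁, hi₁⟩ := Nat.exists_eq_add_of_le hb
    rw [hi₁] at gL ghigh gact
    refine hQ _ ⟨i₁, by omega, by simpa using hi₁, gL, fun i' h1 h2 => ?_⟩ ha hv hc (by simp; omega)
    by_contra hcon
    have := gact i' h2 (by omega)
    omega
  · exact ⟨hj, hL, hlow, hhigh, hact, rfl, fun _ _ => rfl, rfl, by
      have := Nat.mul_le_mul_right 20 hj; omega⟩

theorem wp_previous {mt ℓ i L T : ℕ} (h1 : m.var 1 = 1) (h2 : m.var 2 = 0)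
    (h4 : m.var 4 = 2 ^ ℓ) (h7 : m.var 7 = L) (h12 : m.var 12 = 2 ^ ℓ + i) (hi : i < 2 ^ ℓ)
    (h19 : ∀ v < 2 * 2 ^ ℓ, m.arr 19 v = v / 2) (hM : MaxTree (m.arr mt) ℓ T)
    {Q : Mem → Prop}
    (hQ : ∀ m' : Mem, ((m'.var 20 = 0 ∧ ∀ i' < i, m.arr mt (2 ^ ℓ + i') ≤ L) ∨
      (∃ i₁ < i, m'.var 20 = 2 ^ ℓ + i₁ ∧ L < m.arr mt (2 ^ ℓ + i₁) ∧
        ∀ i', i₁ < i' → i' < i → m.arr mt (2 ^ ℓ + i') ≤ L)) →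
      m'.arr = m.arr → (∀ y < 20, m'.var y = m.var y) → m'.calls = m.calls →
      m'.time ≤ m.time + treeTime ℓ → Q m') :
    wp P e (previous mt) Q m := by
  simp only [previous, seqs, wp]
  refine wp_climb (mt := mt) (ℓ := ℓ) (i := i) (L := L) (T := T) (by simp [h1]) (by simp [h2])
    (by simp [h7]) (by simp [h12]) (by simp) hi (by simpa using h19) (by simpa using hM)
    fun m' hcase ha hv hc ht => ?_
  simp only [Mem.set_arr, Mem.tick_arr, Mem.set_calls, Mem.tick_calls, Mem.set_time,
    Mem.tick_time] at hcase ha hc ht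
  have hv' : ∀ y < 20, m'.var y = m.var y := by
    intro y hy
    rw [hv y hy]
    simp [show y ≠ 20 by omega, show y ≠ 21 by omega]
  have u2 := (hv' 2 (by norm_num)).trans h2
  refine ⟨fun hb => ?_, fun hb => ?_⟩
  · simp only [Test.eval, u2, decide_eq_true_eq] at hb
    rcases hcase with ⟨h0, hnone⟩ | ⟨j, hj, hL, hlow, -⟩
    · refine hQ _ (Or.inl ⟨by simpa using h0, hnone⟩) ?_ ?_ ?_ ?_
      · simp [ha]
      · intro y hy; simp [show y ≠ 20 by omega, hv' y hy]
      · simpa using hc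
      · simp [treeTime]; omega
    · have : 0 < 2 ^ (ℓ - j) := by positivity
      omega
  · simp only [Test.eval, u2, decide_eq_false_iff_not] at hb
    rcases hcase with ⟨h0, -⟩ | ⟨j, hj, hL, hlow, hhigh, hact⟩
    · exact absurd h0 hb
    · refine wp_sink (m := m'.tick) (mt := mt) (T := T) ((hv' 1 (by norm_num)).trans h1)
        ((hv' 4 (by norm_num)).trans h4) ((hv' 7 (by norm_num)).trans h7) hi
        (by simpa [ha] using hM) hj (by simpa [ha] using hL) hlow hhigh (by simpa [ha] using hact)
        fun m'' hfound ha' hvv hc' ht' => hQ _ (Or.inr ?_) (ha'.trans ha) ?_ (hc'.trans hc) ?_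
      · simpa [ha] using hfound
      · intro y hy; rw [hvv y hy]; exact hv' y hy
      · simp only [Mem.tick_time] at ht'
        unfold treeTime; omega

end Trees

/-! ### The meaning of the primitives, and packing in a square -/

/-- The input point with a given number; beyond the input, the origin. -/
noncomputable def pt {n : ℕ} (P : Fin n → Plane) (i : ℕ) : Plane :=
  if h : i < n then P ⟨i, h⟩ else 0

theorem pt_val {n : ℕ} (P : Fin n → Plane) (i : Fin n) : pt P i = P i := by simp [pt]

theorem pt_of_lt {n : ℕ} (P : Fin n → Plane) {i : ℕ} (h : i < n) : pt P i = P ⟨i, h⟩ := by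
  simp [pt, h]

theorem orderQuery_xLe {n : ℕ} (P : Fin n → Plane) :
    OrderQuery P Primitive.xLe fun i => pt P i 0 := by
  refine ⟨fun _ _ _ => rfl, fun i j b hi hj => ⟨hi, hj⟩, fun i j => ?_⟩
  simp only [Primitive.answer, decide_eq_true_eq]
  constructor
  · rintro ⟨q, hq, h⟩
    cases q <;> simp only [Primitive.map, Primitive.xLe.injEq, reduceCtorEq] at hq
    obtain ⟨rfl, rfl⟩ := hq
    exact ⟨Fin.is_lt _, Fin.is_lt _, by simpa only [Primitive.Holds, pt_val] using h⟩
  · rintro ⟨hi, hj, h⟩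
    refine ⟨.xLe ⟨i, hi⟩ ⟨j, hj⟩, rfl, ?_⟩
    simpa only [Primitive.Holds, pt_of_lt, hi, hj] using h

theorem orderQuery_yLe {n : ℕ} (P : Fin n → Plane) :
    OrderQuery P Primitive.yLe fun i => pt P i 1 := by
  refine ⟨fun _ _ _ => rfl, fun i j b hi hj => ⟨hi, hj⟩, fun i j => ?_⟩
  simp only [Primitive.answer, decide_eq_true_eq]
  constructor
  · rintro ⟨q, hq, h⟩
    cases q <;> simp only [Primitive.map, Primitive.yLe.injEq, reduceCtorEq] at hq
    obtain ⟨rfl, rfl⟩ := hq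
    exact ⟨Fin.is_lt _, Fin.is_lt _, by simpa only [Primitive.Holds, pt_val] using h⟩
  · rintro ⟨hi, hj, h⟩
    refine ⟨.yLe ⟨i, hi⟩ ⟨j, hj⟩, rfl, ?_⟩
    simpa only [Primitive.Holds, pt_of_lt, hi, hj] using h

theorem answer_distLe {n : ℕ} (P : Fin n → Plane) {i j k l : ℕ} (hi : i < n) (hj : j < n)
    (hk : k < n) (hl : l < n) :
    (Primitive.distLe i j k l).answer P = true ↔
      dist (pt P i) (pt P j) ≤ dist (pt P k) (pt P l) := by
  simp only [Primitive.answer, decide_eq_true_eq]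
  constructor
  · rintro ⟨q, hq, h⟩
    cases q <;> simp only [Primitive.map, Primitive.distLe.injEq, reduceCtorEq] at hq
    obtain ⟨rfl, rfl, rfl, rfl⟩ := hq
    simpa only [Primitive.Holds, pt_val] using h
  · intro h
    refine ⟨.distLe ⟨i, hi⟩ ⟨j, hj⟩ ⟨k, hk⟩ ⟨l, hl⟩, rfl, ?_⟩
    simpa only [Primitive.Holds, pt_of_lt, hi, hj, hk, hl] using h

theorem answer_gapLe {n : ℕ} (P : Fin n → Plane) {i j k l : ℕ} (hi : i < n) (hj : j < n)
    (hk : k < n) (hl : l < n) :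
    (Primitive.gapLe i j k l).answer P = true ↔
      |pt P i 0 - pt P j 0| ≤ dist (pt P k) (pt P l) := by
  simp only [Primitive.answer, decide_eq_true_eq]
  constructor
  · rintro ⟨q, hq, h⟩
    cases q <;> simp only [Primitive.map, Primitive.gapLe.injEq, reduceCtorEq] at hq
    obtain ⟨rfl, rfl, rfl, rfl⟩ := hq
    simpa only [Primitive.Holds, pt_val] using h
  · intro h
    refine ⟨.gapLe ⟨i, hi⟩ ⟨j, hj⟩ ⟨k, hk⟩ ⟨l, hl⟩, rfl, ?_⟩
    simpa only [Primitive.Holds, pt_of_lt, hi, hj, hk, hl] using h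

theorem sq_dist_eq (x y : Plane) : dist x y ^ 2 = (x 0 - y 0) ^ 2 + (x 1 - y 1) ^ 2 := by
  rw [EuclideanSpace.dist_eq, Real.sq_sqrt (by positivity), Fin.sum_univ_two, Real.dist_eq,
    Real.dist_eq, sq_abs, sq_abs]

/-- A square contains at most four points with mutual distances at least its side. -/
theorem card_le_four_of_box {S : Finset ℕ} {u v : ℕ → ℝ} {δ u₀ v₀ : ℝ} (hδ : 0 < δ)
    (hu : ∀ s ∈ S, u₀ ≤ u s ∧ u s ≤ u₀ + δ) (hv : ∀ s ∈ S, v₀ ≤ v s ∧ v s ≤ v₀ + δ)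
    (hd : ∀ s ∈ S, ∀ t ∈ S, s ≠ t → δ ^ 2 ≤ (u s - u t) ^ 2 + (v s - v t) ^ 2) :
    S.card ≤ 4 := by
  classical
  by_contra hcard
  -- Pigeonhole on the four quarters of the square: two points in the same quarter have squared
  -- distance at most δ² / 2.
  obtain ⟨s, hs, t, ht, hst, he⟩ := Finset.exists_ne_map_eq_of_card_lt_of_maps_to
    (s := S) (t := (Finset.univ : Finset (Bool × Bool)))
    (f := fun s => (decide (u s ≤ u₀ + δ / 2), decide (v s ≤ v₀ + δ / 2)))
    (by simpa using hcard) (fun _ _ => Finset.mem_univ _)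
  simp only [Prod.mk.injEq, decide_eq_decide] at he
  have key : ∀ {a b z : ℝ}, z ≤ a ∧ a ≤ z + δ → z ≤ b ∧ b ≤ z + δ →
      (a ≤ z + δ / 2 ↔ b ≤ z + δ / 2) → (a - b) ^ 2 ≤ (δ / 2) ^ 2 := by
    intro a b z ha hb hab
    rw [sq_le_sq, abs_of_pos (by positivity : 0 < δ / 2), abs_le]
    by_cases h : a ≤ z + δ / 2
    · have := hab.1 h
      constructor <;> linarith [ha.1, hb.1]
    · have h' := mt hab.2 h
      push Not at h h'
      constructor <;> linarith [ha.2, hb.2]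
  have h1 := key (hu s hs) (hu t ht) he.1
  have h2 := key (hv s hs) (hv t ht) he.2
  have h3 := hd s hs t ht hst
  nlinarith

/-! ### Comparison with four vertical neighbours -/

/-- Compare the point in variable 10 with the last four marked points before it in the order of
the ranks `k`, and keep the closest pair in the variables 8 and 9. -/
def check (r o k mt : ℕ) : Program :=
  seqs [.load 12 k 10, .add 12 12 4, .const 13 4,
    .loop (.lt 2 13) (seqs [previous mt, .ite (.eq 20 2) (.const 13 0)
      (seqs [.copy 12 20, .sub 14 20 4, .load 14 o 14, sure r (.distLe 10 14 8 9),
        .ite (.eq 50 1) (seqs [.copy 8 10, .copy 9 14]) (.copy 8 8), .sub 13 13 1])])]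

/-- The running time of `check`. -/
def checkTime (r w ℓ : ℕ) : ℕ := 4 * (sureTime r (16 * w) + treeTime ℓ + 30) + 20

section Check

variable {n : ℕ} {P : Fin n → Plane} {e : ℕ → Bool} {m : Mem}

/-- This is the part without geometry. The set S of examined points either contains all active
points of smaller rank, or it has four elements and every active point of smaller rank that was
missed has smaller rank than all of S. -/
theorem wp_check_loop {r w j o k mt ℓ L T p a b : ℕ} {f : ℕ → ℝ} (hr : Reliable r w e)
    (h1 : m.var 1 = 1) (h2 : m.var 2 = 0) (h3 : m.var 3 = 16 * w)
    (h4 : m.var 4 = 2 ^ ℓ) (h7 : m.var 7 = L) (h8 : m.var 8 = a) (h9 : m.var 9 = b)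
    (h10 : m.var 10 = p) (hc : m.calls = r * j) (hn : n ≤ 2 ^ ℓ)
    (ha : a < n) (hb : b < n) (hab : a ≠ b) (hp : p < n)
    (hs : SortedBy n f (m.arr o) (m.arr k))
    (h19 : ∀ v < 2 * 2 ^ ℓ, m.arr 19 v = v / 2) (hM : MaxTree (m.arr mt) ℓ T)
    {Q : Mem → Prop}
    (hQ : ∀ m' a' b' j', m'.var 8 = a' → m'.var 9 = b' → a' < n → b' < n → a' ≠ b' →
      dist (pt P a') (pt P b') ≤ dist (pt P a) (pt P b) →
      (∃ S : Finset ℕ, (∀ s ∈ S, s < n ∧ L < m.arr mt (2 ^ ℓ + m.arr k s) ∧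
        m.arr k s < m.arr k p ∧ dist (pt P a') (pt P b') ≤ dist (pt P p) (pt P s)) ∧
        ∀ q < n, L < m.arr mt (2 ^ ℓ + m.arr k q) → m.arr k q < m.arr k p → q ∉ S →
          S.card = 4 ∧ ∀ s ∈ S, m.arr k q < m.arr k s) →
      m'.arr = m.arr → (∀ y < 12, y ≠ 8 → y ≠ 9 → m'.var y = m.var y) → m'.calls = r * j' →
      m'.time ≤ m.time + checkTime r w ℓ → Q m') :
    wp P e (check r o k mt) Q m := by
  have hkn := hs.rank_lt p hp
  obtain ⟨X, hX⟩ : ∃ X, X = sureTime r (16 * w) + treeTime ℓ + 30 := ⟨_, rfl⟩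
  simp only [check, seqs, wp]
  -- With g comparisons left, S consists of the active points with ranks from u up to that of p,
  -- where u is the rank reached. The second alternative arises when no earlier active leaf exists
  -- and the loop is stopped.
  refine wp.loop (fun g m' => ∃ a' b' j', m'.var 8 = a' ∧ m'.var 9 = b' ∧ a' < n ∧ b' < n ∧
    a' ≠ b' ∧ dist (pt P a') (pt P b') ≤ dist (pt P a) (pt P b) ∧
    (∃ S : Finset ℕ, (∀ s ∈ S, s < n ∧ L < m.arr mt (2 ^ ℓ + m.arr k s) ∧
        m.arr k s < m.arr k p ∧ dist (pt P a') (pt P b') ≤ dist (pt P p) (pt P s)) ∧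
      ((m'.var 13 = g ∧ S.card + g = 4 ∧ ∃ u ≤ m.arr k p, m'.var 12 = 2 ^ ℓ + u ∧
        (∀ s ∈ S, u ≤ m.arr k s) ∧ ∀ q < n, L < m.arr mt (2 ^ ℓ + m.arr k q) →
          u ≤ m.arr k q → m.arr k q < m.arr k p → q ∈ S) ∨
      (m'.var 13 = 0 ∧ ∀ q < n, L < m.arr mt (2 ^ ℓ + m.arr k q) →
          m.arr k q < m.arr k p → q ∈ S))) ∧
    m'.arr = m.arr ∧ (∀ y < 12, y ≠ 8 → y ≠ 9 → m'.var y = m.var y) ∧ m'.calls = r * j' ∧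
    g ≤ 4 ∧ m'.time + g * X ≤
      m.time + 4 * X + 10) ?_ ?_ 4 _ ?_
  · rintro g m' ⟨a', b', j', g8, g9, ga, gb, gab, gle, ⟨S, hS, hcase⟩, garr, gv, gc, gg, gt⟩ hb
    have u1 := (gv 1 (by norm_num) (by norm_num) (by norm_num)).trans h1
    have u2 := (gv 2 (by norm_num) (by norm_num) (by norm_num)).trans h2
    have u3 := (gv 3 (by norm_num) (by norm_num) (by norm_num)).trans h3
    have u4 := (gv 4 (by norm_num) (by norm_num) (by norm_num)).trans h4
    have u7 := (gv 7 (by norm_num) (by norm_num) (by norm_num)).trans h7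
    have u10 := (gv 10 (by norm_num) (by norm_num) (by norm_num)).trans h10
    simp only [Test.eval, u2, decide_eq_true_eq] at hb
    rcases hcase with ⟨g13, hcard, u, hu, g12, hSu, hall⟩ | ⟨h, -⟩
    swap
    · omega
    obtain ⟨g, rfl⟩ : ∃ f, g = f + 1 := ⟨g - 1, by omega⟩
    rw [add_one_mul] at gt
    refine ⟨g, rfl, ?_⟩
    simp only [wp]
    refine wp_previous (mt := mt) (ℓ := ℓ) (i := u) (L := L) (T := T) (by simpa using u1)
      (by simpa using u2) (by simpa using u4) (by simpa using u7) (by simpa using g12)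
      (by omega) (by simpa [garr] using h19) (by simpa [garr] using hM)
      fun m₁ hprev ha₁ hv₁ hc₁ ht₁ => ?_
    simp only [Mem.tick_var, Mem.tick_arr, Mem.tick_calls, Mem.tick_time, garr]
      at hprev ha₁ hv₁ hc₁ ht₁
    have v2 := (hv₁ 2 (by norm_num)).trans u2
    refine ⟨fun hb' => ?_, fun hb' => ?_⟩
    · simp only [Test.eval, v2, decide_eq_true_eq] at hb'
      rcases hprev with ⟨-, hnone⟩ | ⟨i₁, -, h20, -⟩
      swap
      · have : 0 < 2 ^ ℓ := by positivity
        omega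
      refine ⟨a', b', j', ?_, ?_, ga, gb, gab, gle, ⟨S, hS, Or.inr ⟨by simp, ?_⟩⟩, ?_, ?_, ?_,
        by omega, ?_⟩
      · simp [hv₁, g8]
      · simp [hv₁, g9]
      · intro q hq hL hlt
        by_cases hqu : u ≤ m.arr k q
        · exact hall q hq hL hqu hlt
        · have := hnone _ (not_le.1 hqu); omega
      · simp [ha₁]
      · intro y hy hy8 hy9
        simp [show y ≠ 13 by omega, hv₁ y (by omega), gv y hy hy8 hy9]
      · simpa [hc₁] using gc
      · simp; omega
    · simp only [Test.eval, v2, decide_eq_false_iff_not] at hb'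
      rcases hprev with ⟨h, -⟩ | ⟨i₁, hi₁, h20, hL₁, hbetween⟩
      · exact absurd h hb'
      have v1 := (hv₁ 1 (by norm_num)).trans u1
      have v4 := (hv₁ 4 (by norm_num)).trans u4
      set q := m.arr o i₁ with hq
      have hqn : q < n := hs.lt i₁ (by omega)
      have hkq : m.arr k q = i₁ := hs.rank_apply i₁ (by omega)
      have hqS : q ∉ S := fun hqS => by
        have := hSu q hqS; omega
      refine wp_sure (w := w) (k := j') (by simp [Primitive.Below]) hr (by simp [v1])
        (by simp [v2]) (by simp [hv₁, u3]) (by simpa [hc₁] using gc)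
        fun m₂ hv₂ ha₂ hc₂ ht₂ h50 => ?_
      simp [h20, v4, ha₁, Primitive.map, hv₁, g8, g9, u10] at hv₂ ha₂ ht₂ h50
      rw [← hq] at h50
      have w1 : m₂.var 1 = 1 := by rw [hv₂ 1 (by norm_num)]; simp [hv₁, u1]
      have w8 : m₂.var 8 = a' := by rw [hv₂ 8 (by norm_num)]; simp [hv₁, g8]
      have w9 : m₂.var 9 = b' := by rw [hv₂ 9 (by norm_num)]; simp [hv₁, g9]
      have w10 : m₂.var 10 = p := by rw [hv₂ 10 (by norm_num)]; simp [hv₁, u10]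
      have w12 : m₂.var 12 = 2 ^ ℓ + i₁ := by rw [hv₂ 12 (by norm_num)]; simp
      have w13 : m₂.var 13 = g + 1 := by rw [hv₂ 13 (by norm_num)]; simp [hv₁, g13]
      have w14 : m₂.var 14 = q := by rw [hv₂ 14 (by norm_num)]; simp [hq]
      have hwv : ∀ y < 12, m₂.var y = m'.var y := by
        intro y hy
        rw [hv₂ y (by omega)]
        simp [show y ≠ 14 by omega, show y ≠ 12 by omega, hv₁ y (by omega)]
      have hpq : p ≠ q := by rintro rfl; omega
      have hans := answer_distLe P hp hqn ga gb
      -- Both outcomes of the comparison leave a pair at most as far apart as the old pair and as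
      -- the two points compared, and nothing else is needed for the invariant.
      have step : ∀ (a'' b'' : ℕ) (m₃ : Mem), m₃.var 8 = a'' → m₃.var 9 = b'' → a'' < n →
          b'' < n → a'' ≠ b'' →
          dist (pt P a'') (pt P b'') ≤ dist (pt P a') (pt P b') →
          dist (pt P a'') (pt P b'') ≤ dist (pt P p) (pt P q) →
          m₃.arr = m₂.arr → (∀ y, y ≠ 8 → y ≠ 9 → m₃.var y = m₂.var y) → m₃.calls = m₂.calls →
          m₃.time ≤ m₂.time + 6 →
          ∃ a' b' j', (m₃.set 13 (m₃.var 13 - m₃.var 1)).var 8 = a' ∧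
            (m₃.set 13 (m₃.var 13 - m₃.var 1)).var 9 = b' ∧ a' < n ∧ b' < n ∧
            a' ≠ b' ∧ dist (pt P a') (pt P b') ≤ dist (pt P a) (pt P b) ∧
            (∃ S : Finset ℕ, (∀ s ∈ S, s < n ∧ L < m.arr mt (2 ^ ℓ + m.arr k s) ∧
                m.arr k s < m.arr k p ∧ dist (pt P a') (pt P b') ≤ dist (pt P p) (pt P s)) ∧
              (((m₃.set 13 (m₃.var 13 - m₃.var 1)).var 13 = g ∧ S.card + g = 4 ∧
                ∃ u ≤ m.arr k p, (m₃.set 13 (m₃.var 13 - m₃.var 1)).var 12 = 2 ^ ℓ + u ∧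
                (∀ s ∈ S, u ≤ m.arr k s) ∧ ∀ q < n, L < m.arr mt (2 ^ ℓ + m.arr k q) →
                  u ≤ m.arr k q → m.arr k q < m.arr k p → q ∈ S) ∨
              ((m₃.set 13 (m₃.var 13 - m₃.var 1)).var 13 = 0 ∧
                ∀ q < n, L < m.arr mt (2 ^ ℓ + m.arr k q) →
                  m.arr k q < m.arr k p → q ∈ S))) ∧
            (m₃.set 13 (m₃.var 13 - m₃.var 1)).arr = m.arr ∧
            (∀ y < 12, y ≠ 8 → y ≠ 9 →
              (m₃.set 13 (m₃.var 13 - m₃.var 1)).var y = m.var y) ∧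
            (m₃.set 13 (m₃.var 13 - m₃.var 1)).calls = r * j' ∧
            g ≤ 4 ∧ (m₃.set 13 (m₃.var 13 - m₃.var 1)).time +
                g * X ≤
              m.time + 4 * X + 10 := by
        intro a'' b'' m₃ i8 i9 ha'' hb'' hab'' hle1 hle2 hia hiv hic hit
        refine ⟨a'', b'', j' + 16 * w, by simp [i8], by simp [i9], ha'', hb'', hab'',
          hle1.trans gle, ⟨insert q S, ?_, Or.inl ⟨?_, ?_, i₁, by omega, ?_, ?_, ?_⟩⟩, ?_, ?_, ?_,
          by omega, ?_⟩
        · intro s hs'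
          rcases Finset.mem_insert.1 hs' with rfl | hs'
          · exact ⟨hqn, by rwa [hkq], by omega, hle2⟩
          · obtain ⟨s1, s2, s3, s4⟩ := hS s hs'
            exact ⟨s1, s2, s3, hle1.trans s4⟩
        · simp [hiv 13, hiv 1, w13, w1]
        · rw [Finset.card_insert_of_notMem hqS]; omega
        · simp [hiv 12, w12]
        · intro s hs'
          rcases Finset.mem_insert.1 hs' with rfl | hs'
          · exact hkq.ge
          · exact hi₁.le.trans (hSu s hs')
        · intro q' hq' hL' hle hlt
          by_cases hqu : u ≤ m.arr k q'
          · exact Finset.mem_insert_of_mem (hall q' hq' hL' hqu hlt)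
          · rcases hle.eq_or_lt with heq | hlt'
            · have : q' = q := by rw [hq, heq, hs.apply_rank q' hq']
              exact this ▸ Finset.mem_insert_self _ _
            · have := hbetween _ hlt' (not_le.1 hqu); omega
        · simp [hia, ha₂]
        · intro y hy hy8 hy9
          simp [show y ≠ 13 by omega, hiv y hy8 hy9, hwv y hy, gv y hy hy8 hy9]
        · simp [hic, hc₂]
        · simp; omega
      refine ⟨fun hyes => ?_, fun hno => ?_⟩
      · simp only [Test.eval, Mem.tick_var, w1, h50, decide_eq_true_eq] at hyes
        have hle := hans.1 (by
          cases h : (Primitive.distLe p q a' b').answer P <;> simp [h] at hyes ⊢)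
        exact step p q _ (by simp [w10]) (by simp [w14]) hp hqn hpq hle le_rfl (by simp)
          (fun y hy8 hy9 => by simp [hy8, hy9]) (by simp) (by simp)
      · simp only [Test.eval, Mem.tick_var, w1, h50, decide_eq_false_iff_not] at hno
        have hle := hans.not.1 (by
          cases h : (Primitive.distLe p q a' b').answer P <;> simp [h] at hno ⊢)
        exact step a' b' _ (by simp [w8]) (by simp [w9]) ga gb gab le_rfl (not_le.1 hle).le
          (by simp) (fun y hy8 hy9 => by simp [hy8]) (by simp) (by simp)
  · rintro g m' ⟨a', b', j', g8, g9, ga, gb, gab, gle, ⟨S, hS, hcase⟩, garr, gv, gc, gg, gt⟩ hb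
    have u2 := (gv 2 (by norm_num) (by norm_num) (by norm_num)).trans h2
    simp only [Test.eval, u2, decide_eq_false_iff_not, not_lt, Nat.le_zero] at hb
    refine hQ _ a' b' j' (by simpa using g8) (by simpa using g9) ga gb gab gle ⟨S, hS, ?_⟩
      (by simpa using garr) (by simpa using gv) (by simpa using gc)
      (by simp [checkTime, ← hX]; omega)
    rcases hcase with ⟨g13, hcard, u, hu, g12, hSu, hall⟩ | ⟨-, hall⟩
    · intro q hq hL hlt hqS
      refine ⟨by omega, fun s hs' => ?_⟩
      have : ¬ u ≤ m.arr k q := fun h => hqS (hall q hq hL h hlt)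
      exact (not_le.1 this).trans_le (hSu s hs')
    · exact fun q hq hL hlt hqS => absurd (hall q hq hL hlt) hqS
  · refine ⟨a, b, j, by simp [h8], by simp [h9], ha, hb, hab, le_rfl,
      ⟨∅, by simp, Or.inl ⟨by simp, by simp, m.arr k p, le_rfl, ?_, by simp, ?_⟩⟩, ?_, ?_, ?_,
      le_rfl, ?_⟩
    · simp [h10, h4]; ring
    · intro q _ _ h h'; omega
    · simp
    · intro y hy _ _; simp [show y ≠ 12 by omega, show y ≠ 13 by omega]
    · simpa using hc
    · simp; omega

/-- Suppose an active q of smaller rank was missed although it is closer to p than the current pair.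
Then q and the four examined points all lie in the square of side δ with p on its right side and at
the end of the vertical direction `f`: horizontally by `hx`, vertically because q is less than δ
away and the others have ranks between q and p. Five points with mutual distances at least δ
contradict `card_le_four_of_box`. The function `f` is y or -y, so both sides are covered. -/
theorem wp_check {r w j o k mt ℓ L T p a b : ℕ} {f : ℕ → ℝ} (hr : Reliable r w e)
    (h1 : m.var 1 = 1) (h2 : m.var 2 = 0) (h3 : m.var 3 = 16 * w)
    (h4 : m.var 4 = 2 ^ ℓ) (h7 : m.var 7 = L) (h8 : m.var 8 = a) (h9 : m.var 9 = b)
    (h10 : m.var 10 = p) (hc : m.calls = r * j) (hn : n ≤ 2 ^ ℓ)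
    (ha : a < n) (hb : b < n) (hab : a ≠ b) (hp : p < n)
    (hs : SortedBy n f (m.arr o) (m.arr k))
    (h19 : ∀ v < 2 * 2 ^ ℓ, m.arr 19 v = v / 2) (hM : MaxTree (m.arr mt) ℓ T) {A : ℕ → Prop}
    (hA : ∀ q < n, A q ↔ L < m.arr mt (2 ^ ℓ + m.arr k q)) {δ : ℝ}
    (hδ : dist (pt P a) (pt P b) ≤ δ)
    (hf : ∀ i j, dist (pt P i) (pt P j) ^ 2 = (pt P i 0 - pt P j 0) ^ 2 + (f i - f j) ^ 2)
    (hx : ∀ q < n, A q → pt P p 0 - δ ≤ pt P q 0 ∧ pt P q 0 ≤ pt P p 0)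
    (hsep : ∀ q < n, ∀ q' < n, A q → A q' → q ≠ q' → δ ≤ dist (pt P q) (pt P q'))
    {Q : Mem → Prop}
    (hQ : ∀ m' a' b' j', m'.var 8 = a' → m'.var 9 = b' → a' < n → b' < n → a' ≠ b' →
      dist (pt P a') (pt P b') ≤ dist (pt P a) (pt P b) →
      (∀ q < n, A q → m.arr k q < m.arr k p →
        dist (pt P a') (pt P b') ≤ dist (pt P p) (pt P q)) →
      m'.arr = m.arr → (∀ y < 12, y ≠ 8 → y ≠ 9 → m'.var y = m.var y) → m'.calls = r * j' →
      m'.time ≤ m.time + checkTime r w ℓ → Q m') :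
    wp P e (check r o k mt) Q m := by
  refine wp_check_loop hr h1 h2 h3 h4 h7 h8 h9 h10 hc hn ha hb hab hp hs h19 hM
    fun m' a' b' j' g8 g9 ga gb gab gle hS garr gv gc gt =>
      hQ m' a' b' j' g8 g9 ga gb gab gle ?_ garr gv gc gt
  obtain ⟨S, hS, hrest⟩ := hS
  intro q hq hAq hlt
  by_cases hqS : q ∈ S
  · exact (hS q hqS).2.2.2
  by_contra hcon
  push Not at hcon
  obtain ⟨hcard, hmin⟩ := hrest q hq ((hA q hq).1 hAq) hlt hqS
  have hmono : ∀ s t, s < n → t < n → m.arr k s ≤ m.arr k t → f s ≤ f t := by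
    intro s t hs' ht h
    have := hs.mono _ _ h (hs.rank_lt t ht)
    rwa [hs.apply_rank s hs', hs.apply_rank t ht] at this
  have hδ' : dist (pt P p) (pt P q) < δ := hcon.trans_le (gle.trans hδ)
  have hδ0 : 0 < δ := dist_nonneg.trans_lt hδ'
  have hfpq : f p - δ ≤ f q := by
    have h := hf p q
    have h' : (f p - f q) ^ 2 ≤ δ ^ 2 := by nlinarith [dist_nonneg (x := pt P p) (y := pt P q)]
    have := abs_le_of_sq_le_sq' h' hδ0.le
    linarith [this.2]
  have := card_le_four_of_box (S := insert q S) (u := fun i => pt P i 0) (v := f)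
    (u₀ := pt P p 0 - δ) (v₀ := f p - δ) hδ0 ?_ ?_ ?_
  · rw [Finset.card_insert_of_notMem hqS] at this; omega
  · intro s hs'
    rw [sub_add_cancel]
    rcases Finset.mem_insert.1 hs' with rfl | hs'
    · exact hx s hq hAq
    · obtain ⟨s1, s2, -⟩ := hS s hs'
      exact hx s s1 ((hA s s1).2 s2)
  · intro s hs'
    rw [sub_add_cancel]
    rcases Finset.mem_insert.1 hs' with rfl | hs'
    · exact ⟨hfpq, hmono _ _ hq hp hlt.le⟩
    · obtain ⟨s1, -, s3, -⟩ := hS s hs'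
      exact ⟨hfpq.trans (hmono _ _ hq s1 (hmin s hs').le), hmono _ _ s1 hp s3.le⟩
  · have hAS : ∀ s ∈ insert q S, s < n ∧ A s := by
      intro s hs'
      rcases Finset.mem_insert.1 hs' with rfl | hs'
      · exact ⟨hq, hAq⟩
      · obtain ⟨s1, s2, -⟩ := hS s hs'
        exact ⟨s1, (hA s s1).2 s2⟩
    intro s hs' t ht hst
    rw [← hf]
    have h := hsep s (hAS s hs').1 t (hAS t ht).1 (hAS s hs').2 (hAS t ht).2 hst
    exact pow_le_pow_left₀ hδ0.le h 2

end Check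

/-! ### The sweep -/

theorem abs_sub_le_dist (x y : Plane) : |x 0 - y 0| ≤ dist x y := by
  refine abs_le_of_sq_le_sq ?_ dist_nonneg
  rw [sq_dist_eq]
  nlinarith [sq_nonneg (x 1 - y 1)]

/-- One step of the sweep: either discard the leftmost active point, or process the next point. -/
def sweepStep (r : ℕ) : Program :=
  seqs [.load 10 10 6, .load 11 10 7, sure r (.gapLe 10 11 8 9), .ite (.eq 50 2) (.add 7 7 1)
    (seqs [check r 14 15 20, check r 16 17 21, mark 20 15, mark 21 17, .add 6 6 1])]

/-- Find a closest pair when the points are sorted in both directions. -/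
def sweep (r : ℕ) : Program :=
  seqs [.load 8 10 2, .load 9 10 1, .const 6 0, .const 7 0, .loop (.lt 6 0) (sweepStep r)]

/-- The running time of `sweepStep`. -/
def sweepStepTime (r w ℓ : ℕ) : ℕ :=
  sureTime r (16 * w) + 2 * checkTime r w ℓ + 2 * treeTime ℓ + 40

/-- The state of the sweep after the first `i` points in horizontal order, if the first `L` of them
have been discarded and `a` and `b` form the closest pair so far. -/
structure SweepState {n : ℕ} (P : Fin n → Plane) (m₀ : Mem) (ℓ i L a b : ℕ) (m : Mem) : Prop where
  var_six : m.var 6 = i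
  var_seven : m.var 7 = L
  var_eight : m.var 8 = a
  var_nine : m.var 9 = b
  i_le : i ≤ n
  L_le : L ≤ i
  a_lt : a < n
  b_lt : b < n
  ne : a ≠ b
  closest : ∀ s t, s < t → t < i →
    dist (pt P a) (pt P b) ≤ dist (pt P (m₀.arr 10 s)) (pt P (m₀.arr 10 t))
  far : ∀ s < L, ∀ t, i ≤ t → t < n →
    dist (pt P a) (pt P b) < pt P (m₀.arr 10 t) 0 - pt P (m₀.arr 10 s) 0
  leaf : ∀ q < n, m.arr 20 (2 ^ ℓ + m₀.arr 15 q) =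
    if m₀.arr 11 q < i then m₀.arr 11 q + 1 else 0
  leaf' : ∀ q < n, m.arr 21 (2 ^ ℓ + m₀.arr 17 q) =
    if m₀.arr 11 q < i then m₀.arr 11 q + 1 else 0
  tree : MaxTree (m.arr 20) ℓ i
  tree' : MaxTree (m.arr 21) ℓ i
  arr : ∀ B v, B ≠ 20 → B ≠ 21 → m.arr B v = m₀.arr B v
  var : ∀ y < 5, m.var y = m₀.var y

/-- The preconditions of the sweep. -/
structure SweepReady {n : ℕ} (P : Fin n → Plane) (w ℓ : ℕ) (m : Mem) : Prop where
  var_zero : m.var 0 = n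
  var_one : m.var 1 = 1
  var_two : m.var 2 = 0
  var_three : m.var 3 = 16 * w
  var_four : m.var 4 = 2 ^ ℓ
  le_pow : n ≤ 2 ^ ℓ
  half : ∀ v < 2 * 2 ^ ℓ, m.arr 19 v = v / 2
  sorted : SortedBy n (fun i => pt P i 0) (m.arr 10) (m.arr 11)
  sorted_up : SortedBy n (fun i => pt P i 1) (m.arr 14) (m.arr 15)
  sorted_down : SortedBy n (fun i => -pt P i 1) (m.arr 16) (m.arr 17)
  rank_down : ∀ p < n, m.arr 17 p = n - 1 - m.arr 15 p
  unmarked : ∀ v, m.arr 20 v = 0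
  unmarked' : ∀ v, m.arr 21 v = 0

section Sweep

variable {n : ℕ} {P : Fin n → Plane} {e : ℕ → Bool} {m₀ m : Mem} {w ℓ i L a b : ℕ}

theorem SortedBy.rank_ne {f : ℕ → ℝ} {O K : ℕ → ℕ} (h : SortedBy n f O K) {p q : ℕ} (hp : p < n)
    (hq : q < n) (hpq : p ≠ q) : K p ≠ K q := fun e => hpq (by
  rw [← h.apply_rank p hp, ← h.apply_rank q hq, e])

/-- A point too far to the left of the next point is also too far to the left of all later ones,
since they are sorted by x. In particular the gap is not zero, so L < i and the threshold never
overtakes the sweep. -/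
theorem SweepState.skip (h₀ : SweepReady P w ℓ m₀) (h : SweepState P m₀ ℓ i L a b m) (hi : i < n)
    (hgap : dist (pt P a) (pt P b) < |pt P (m₀.arr 10 i) 0 - pt P (m₀.arr 10 L) 0|) {m' : Mem}
    (hm6 : m'.var 6 = i) (hm7 : m'.var 7 = L + 1) (hm8 : m'.var 8 = a) (hm9 : m'.var 9 = b)
    (harr : m'.arr = m.arr) (hv : ∀ y < 5, m'.var y = m.var y) :
    SweepState P m₀ ℓ i (L + 1) a b m' := by
  have hLi : L ≠ i := by
    rintro rfl
    rw [sub_self, abs_zero] at hgap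
    exact hgap.not_ge dist_nonneg
  have hL := h.L_le
  have hmono := h₀.sorted.mono
  rw [abs_of_nonneg (sub_nonneg.2 (hmono L i hL hi))] at hgap
  refine ⟨hm6, hm7, hm8, hm9, h.i_le, by omega, h.a_lt, h.b_lt, h.ne, h.closest, ?_, ?_, ?_, ?_, ?_,
    ?_, fun y hy => (hv y hy).trans (h.var y hy)⟩
  · intro s hs t ht htn
    rcases Nat.lt_succ_iff_lt_or_eq.1 hs with hs | rfl
    · exact h.far s hs t ht htn
    · have := hmono i t ht htn
      simp only at this
      linarith
  · rw [harr]; exact h.leaf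
  · rw [harr]; exact h.leaf'
  · rw [harr]; exact h.tree
  · rw [harr]; exact h.tree'
  · rw [harr]; exact h.arr

/-- Discarded points are farther from the new point than the current distance already horizontally,
so comparisons with active points suffice. -/
theorem SweepState.closest_next (h₀ : SweepReady P w ℓ m₀) (h : SweepState P m₀ ℓ i L a b m)
    (hi : i < n) {a' b' : ℕ}
    (hle : dist (pt P a') (pt P b') ≤ dist (pt P a) (pt P b))
    (hnew : ∀ q < n, L ≤ m₀.arr 11 q → m₀.arr 11 q < i →
      dist (pt P a') (pt P b') ≤ dist (pt P (m₀.arr 10 i)) (pt P q)) :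
    ∀ s t, s < t → t < i + 1 →
      dist (pt P a') (pt P b') ≤ dist (pt P (m₀.arr 10 s)) (pt P (m₀.arr 10 t)) := by
  intro s t hst ht
  rcases Nat.lt_succ_iff_lt_or_eq.1 ht with ht | rfl
  · exact hle.trans (h.closest s t hst ht)
  · by_cases hs : s < L
    · have h1 := h.far s hs t le_rfl hi
      have h2 := abs_sub_le_dist (pt P (m₀.arr 10 s)) (pt P (m₀.arr 10 t))
      rw [abs_sub_comm] at h2
      exact hle.trans (h1.le.trans ((le_abs_self _).trans h2))
    · have hr := h₀.sorted.rank_apply s (by omega)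
      rw [dist_comm (pt P (m₀.arr 10 s))]
      exact hnew _ (h₀.sorted.lt s (by omega)) (by omega) (by omega)

/-- If the leftmost active point is within δ horizontally, so are all active points. They are also
at mutual distances at least δ, being processed points. These are the hypotheses of `wp_check`,
which is applied once for each vertical direction. -/
theorem wp_sweepStep {r j : ℕ} (hr : Reliable r w e) (h₀ : SweepReady P w ℓ m₀)
    (h : SweepState P m₀ ℓ i L a b m) (hi : i < n) (hc : m.calls = r * j) {Q : Mem → Prop}
    (hQ : ∀ m' i' L' a' b' j', SweepState P m₀ ℓ i' L' a' b' m' → i' + L' = i + L + 1 →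
      m'.calls = r * j' → m'.time ≤ m.time + sweepStepTime r w ℓ → Q m') :
    wp P e (sweepStep r) Q m := by
  have u1 := (h.var 1 (by norm_num)).trans h₀.var_one
  have u2 := (h.var 2 (by norm_num)).trans h₀.var_two
  have u3 := (h.var 3 (by norm_num)).trans h₀.var_three
  have u4 := (h.var 4 (by norm_num)).trans h₀.var_four
  have hL := h.L_le
  set p := m₀.arr 10 i with hp
  have hpn : p < n := h₀.sorted.lt i hi
  have hLn : m₀.arr 10 L < n := h₀.sorted.lt L (by omega)
  have hkp : m₀.arr 11 p = i := h₀.sorted.rank_apply i hi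
  simp only [sweepStep, seqs, wp]
  refine wp_sure (w := w) (k := j) (by simp [Primitive.Below]) hr (by simp [u1])
    (by simp [u2]) (by simp [u3]) (by simpa using hc) fun m₁ hv₁ ha₁ hc₁ ht₁ h50 => ?_
  simp [h.var_six, h.var_seven, h.var_eight, h.var_nine, Primitive.map, h.arr, ← hp] at hv₁ ha₁ ht₁ h50
  have w1 : m₁.var 1 = 1 := by rw [hv₁ 1 (by norm_num)]; simp [u1]
  have w2 : m₁.var 2 = 0 := by rw [hv₁ 2 (by norm_num)]; simp [u2]
  have w3 : m₁.var 3 = 16 * w := by rw [hv₁ 3 (by norm_num)]; simp [u3]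
  have w4 : m₁.var 4 = 2 ^ ℓ := by rw [hv₁ 4 (by norm_num)]; simp [u4]
  have w6 : m₁.var 6 = i := by rw [hv₁ 6 (by norm_num)]; simp [h.var_six]
  have w7 : m₁.var 7 = L := by rw [hv₁ 7 (by norm_num)]; simp [h.var_seven]
  have w8 : m₁.var 8 = a := by rw [hv₁ 8 (by norm_num)]; simp [h.var_eight]
  have w9 : m₁.var 9 = b := by rw [hv₁ 9 (by norm_num)]; simp [h.var_nine]
  have w10 : m₁.var 10 = p := by rw [hv₁ 10 (by norm_num)]; simp
  have wlow : ∀ y < 5, m₁.var y = m.var y := by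
    intro y hy
    rw [hv₁ y (by omega)]
    simp [show y ≠ 10 by omega, show y ≠ 11 by omega]
  have hans := answer_gapLe P hpn hLn h.a_lt h.b_lt
  refine ⟨fun hno => ?_, fun hyes => ?_⟩
  · simp only [Test.eval, w2, h50, decide_eq_true_eq] at hno
    have hgap := not_le.1 (hans.not.1 (by
      cases h : (Primitive.gapLe p (m₀.arr 10 L) a b).answer P <;> simp [h] at hno ⊢))
    refine hQ _ i (L + 1) a b _ (h.skip h₀ hi hgap ?_ ?_ ?_ ?_ ?_ ?_) (by omega)
      (by simpa using hc₁) ?_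
    · simp [w6]
    · simp [w7, w1]
    · simp [w8]
    · simp [w9]
    · simp [ha₁]
    · intro y hy; simp [show y ≠ 7 by omega, wlow y hy]
    · simp [sweepStepTime]; omega
  simp only [Test.eval, w2, h50, decide_eq_false_iff_not] at hyes
  have hgap := hans.1 (by
    cases h : (Primitive.gapLe p (m₀.arr 10 L) a b).answer P <;> simp [h] at hyes ⊢)
  have hrank : ∀ q < n, m₀.arr 10 (m₀.arr 11 q) = q := h₀.sorted.apply_rank
  have hx : ∀ q < n, L ≤ m₀.arr 11 q ∧ m₀.arr 11 q < i →
      pt P p 0 - dist (pt P a) (pt P b) ≤ pt P q 0 ∧ pt P q 0 ≤ pt P p 0 := by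
    rintro q hq ⟨hq1, hq2⟩
    have g1 := h₀.sorted.mono L (m₀.arr 11 q) hq1 (by omega)
    have g2 := h₀.sorted.mono (m₀.arr 11 q) i hq2.le hi
    simp only [hrank q hq, ← hp] at g1 g2
    have := (abs_le.1 hgap).2
    constructor <;> linarith
  have hsep : ∀ q < n, ∀ q' < n, (L ≤ m₀.arr 11 q ∧ m₀.arr 11 q < i) →
      (L ≤ m₀.arr 11 q' ∧ m₀.arr 11 q' < i) → q ≠ q' →
      dist (pt P a) (pt P b) ≤ dist (pt P q) (pt P q') := by
    intro q hq q' hq' h1 h2 hne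
    rcases (h₀.sorted.rank_ne hq hq' hne).lt_or_gt with hlt | hlt
    · have := h.closest _ _ hlt h2.2
      rwa [hrank q hq, hrank q' hq'] at this
    · have := h.closest _ _ hlt h1.2
      rwa [hrank q hq, hrank q' hq', dist_comm (pt P q')] at this
  have harr : ∀ B, B ≠ 20 → B ≠ 21 → m.arr B = m₀.arr B := fun B h1 h2 =>
    funext fun v => h.arr B v h1 h2
  have a14 := harr 14 (by norm_num) (by norm_num)
  have a15 := harr 15 (by norm_num) (by norm_num)
  have a16 := harr 16 (by norm_num) (by norm_num)
  have a17 := harr 17 (by norm_num) (by norm_num)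
  have a19 := harr 19 (by norm_num) (by norm_num)
  refine wp_check (w := w) (ℓ := ℓ) (L := L) (p := p) (a := a) (b := b) (T := i)
    (A := fun q => L ≤ m₀.arr 11 q ∧ m₀.arr 11 q < i) (δ := dist (pt P a) (pt P b))
    hr (by simp [w1]) (by simp [w2]) (by simp [w3]) (by simp [w4]) (by simp [w7]) (by simp [w8])
    (by simp [w9]) (by simp [w10]) (by simpa using hc₁) h₀.le_pow h.a_lt h.b_lt h.ne hpn
    (by simpa [ha₁, a14, a15] using h₀.sorted_up) (by simpa [ha₁, a19] using h₀.half)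
    (by simpa [ha₁] using h.tree) ?_ le_rfl (fun i j => sq_dist_eq _ _) hx hsep
    fun m₂ a₂ b₂ j₂ h8₂ h9₂ ha₂ hb₂ hab₂ hle₂ hnew₂ harr₂ hv₂ hc₂ ht₂ => ?_
  -- The mark of a processed point is its horizontal rank plus one, and the others have mark 0. So
  -- marks above L single out the processed points of rank at least L.
  · intro q hq
    simp only [Mem.tick_arr, ha₁, a15, h.leaf q hq]
    split_ifs <;> omega
  simp [ha₁, a15] at hnew₂ harr₂ hv₂ ht₂
  -- The second check keeps the old distance as δ, because horizontal closeness and separation are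
  -- known for it; the pair may have become closer meanwhile.
  refine wp_check (w := w) (ℓ := ℓ) (L := L) (p := p) (a := a₂) (b := b₂) (T := i)
    (A := fun q => L ≤ m₀.arr 11 q ∧ m₀.arr 11 q < i) (δ := dist (pt P a) (pt P b))
    (f := fun i => -pt P i 1)
    hr (by simp [hv₂, w1]) (by simp [hv₂, w2]) (by simp [hv₂, w3]) (by simp [hv₂, w4])
    (by simp [hv₂, w7]) (by simp [h8₂])
    (by simp [h9₂]) (by simp [hv₂, w10]) (by simpa using hc₂) h₀.le_pow ha₂ hb₂ hab₂ hpn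
    (by simpa [harr₂, a16, a17] using h₀.sorted_down) (by simpa [harr₂, a19] using h₀.half)
    (by simpa [harr₂] using h.tree') ?_ hle₂
    (fun i j => by rw [sq_dist_eq]; ring) hx hsep
    fun m₃ a₃ b₃ j₃ h8₃ h9₃ ha₃ hb₃ hab₃ hle₃ hnew₃ harr₃ hv₃ hc₃ ht₃ => ?_
  · intro q hq
    simp only [Mem.tick_arr, harr₂, a17, h.leaf' q hq]
    split_ifs <;> omega
  simp [harr₂, a17] at hnew₃ harr₃ hv₃ ht₃
  have hv₃' : ∀ y < 12, y ≠ 8 → y ≠ 9 → m₃.var y = m₁.var y := fun y h1 h2 h3 => by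
    rw [hv₃ y h1 h2 h3, hv₂ y h1 h2 h3]
  have hk15 : m₀.arr 15 p < n := h₀.sorted_up.rank_lt p hpn
  have hk17 : m₀.arr 17 p < n := h₀.sorted_down.rank_lt p hpn
  have hpow := h₀.le_pow
  refine wp_mark (ℓ := ℓ) (p := p) (i := m₀.arr 15 p) (T := i) (by norm_num) (by simp [hv₃', w1])
    (by simp [hv₃', w2]) (by simp [hv₃', w4]) (by simp [hv₃', w10]) (by simp [harr₃, a15])
    (by omega) (by simp [hv₃', w6]) (by simpa [harr₃, a19] using h₀.half)
    (by simpa [harr₃] using h.tree) fun m₄ htree₄ hleaf₄ harr₄ hv₄ hc₄ ht₄ => ?_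
  simp [harr₃] at hleaf₄ harr₄ hv₄ hc₄ ht₄
  refine wp_mark (ℓ := ℓ) (p := p) (i := m₀.arr 17 p) (T := i) (by norm_num)
    (by simp [hv₄, hv₃', w1])
    (by simp [hv₄, hv₃', w2]) (by simp [hv₄, hv₃', w4]) (by simp [hv₄, hv₃', w10])
    (by simp [harr₄, a17])
    (by omega) (by simp [hv₄, hv₃', w6]) (by simpa [harr₄, a19] using h₀.half)
    (by
      have : m₄.arr 21 = m.arr 21 := funext fun v => harr₄ 21 v (by norm_num)
      simpa [this] using h.tree') fun m₅ htree₅ hleaf₅ harr₅ hv₅ hc₅ ht₅ => ?_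
  simp [harr₄] at hleaf₅ harr₅ hv₅ hc₅ ht₅
  have hlow : ∀ y < 5, m₅.var y = m.var y := fun y hy => by
    rw [hv₅ y (by omega), hv₄ y (by omega), hv₃' y (by omega) (by omega) (by omega), wlow y hy]
  refine hQ _ (i + 1) L a₃ b₃ j₃ ⟨?_, ?_, ?_, ?_, by omega, by omega, ha₃, hb₃, hab₃,
    h.closest_next h₀ hi (hle₃.trans hle₂) ?_, ?_, ?_, ?_, ?_, ?_, ?_, ?_⟩ (by omega) ?_ ?_
  · simp [hv₅, hv₄, hv₃', w6, w1]
  · simp [hv₅, hv₄, hv₃', w7]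
  · simp [hv₅, hv₄, h8₃]
  · simp [hv₅, hv₄, h9₃]
  · intro q hq hLq hqi
    have hne : q ≠ p := by rintro rfl; omega
    -- Each active point precedes the new one in one of the two opposite vertical orders, so one of
    -- the checks covers it.
    rcases (h₀.sorted_up.rank_ne hq hpn hne).lt_or_gt with hlt | hlt
    · exact hle₃.trans (hnew₂ q hq hLq hqi hlt)
    · refine hnew₃ q hq hLq hqi ?_
      have := h₀.sorted_up.rank_lt q hq
      rw [h₀.rank_down q hq, h₀.rank_down p hpn]; omega
  · intro s hs t ht htn
    exact (hle₃.trans hle₂).trans_lt (h.far s hs t (by omega) htn)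
  · intro q hq
    have hqn := h₀.sorted_up.rank_lt q hq
    simp only [Mem.set_arr]
    rw [harr₅ 20 _ (by norm_num), hleaf₄ _ (by omega)]
    by_cases hqp : q = p
    · simp [hqp, hkp]
    · have hne := h₀.sorted.rank_ne hq hpn hqp
      rw [hkp] at hne
      rw [if_neg (h₀.sorted_up.rank_ne hq hpn hqp), h.leaf q hq]
      split_ifs <;> omega
  · intro q hq
    have hqn := h₀.sorted_down.rank_lt q hq
    simp only [Mem.set_arr]
    rw [hleaf₅ _ (by omega)]
    by_cases hqp : q = p
    · simp [hqp, hkp]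
    · have hne := h₀.sorted.rank_ne hq hpn hqp
      rw [hkp] at hne
      rw [if_neg (h₀.sorted_down.rank_ne hq hpn hqp), h.leaf' q hq]
      split_ifs <;> omega
  · have : m₅.arr 20 = m₄.arr 20 := funext fun v => harr₅ 20 v (by norm_num)
    simpa [this] using htree₄
  · simpa using htree₅
  · intro B v h1 h2
    simp [harr₅ B v h2, harr₄ B v h1, h.arr B v h1 h2]
  · intro y hy
    simp [show y ≠ 6 by omega, hlow y hy, h.var y hy]
  · simp [hc₅, hc₄, hc₃]
  · simp [sweepStepTime]; omega

/-- The running time of `sweep`. -/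
def sweepTime (r w ℓ n : ℕ) : ℕ := 2 * n * (sweepStepTime r w ℓ + 1) + 20

theorem wp_sweep {r j : ℕ} (hr : Reliable r w e) (hn : 2 ≤ n) (h₀ : SweepReady P w ℓ m)
    (hc : m.calls = r * j) {Q : Mem → Prop}
    (hQ : ∀ m' (a b : Fin n), m'.var 8 = (a : ℕ) → m'.var 9 = (b : ℕ) → IsClosestPair P a b →
      m'.time ≤ m.time + sweepTime r w ℓ n → Q m') :
    wp P e (sweep r) Q m := by
  simp only [sweep, seqs, wp]
  obtain ⟨Y, hY⟩ : ∃ Y, Y = sweepStepTime r w ℓ + 1 := ⟨_, rfl⟩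
  -- The sum i + L grows by one in each step and never exceeds 2 n, which bounds the number of
  -- steps.
  refine wp.loop (fun f m' => ∃ i L a b j, SweepState P m ℓ i L a b m' ∧ i + L + f = 2 * n ∧
    m'.calls = r * j ∧ m'.time + f * Y ≤ m.time + 2 * n * Y + 10) ?_ ?_ (2 * n) _ ?_
  · rintro f m' ⟨i, L, a, b, j, h, hf, hc, ht⟩ hb
    have u0 := (h.var 0 (by norm_num)).trans h₀.var_zero
    simp only [Test.eval, u0, h.var_six, decide_eq_true_eq] at hb
    have hL := h.L_le
    obtain ⟨f, rfl⟩ : ∃ g, f = g + 1 := ⟨f - 1, by omega⟩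
    rw [add_one_mul] at ht
    refine ⟨f, rfl, ?_⟩
    refine wp_sweepStep (m := m'.tick) (i := i) (L := L) (a := a) (b := b) hr h₀ ?_ hb
      (by simpa using hc) fun m'' i' L' a' b' j' h' hiL hc' ht' =>
        ⟨i', L', a', b', j', h', by omega, hc', ?_⟩
    · exact { h with }
    · simp only [Mem.tick_time] at ht'
      omega
  · rintro f m' ⟨i, L, a, b, j, h, hf, hc, ht⟩ hb
    have u0 := (h.var 0 (by norm_num)).trans h₀.var_zero
    simp only [Test.eval, u0, h.var_six, decide_eq_false_iff_not, not_lt] at hb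
    obtain rfl : i = n := le_antisymm h.i_le hb
    refine hQ _ ⟨a, h.a_lt⟩ ⟨b, h.b_lt⟩ (by simpa using h.var_eight) (by simpa using h.var_nine)
      ⟨fun hab => h.ne (congrArg Fin.val hab), fun k l hkl => ?_⟩ ?_
    · have hne : (k : ℕ) ≠ l := fun e => hkl (Fin.ext e)
      rw [← pt_of_lt P h.a_lt, ← pt_of_lt P h.b_lt, ← pt_val P k, ← pt_val P l]
      rcases (h₀.sorted.rank_ne k.2 l.2 hne).lt_or_gt with hlt | hlt
      · have := h.closest _ _ hlt (h₀.sorted.rank_lt _ l.2)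
        rwa [h₀.sorted.apply_rank _ k.2, h₀.sorted.apply_rank _ l.2] at this
      · have := h.closest _ _ hlt (h₀.sorted.rank_lt _ k.2)
        rwa [h₀.sorted.apply_rank _ k.2, h₀.sorted.apply_rank _ l.2, dist_comm (pt P l)] at this
    · simp only [Mem.tick_time, sweepTime, ← hY]; omega
  · have h01 : m.arr 10 0 ≠ m.arr 10 1 := fun e => by
      have h1 := h₀.sorted.rank_apply 0 (by omega)
      have h2 := h₀.sorted.rank_apply 1 (by omega)
      rw [e] at h1; omega
    have tree : ∀ M : ℕ → ℕ, (∀ v, M v = 0) → MaxTree M ℓ 0 := fun M hM =>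
      ⟨fun i _ j _ => by simp [hM], fun v _ _ => by simp [hM], fun v => (hM v).le⟩
    refine ⟨0, 0, m.arr 10 0, m.arr 10 1, j, ⟨?_, ?_, ?_, ?_, by omega, le_rfl,
      h₀.sorted.lt 0 (by omega), h₀.sorted.lt 1 (by omega), h01, ?_, ?_, ?_, ?_, ?_, ?_, ?_, ?_⟩,
      by omega, ?_, ?_⟩
    · simp
    · simp
    · simp [h₀.var_two]
    · simp [h₀.var_one]
    · intro s t _ ht; omega
    · intro s hs; omega
    · intro q _; simp [h₀.unmarked]
    · intro q _; simp [h₀.unmarked']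
    · exact tree _ fun v => by simp [h₀.unmarked]
    · exact tree _ fun v => by simp [h₀.unmarked']
    · intro B v _ _; simp
    · intro y hy
      simp [show y ≠ 6 by omega, show y ≠ 7 by omega, show y ≠ 8 by omega, show y ≠ 9 by omega]
    · simpa using hc
    · simp; omega

end Sweep

/-! ### The complete program and its running time -/

/-- Find a closest pair; blocks of `r` answers and majorities among `16 * K * log n` of them make
the answers reliable. -/
def closestPair (r K : ℕ) : Program :=
  seqs [setup K, sortPoints r Primitive.xLe 10 11 12 13, sortPoints r Primitive.yLe 14 15 16 17,
    sweep r, .copy 0 8, .copy 1 9]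

/-- The factor in front of `n * log n` in the running time of `closestPair`. -/
def timeFactor (r : ℕ) : ℕ := 416 * askTime r + 8300

theorem closestPair_time_le {r w ℓ n : ℕ} (hℓ : ℓ ≤ w) (hw : 1 ≤ w) (hn : 2 ≤ n) :
    n * 40 + 40 + 2 * sortTime r w n + sweepTime r w ℓ n + 20 ≤ timeFactor r * (n * w) := by
  unfold timeFactor
  generalize hq : askTime r = q
  have h1 : insertTime r w ≤ (64 * q + 1616) * w := by
    simp only [insertTime, walkTime, hq]; nlinarith
  have h2 : sureTime r (16 * w) ≤ (16 * q + 100) * w := by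
    simp only [sureTime, hq]; nlinarith
  have h3 : treeTime ℓ ≤ 120 * w := by
    simp only [treeTime]; omega
  have h4 : checkTime r w ℓ ≤ (64 * q + 1020) * w := by
    simp only [checkTime]; nlinarith
  have h5 : sweepStepTime r w ℓ + 1 ≤ (144 * q + 2421) * w := by
    simp only [sweepStepTime]; nlinarith
  have h6 := Nat.mul_le_mul_left n (show insertTime r w + 30 ≤ (64 * q + 1646) * w by nlinarith)
  have h7 := Nat.mul_le_mul_left (2 * n) h5
  have h8 : n ≤ n * w := Nat.le_mul_of_pos_right n hw
  simp only [sortTime, sweepTime]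
  nlinarith

section Correctness

variable {n : ℕ} {P : Fin n → Plane} {e : ℕ → Bool} {m : Mem}

theorem wp_closestPair {r K ℓ : ℕ} (hK : 1 ≤ K) (hn : 2 ≤ n) (hℓ : n ≤ 2 ^ ℓ)
    (hℓ' : 2 ^ ℓ < 2 * n) (hr : Reliable r (K * ℓ) e) (h0 : m.var 0 = n) (ha : ∀ B v, m.arr B v = 0)
    (hc : m.calls = 0) {Q : Mem → Prop}
    (hQ : ∀ m' (a b : Fin n), m'.var 0 = (a : ℕ) → m'.var 1 = (b : ℕ) → IsClosestPair P a b →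
      m'.time ≤ m.time + timeFactor r * (n * (K * ℓ)) → Q m') :
    wp P e (closestPair r K) Q m := by
  simp only [closestPair, seqs, wp]
  refine wp_setup (m := m.tick) hn h0 (ha 19) fun m₁ ℓ₁ one_le hle hlt v0 v1 v2 v3 v4 h19 ha₁ hc₁ ht₁ => ?_
  -- There is only one power of two from n up to, but excluding, 2 n.
  obtain rfl : ℓ₁ = ℓ := by
    rcases lt_trichotomy ℓ₁ ℓ with h | h | h
    · have := Nat.pow_le_pow_right (n := 2) (by norm_num) (Nat.succ_le_of_lt h)
      rw [pow_succ] at this; omega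
    · exact h
    · have := Nat.pow_le_pow_right (n := 2) (by norm_num) (Nat.succ_le_of_lt h)
      rw [pow_succ] at this; omega
  have hw : ℓ₁ ≤ K * ℓ₁ := Nat.le_mul_of_pos_left _ hK
  have hnw : n < 2 ^ (8 * (K * ℓ₁)) :=
    hle.trans_lt (Nat.pow_lt_pow_right (by norm_num) (by omega))
  refine wp_sortPoints (m := m₁.tick) (j := 0) (orderQuery_xLe P) hr (by norm_num) (by norm_num)
    (by norm_num)
    (by norm_num) (by decide) v0 v1 v2 v3 (by simpa using hc₁.trans hc) hnw
    fun m₂ j₂ s₂ s₂' _ ha₂ hv₂ hc₂ ht₂ => ?_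
  refine wp_sortPoints (m := m₂.tick) (j := j₂) (orderQuery_yLe P) hr (by norm_num) (by norm_num)
    (by norm_num)
    (by norm_num) (by decide) ((hv₂ 0 (by norm_num)).trans v0) ((hv₂ 1 (by norm_num)).trans v1)
    ((hv₂ 2 (by norm_num)).trans v2) ((hv₂ 3 (by norm_num)).trans v3) hc₂ hnw
    fun m₃ j₃ s₃ s₃' hdown ha₃ hv₃ hc₃ ht₃ => ?_
  have hv : ∀ y < 5, m₃.var y = m₁.var y := fun y hy => (hv₃ y hy).trans (hv₂ y hy)
  have harr : ∀ B v, 18 ≤ B → m₃.arr B v = m₁.arr B v := by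
    intro B v hB
    have h1 := ha₃ B v (by omega) (by simp; omega)
    have h2 := ha₂ B v (by omega) (by simp; omega)
    exact h1.trans h2
  have h10 : m₃.arr 10 = m₂.arr 10 := funext fun v => ha₃ 10 v le_rfl (by decide)
  have h11 : m₃.arr 11 = m₂.arr 11 := funext fun v => ha₃ 11 v (by norm_num) (by decide)
  refine wp_sweep (m := m₃.tick) (w := K * ℓ₁) (ℓ := ℓ₁) (j := j₃) hr hn
    ⟨(hv 0 (by norm_num)).trans v0, (hv 1 (by norm_num)).trans v1,
      (hv 2 (by norm_num)).trans v2, (hv 3 (by norm_num)).trans v3,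
      (hv 4 (by norm_num)).trans v4, hle, fun v hv => (harr 19 v (by norm_num)).trans (h19 v hv),
      ?_, s₃, s₃', hdown, fun v => ?_, fun v => ?_⟩ hc₃
    fun m₄ a b h8 h9 hab ht₄ => hQ _ a b ?_ ?_ hab ?_
  · simpa [h10, h11] using s₂
  · exact (harr 20 v (by norm_num)).trans ((ha₁ 20 v (by norm_num)).trans (ha 20 v))
  · exact (harr 21 v (by norm_num)).trans ((ha₁ 21 v (by norm_num)).trans (ha 21 v))
  · simp [h8]
  · simp [h9]
  · have := closestPair_time_le (r := r) hw (one_le.trans hw) hn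
    simp at ht₁ ht₂ ht₃ ht₄ ⊢
    omega

theorem detStep_iterate_of_halted {s : Config} (hs : s.todo = []) (t : ℕ) :
    (detStep P e)^[t] s = s := by
  refine Function.iterate_fixed ?_ t
  unfold detStep
  rw [hs]

theorem hasFoundClosestPair_of_reliable {r K ℓ t : ℕ} (hK : 1 ≤ K) (hn : 2 ≤ n) (hℓ : n ≤ 2 ^ ℓ)
    (hℓ' : 2 ^ ℓ < 2 * n) (hr : Reliable r (K * ℓ) e)
    (ht : timeFactor r * (n * (K * ℓ)) ≤ t) :
    HasFoundClosestPair P ((detStep P e)^[t] (Config.init (closestPair r K) n)) := by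
  obtain ⟨t₀, m', ⟨a, b, ha, hb, hab, hle⟩, htime, hrun⟩ := Runs.of_wp
    (wp_closestPair (P := P) (m := ⟨Function.update (fun _ => 0) 0 n, fun _ _ => 0, 0, 0⟩)
      (Q := fun m' => ∃ a b : Fin n, m'.var 0 = (a : ℕ) ∧ m'.var 1 = (b : ℕ) ∧
        IsClosestPair P a b ∧ m'.time ≤ timeFactor r * (n * (K * ℓ)))
      hK hn hℓ hℓ' hr (by simp) (fun _ _ => rfl) rfl
      fun m' a b ha hb hab h => ⟨a, b, ha, hb, hab, by simpa using h⟩)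
  have hrun' : (detStep P e)^[t₀] (Config.init (closestPair r K) n) = m'.cfg [] := hrun []
  simp only [zero_add] at htime
  obtain ⟨d, rfl⟩ := Nat.exists_eq_add_of_le (show t₀ ≤ t by omega)
  rw [add_comm, Function.iterate_add_apply, hrun', detStep_iterate_of_halted rfl]
  exact ⟨rfl, a, b, ha, hb, hab⟩

end Correctness

/-! ### Choice of the constants -/

/-- The difference 1 - `meanWeight p` equals 2 (p - 1/2)^2. -/
theorem meanWeight_lt_one {p : ℝ} (hp : p < 1 / 2) : meanWeight p < 1 := by
  unfold meanWeight; nlinarith [mul_self_pos.2 (sub_ne_zero.2 hp.ne)]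

theorem exists_blockLength {p : ℝ} (hp0 : 0 < p) (hp : p < 1 / 2) :
    ∃ r : ℕ, 0 < r ∧ 2 ^ 16 * ENNReal.ofReal (meanWeight p) ^ r ≤ ENNReal.ofReal (1 / 2) := by
  have h0 : 0 ≤ meanWeight p := by unfold meanWeight; nlinarith
  obtain ⟨r, hr⟩ := exists_pow_lt_of_lt_one (show (0 : ℝ) < 1 / 2 ^ 17 by positivity)
    (meanWeight_lt_one hp)
  refine ⟨r, ?_, ?_⟩
  · rcases Nat.eq_zero_or_pos r with rfl | h
    · norm_num at hr
    · exact h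
  · rw [← ENNReal.ofReal_pow h0,
      show (2 ^ 16 : ENNReal) = ENNReal.ofReal (2 ^ 16) by
        rw [ENNReal.ofReal_pow (by norm_num)]; norm_num,
      ← ENNReal.ofReal_mul (by positivity)]
    apply ENNReal.ofReal_le_ofReal
    norm_num at hr ⊢
    linarith

/-- The running time contains the factor K, while K has to be large enough for the union bound over
the running time. With K = s + d for the appropriate d, the exponential 2^s dominates and resolves
this circularity. -/
theorem exists_mul_add_le_two_pow (A d : ℕ) : ∃ s : ℕ, A * (s + d) ≤ 2 ^ s := by
  -- With B = A (2 + d), the power 2^(2 B) is the square of 2^B ≥ B, and B² suffices.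
  refine ⟨2 * (A * (2 + d)), ?_⟩
  have h := (Nat.lt_two_pow_self (n := A * (2 + d))).le
  rw [two_mul, pow_add]
  rcases Nat.eq_zero_or_pos A with rfl | hA
  · simp
  · refine le_trans ?_ (Nat.mul_le_mul h h)
    have : d ≤ d * (A * (2 + d)) := Nat.le_mul_of_pos_right d (by positivity)
    nlinarith

/-- From 2^ℓ < 2 n ≤ n² one gets ℓ log 2 ≤ 2 log n, and 2 / log 2 < 3. -/
theorem clog_le_three_mul_log {n ℓ : ℕ} (hn : 2 ≤ n) (hℓ : 2 ^ ℓ < 2 * n) :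
    (ℓ : ℝ) ≤ 3 * Real.log n := by
  have h2 : (2 : ℝ) ≤ n := by exact_mod_cast hn
  have h1 : (2 : ℝ) ^ ℓ ≤ (n : ℝ) ^ 2 := by
    have : (2 : ℝ) ^ ℓ < 2 * n := by exact_mod_cast hℓ
    nlinarith
  have := Real.log_le_log (by positivity) h1
  rw [Real.log_pow, Real.log_pow] at this
  push_cast at this
  have := Real.log_two_gt_d9
  have h0 : (0 : ℝ) ≤ ℓ := by positivity
  nlinarith

/-- The power 2^(K ℓ) is at least n^K = n^(s + 2) n^d: the first factor pays for the union over the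
running time, and the second gives the required probability. -/
theorem failureBound_le {n ℓ t s K d : ℕ} {c : ℝ} (hn : 2 ≤ n) (hℓ : n ≤ 2 ^ ℓ)
    (hK : K = s + (d + 2)) (hc : c ≤ d) (ht : t + 1 ≤ n ^ (s + 2)) :
    ((t : ENNReal) + 1) * ENNReal.ofReal (1 / 2) ^ (K * ℓ) ≤
      ENNReal.ofReal (1 / (n : ℝ) ^ c) := by
  have hn0 : (0 : ℝ) < n := by positivity
  have hn1 : (1 : ℝ) ≤ n := by exact_mod_cast (by omega : 1 ≤ n)
  rw [← ENNReal.ofReal_pow (by norm_num), show (t : ENNReal) + 1 = ENNReal.ofReal (t + 1 : ℝ) by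
    rw [ENNReal.ofReal_add (by positivity) (by norm_num)]; simp,
    ← ENNReal.ofReal_mul (by positivity)]
  apply ENNReal.ofReal_le_ofReal
  have h1 : (t : ℝ) + 1 ≤ (n : ℝ) ^ (s + 2) := by exact_mod_cast ht
  have h2 : (n : ℝ) ^ K ≤ 2 ^ (K * ℓ) := by
    rw [mul_comm, pow_mul]
    exact pow_le_pow_left₀ hn0.le (by exact_mod_cast hℓ) K
  have h3 : (n : ℝ) ^ c ≤ (n : ℝ) ^ d := by
    rw [← Real.rpow_natCast]
    exact Real.rpow_le_rpow_of_exponent_le hn1 hc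
  have h4 : (0 : ℝ) < (n : ℝ) ^ c := Real.rpow_pos_of_pos hn0 c
  rw [one_div, inv_pow, ← div_eq_mul_inv, div_le_div_iff₀ (by positivity) h4, one_mul]
  calc ((t : ℝ) + 1) * (n : ℝ) ^ c ≤ (n : ℝ) ^ (s + 2) * (n : ℝ) ^ d := by gcongr
    _ = (n : ℝ) ^ K := by rw [← pow_add, hK]; congr 1; ring
    _ ≤ 2 ^ (K * ℓ) := h2

theorem Noise.ErrorAtMost.mono {ν : Noise} {p p' : ℝ} (h : ν.ErrorAtMost p) (hp : p ≤ p') :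
    ν.ErrorAtMost p' := fun k q => (h k q).trans (ENNReal.ofReal_le_ofReal hp)

end NoisyGeometry

open NoisyGeometry in
theorem mainTheorem9 (p : ℝ) (hp0 : 0 ≤ p) (hp : p < 1 / 2) (c : ℝ) (hc : 1 ≤ c) :
    ∃ (prog : NoisyGeometry.Program) (C : ℝ), 0 < C ∧
      ∀ (n : ℕ), 2 ≤ n → ∀ (P : Fin n → NoisyGeometry.Plane) (ν : NoisyGeometry.Noise),
        ν.ErrorAtMost p →
        (NoisyGeometry.run prog P ν ⌊C * n * Real.log n⌋₊).toOuterMeasure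
            {s | ¬ NoisyGeometry.HasFoundClosestPair P s}
          ≤ ENNReal.ofReal (1 / (n : ℝ) ^ c) := by
  -- The weight 1 / (2 p) needs p > 0. Enlarging the error bound is harmless.
  have hp' : max p (1 / 4) < 1 / 2 := max_lt hp (by norm_num)
  have hp0' : 0 < max p (1 / 4) := lt_max_of_lt_right (by norm_num)
  obtain ⟨r, hr, hblock⟩ := exists_blockLength hp0' hp'
  obtain ⟨d, hd⟩ := exists_nat_ge c
  -- The number s depends only on r and d, and it makes 4 * `timeFactor r` * K at most 2^s, hence at
  -- most n^s for all n ≥ 2.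
  obtain ⟨s, hs⟩ := exists_mul_add_le_two_pow (4 * timeFactor r) (d + 2)
  set K := s + (d + 2) with hK
  have hA : 0 < timeFactor r := by unfold timeFactor; positivity
  -- The factor 3 converts ℓ into the natural logarithm.
  refine ⟨closestPair r K, 3 * timeFactor r * K, by positivity, fun n hn P ν hν => ?_⟩
  set t := ⌊3 * timeFactor r * K * n * Real.log n⌋₊ with ht
  have hn0 : n ≠ 0 := by omega
  have hℓ : n ≤ 2 ^ Nat.clog 2 n := Nat.le_pow_clog (by norm_num) n
  have hpos : 0 < Nat.clog 2 n := Nat.clog_pos (by norm_num) hn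
  have hℓ' : 2 ^ Nat.clog 2 n < 2 * n := by
    have := Nat.pow_pred_clog_lt_self (b := 2) (by norm_num) (x := n) (by omega)
    obtain ⟨g, hg⟩ : ∃ g, Nat.clog 2 n = g + 1 := ⟨Nat.clog 2 n - 1, by omega⟩
    rw [hg] at this ⊢
    rw [pow_succ]
    simp only [Nat.pred_eq_sub_one, Nat.add_sub_cancel] at this
    omega
  have hlog := clog_le_three_mul_log hn hℓ'
  generalize Nat.clog 2 n = ℓ at hℓ hℓ' hlog hpos
  have htime : timeFactor r * (n * (K * ℓ)) ≤ t := by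
    apply Nat.le_floor
    push_cast
    calc (timeFactor r : ℝ) * (n * (K * ℓ)) ≤ timeFactor r * (n * (K * (3 * Real.log n))) := by
          gcongr
      _ = _ := by ring
  -- The crude bound log n ≤ n is enough here; the factor 4 in place of 3 absorbs the summand 1.
  have ht' : t + 1 ≤ n ^ (s + 2) := by
    have h1 : t ≤ 3 * timeFactor r * K * n * n := by
      apply Nat.floor_le_of_le
      push_cast
      have := (Real.log_le_sub_one_of_pos (show (0 : ℝ) < n by positivity))
      gcongr
      linarith
    have h2 : 1 ≤ timeFactor r * K * n * n := Nat.succ_le_of_lt (by positivity)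
    have h3 := Nat.pow_le_pow_left hn s
    calc t + 1 ≤ (4 * timeFactor r * K) * n ^ 2 := by nlinarith
      _ ≤ n ^ s * n ^ 2 := Nat.mul_le_mul_right _ (hs.trans h3)
      _ = n ^ (s + 2) := by rw [pow_add]
  calc _ ≤ ((t : ENNReal) + 1) *
        (2 ^ 16 * ENNReal.ofReal (meanWeight (max p (1 / 4))) ^ r) ^ (K * ℓ) :=
        failure_le P ν hp0' hp' (hν.mono (le_max_left _ _)) _ t r (K * ℓ) hr (by positivity) _
          fun e he => hasFoundClosestPair_of_reliable (by omega) hn hℓ hℓ' he htime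
    _ ≤ ((t : ENNReal) + 1) * ENNReal.ofReal (1 / 2) ^ (K * ℓ) := by gcongr
    _ ≤ _ := failureBound_le hn hℓ hK hd ht'
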